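/- Let $(\Omega,\mathcal F,\mathbb F=(\mathcal F_t)_{t\ge 0},\mathsf P)$ be a filtered probability space and let $X$ be an upwards skip-free Lévy chain relative to $\mathbb F$, with all sample paths càdlàg. That is, for some $h>0$, $X$ is a compound Poisson process ($\mathbb F$-adapted, $X_0=0$ a.s., with stationary increments that are independent relative to $\mathbb F$) whose Lévy measure $\lambda$ (a finite measure with $\lambda(\{0\})=0$) satisfies $\mathrm{supp}(\lambda)\subset\mathbb Z_h:=\{kh:k\in\mathbb Z\}$ and $\mathrm{supp}(\lambda|_{(0,\infty)})=\{h\}$; thus $\mathsf E[e^{ipX_t}]=\exp\{t\int(e^{ipx}-1)\lambda(dx)\}$. Put $\psi(\beta):=\int_{\mathbb R}(e^{\beta x}-1)\lambda(dx)$ for $\beta\ge 0$, and for $q\ge 0$ let $\Phi(q)$ be the largest root in $[0,\infty)$ of $\psi=q$. Put $T_y:=\inf\{t\ge 0:X_t\ge y\}\in[0,\infty]$ and $\underline X_t:=\inf\{X_s:0\le s\le t\}$, with $\underline X_\infty:=\inf_{s\ge 0}X_s$; let $e^{-qT_y}:=0$ if $T_y=\infty$ and $q>0$, and $e^{-qT_y}:=1$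 if $q=0$. Let $\mathbb D_h$ be the space of càdlàg paths $[0,\infty)\to\mathbb Z_h$ with the $\sigma$-algebra and the natural filtration of the evaluation maps. For $c\ge 0$ let $\mathsf P_c$ be the unique measure on $\mathbb D_h$ that satisfies, for all $t\ge 0$ and all $\Lambda\subset\mathbb D_h$ in the $\sigma$-algebra generated by the evaluations up to time $t$, $\mathsf P_c(\Lambda)=\mathsf E[\exp\{cX_t-\psi(c)t\}\mathbf 1_{\{X\in\Lambda\}}]$. Under $\mathsf P_c$ the coordinate process is again an upwards skip-free Lévy chain, with Laplace exponent $\psi_c$, $\psi_c(\beta)=\log\mathsf E_c[e^{\beta X_1}]$; let $\Phi_c(0)$ be the largest root of $\psi_c$ in $[0,\infty)$. With $D_1:=-\underline X_{T_h}$ (the depth of the excursion below $0$ before the level $h$ is attained), let $$W_c(x):=k_c\Big/\prod_{r=1}^{\lfloor x/h\rfloor}\mathsf P_c(D_1\le (r-1)h)\qquad(x\ge 0)$$ be the scale function of the coordinate process under $\mathsf P_c$, where the constant $k_c>0$ is determined by the normalization $\int_0^\infty e^{-\beta x}W_c(x)\,dx=\frac{e^{\beta h}-1}{\beta h\psi_c(\beta)}$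 for $\beta>\Phi_c(0)$. Finally, for $q\ge 0$, define the $q$-scale function $$W^{(q)}(x):=e^{\Phi(q)\lfloor 1+x/h\rfloor h}\,W_{\Phi(q)}(x)\qquad(x\ge 0).$$ **Theorem.** For each $q\ge 0$, $W^{(q)}:[0,\infty)\to[0,\infty)$ is the unique right-continuous and piecewise continuous function $[0,\infty)\to[0,\infty)$ of exponential order (i.e. bounded by $Ae^{\alpha x}$ for some $\alpha,A\ge 0$) with Laplace transform $$\int_0^\infty e^{-\beta x}W^{(q)}(x)\,dx=\frac{e^{\beta h}-1}{\beta h(\psi(\beta)-q)}\qquad(\beta>\Phi(q)).$$ Moreover, for all $y\in\mathbb Z_h$ with $y\ge 0$ and all $x\ge 0$, $$\mathsf E\big[e^{-qT_y}\mathbf 1_{\{\underline X_{T_y}\ge -x\}}\big]=\frac{W^{(q)}(x)}{W^{(q)}(x+y)}.$$ -/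

import Mathlib

open MeasureTheory ProbabilityTheory Filter Set
open scoped NNReal ENNReal Topology

noncomputable section

/-! ### Upwards skip-free Lévy chains -/

/-- A càdlàg path `[0,∞) → ℝ`: right-continuous with (finite) left limits. -/
def IsCadlagPath (w : ℝ≥0 → ℝ) : Prop :=
  ∀ t, ContinuousWithinAt w (Ici t) t ∧ ∃ l, Tendsto w (𝓝[<] t) (𝓝 l)

/-- A real Lévy process relative to the filtration `𝔽`, all of whose sample paths are càdlàg. -/
structure IsLevyProcess {Ω : Type*} [mΩ : MeasurableSpace Ω] (P : Measure Ω)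
    (𝔽 : Filtration ℝ≥0 mΩ) (X : ℝ≥0 → Ω → ℝ) : Prop where
  adapted : Adapted 𝔽 X
  cadlag : ∀ ω, IsCadlagPath (fun t => X t ω)
  zero : ∀ᵐ ω ∂P, X 0 ω = 0
  stationary : ∀ s t, IdentDistrib (fun ω => X (s + t) ω - X s ω) (X t) P P
  indep : ∀ s t,
    Indep (MeasurableSpace.comap (fun ω => X (s + t) ω - X s ω) inferInstance) (𝔽 s) P

/-- The lattice `ℤ_h = {k h : k ∈ ℤ}`. -/
def latticeZ (h : ℝ) : Set ℝ := Set.range (fun k : ℤ => (k : ℝ) * h)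

/-- `X` is an upwards skip-free Lévy chain with lattice span `h` and Lévy measure `ν`: a compound
Poisson process whose (finite) Lévy measure lives on `ℤ_h` and charges, in `(0,∞)`, precisely
the point `h`. Its characteristic exponent is `p ↦ ∫ (e^{ipx} - 1) ν(dx)`. -/
structure IsUpwardsSkipFreeLevyChain {Ω : Type*} [mΩ : MeasurableSpace Ω] (P : Measure Ω)
    (𝔽 : Filtration ℝ≥0 mΩ) (X : ℝ≥0 → Ω → ℝ) (h : ℝ) (ν : Measure ℝ) : Prop
    extends IsLevyProcess P 𝔽 X where
  h_pos : 0 < h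
  finite : IsFiniteMeasure ν
  no_atom_zero : ν {0} = 0
  compoundPoisson : ∀ (t : ℝ≥0) (p : ℝ), charFun (P.map (X t)) p =
    Complex.exp ((t : ℂ) * ∫ x, (Complex.exp (Complex.I * (p : ℂ) * (x : ℂ)) - 1) ∂ν)
  support_subset : ν.support ⊆ latticeZ h
  support_pos : (ν.restrict (Ioi 0)).support = {h}

/-! ### Laplace exponent, first entrance times, running infimum -/

/-- The Laplace exponent `ψ(β) = ∫ (e^{βx} - 1) ν(dx)` attached to the Lévy measure `ν`. -/
def laplaceExponent (ν : Measure ℝ) (β : ℝ) : ℝ := ∫ x, (Real.exp (β * x) - 1) ∂ν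

/-- `Φ(q)`: the largest root in `[0,∞)` of `ψ = q`. (For a strictly convex `ψ` with `ψ(0) = 0`
tending to `+∞`, this is the largest zero of `ψ` for `q = 0`, and in general the inverse of the
increasing bijection `ψ : [Φ(0),∞) → [0,∞)`.) -/
def largestRoot (ψ : ℝ → ℝ) (q : ℝ) : ℝ := sSup {β | 0 ≤ β ∧ ψ β = q}

/-- `T_y = inf {t ≥ 0 : X_t ≥ y}`, equal to `⊤ = +∞` if the level is never reached. -/
def firstEntrance {Ω : Type*} (X : ℝ≥0 → Ω → ℝ) (y : ℝ) : Ω → WithTop ℝ≥0 :=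
  hittingAfter X (Ici y) 0

/-- The infimum of the path up to (and including) the time `τ ∈ [0,∞]`; for `τ = ⊤` this is the
overall infimum. -/
def runningInf {Ω : Type*} (X : ℝ≥0 → Ω → ℝ) (τ : WithTop ℝ≥0) (ω : Ω) : EReal :=
  ⨅ s : ℝ≥0, ⨅ _ : (s : WithTop ℝ≥0) ≤ τ, (X s ω : EReal)

/-- `e^{-qτ}` for `τ ∈ [0,∞]`, with `e^{-∞} = 0` and `0 · ∞ = 0`. -/
def discount (q : ℝ) : WithTop ℝ≥0 → ℝ
  | ⊤ => if q = 0 then 1 else 0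
  | (t : ℝ≥0) => Real.exp (-q * t)

/-! ### Canonical path space and the exponential change of measure -/

/-- `𝔻_h`: càdlàg paths `[0,∞) → ℤ_h`, with the σ-algebra of the evaluation maps (the one
inherited from the product σ-algebra). -/
abbrev PathSpace (h : ℝ) : Type :=
  {w : ℝ≥0 → ℝ // IsCadlagPath w ∧ ∀ t, w t ∈ latticeZ h}

/-- The coordinate process on `𝔻_h`. -/
def coord (h : ℝ) (t : ℝ≥0) (w : PathSpace h) : ℝ := w.1 t

/-- The σ-algebra `σ(pr_s : s ≤ t)` on `𝔻_h`. -/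
@[reducible] def coordSigma (h : ℝ) (t : ℝ≥0) : MeasurableSpace (PathSpace h) :=
  ⨆ s : Iic t, MeasurableSpace.comap (coord h s) inferInstance

/-- The zero path. -/
def zeroPath (h : ℝ) : PathSpace h :=
  ⟨fun _ => 0, fun _ => ⟨continuousWithinAt_const, 0, tendsto_const_nhds⟩,
    fun _ => ⟨0, by simp⟩⟩

open Classical in
/-- The sample path of `X` as an element of `𝔻_h`. The sample paths of an upwards skip-free Lévy
chain lie in `𝔻_h` almost surely; on the exceptional event the zero path is used. -/
def samplePath {Ω : Type*} (h : ℝ) (X : ℝ≥0 → Ω → ℝ) (ω : Ω) : PathSpace h :=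
  if hw : IsCadlagPath (fun t => X t ω) ∧ ∀ t, X t ω ∈ latticeZ h
  then ⟨fun t => X t ω, hw⟩ else zeroPath h

/-- The law of `X` on `𝔻_h`. -/
def pathLaw {Ω : Type*} [MeasurableSpace Ω] (P : Measure Ω) (h : ℝ) (X : ℝ≥0 → Ω → ℝ) :
    Measure (PathSpace h) := P.map (samplePath h X)

/-- `ρ` is the exponential change of measure of `μ` with parameter `c`:
`ρ(Λ) = E_μ[exp (c X_t - ψ(c) t) 1_Λ]` for all `t ≥ 0` and `Λ ∈ σ(pr_s : s ≤ t)`. -/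
def IsEsscherTransform {h : ℝ} (ψ : ℝ → ℝ) (c : ℝ) (μ ρ : Measure (PathSpace h)) : Prop :=
  ∀ (t : ℝ≥0) (Λ : Set (PathSpace h)), MeasurableSet[coordSigma h t] Λ →
    ρ Λ = ∫⁻ w in Λ, ENNReal.ofReal (Real.exp (c * coord h t w - ψ c * t)) ∂μ

open Classical in
/-- The measure `P_c` on `𝔻_h` (a measure determined by `IsEsscherTransform`). -/
def esscherMeasure {h : ℝ} (ψ : ℝ → ℝ) (c : ℝ) (μ : Measure (PathSpace h)) :
    Measure (PathSpace h) :=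
  if hρ : ∃ ρ, IsEsscherTransform ψ c μ ρ then hρ.choose else 0

/-! ### Scale functions -/

/-- The Laplace exponent read off the law `μ` of a process: `ψ_μ(β) = log E_μ[e^{β X_1}]`. -/
def lawLaplaceExponent {h : ℝ} (μ : Measure (PathSpace h)) (β : ℝ) : ℝ :=
  Real.log (∫ w, Real.exp (β * coord h 1 w) ∂μ)

/-- `D_1`: the depth of the excursion below the starting level `0` that takes place before the
new maximum `h` is attained, i.e. minus the infimum of the path up to time `T_h`. -/
def excursionDepth (h : ℝ) (w : PathSpace h) : EReal :=
  -runningInf (coord h) (firstEntrance (coord h) h w) w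

/-- The unnormalized scale function
`x ↦ 1 / ∏_{r=1}^{⌊x/h⌋} μ(D_1 ≤ (r-1)h)`, `x ≥ 0`. -/
def rawScale (h : ℝ) (μ : Measure (PathSpace h)) (x : ℝ) : ℝ :=
  1 / ∏ r ∈ Finset.range ⌊x / h⌋₊, μ.real {w | excursionDepth h w ≤ (((r : ℝ) * h : ℝ) : EReal)}

/-- `f`, as a function on `[0,∞)`, has Laplace transform
`∫_0^∞ e^{-βx} f(x) dx = (e^{βh} - 1) / (βh(ψ(β) - q))` for all `β > Φ(q)`
(`Φ` being the `largestRoot` map of `ψ`), the integrals being convergent. -/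
def HasScaleLaplaceTransform (h : ℝ) (ψ : ℝ → ℝ) (q : ℝ) (f : ℝ → ℝ) : Prop :=
  ∀ β, largestRoot ψ q < β →
    IntegrableOn (fun x => Real.exp (-β * x) * f x) (Ioi 0) ∧
    ∫ x in Ioi (0 : ℝ), Real.exp (-β * x) * f x
      = (Real.exp (β * h) - 1) / (β * h * (ψ β - q))

open Classical in
/-- The multiplicative constant that normalizes the scale function so that its Laplace transform
is `(e^{βh} - 1) / (βhψ(β))` for `β > Φ(0)`. -/
def scaleConst (h : ℝ) (μ : Measure (PathSpace h)) : ℝ :=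
  if hk : ∃ k : ℝ, 0 < k ∧
      HasScaleLaplaceTransform h (lawLaplaceExponent μ) 0 (fun x => k * rawScale h μ x)
  then hk.choose else 0

/-- The (normalized) scale function `W` of the coordinate process under `μ`. -/
def scaleFunction (h : ℝ) (μ : Measure (PathSpace h)) (x : ℝ) : ℝ :=
  scaleConst h μ * rawScale h μ x

/-- `W^{(q)}(x) = e^{Φ(q) ⌊1 + x/h⌋ h} W_{Φ(q)}(x)`, `x ≥ 0`, where `W_c` is the scale function of
the coordinate process under `P_c`. Here `μ` is the law of the chain on `𝔻_h` and `ν` its Lévy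
measure. -/
def qScaleFunction (h : ℝ) (ν : Measure ℝ) (μ : Measure (PathSpace h)) (q x : ℝ) : ℝ :=
  Real.exp (largestRoot (laplaceExponent ν) q * ⌊1 + x / h⌋₊ * h) *
    scaleFunction h
      (esscherMeasure (laplaceExponent ν) (largestRoot (laplaceExponent ν) q) μ) x

/-! ### The class of functions in which the scale functions are characterized -/

/-- Piecewise continuity on `[0,∞)`: finitely many discontinuities on each bounded interval, and
finite one-sided limits. -/
def IsPiecewiseContinuous (f : ℝ → ℝ) : Prop :=
  (∀ R, {x ∈ Icc 0 R | ¬ ContinuousWithinAt f (Ici 0) x}.Finite) ∧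
  (∀ x, 0 < x → ∃ l, Tendsto f (𝓝[<] x) (𝓝 l)) ∧
  (∀ x, 0 ≤ x → ∃ l, Tendsto f (𝓝[>] x) (𝓝 l))

/-- `f(x) ≤ A e^{αx}` for all `x ≥ 0`, for some `α, A ≥ 0`. -/
def IsOfExponentialOrder (f : ℝ → ℝ) : Prop :=
  ∃ α A : ℝ, 0 ≤ α ∧ 0 ≤ A ∧ ∀ x, 0 ≤ x → f x ≤ A * Real.exp (α * x)

/-- `f : [0,∞) → [0,∞)` (the values on `(-∞,0)` being irrelevant) is right-continuous, piecewise
continuous, of exponential order and has the Laplace transform of the `q`-scale function. -/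
structure IsScaleSolution (h : ℝ) (ψ : ℝ → ℝ) (q : ℝ) (f : ℝ → ℝ) : Prop where
  nonneg : ∀ x, 0 ≤ x → 0 ≤ f x
  rightCont : ∀ x, 0 ≤ x → ContinuousWithinAt f (Ici x) x
  piecewise : IsPiecewiseContinuous f
  expOrder : IsOfExponentialOrder f
  laplace : HasScaleLaplaceTransform h ψ q f

end

/-! ### Compound Poisson laws -/

/-! Everything reduces to one sequence `W_k`, namely `scaleSeq`, the value of the `q`-scale function
on `[kh, (k+1)h)`. Let `u(k, m)` (`passageMean`) be the mean of `e^{-qT}`, with `T` the entrance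
time into `[mh, ∞)`, over paths that do not go below `-kh` up to `T`. In a short time `t` the chain
jumps at most once, up to probability `O(t²)`, so the Markov property and the generator give the
backward equation `q u = ∫ (V - u) dν`, where `V` is the value of the problem after a jump
(`mul_passageMean_eq_integral`).

Upward jumps have the single size `h`, so on each diagonal `k + m = N` this equation expresses
`u(k+1, N-k-1)` through `u(j, N-j)` with `j ≤ k`. Such a recurrence has a one-dimensional space of
solutions. Hence `u(k, N-k)` is a multiple of `W_k`, and `u(N, 0) = 1` fixes the multiple: `u(k, m)
= W_k / W_{k+m}` (`passageMean_eq_div`). Paths that never reach the level need no separate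
treatment, since the recurrence and its end value already determine `u`.

The ratios `W_k / W_{k+1} = u(k, 1)` are at most `1` and increase with `k`; let `R` be their limit.
The generating function `S(z)` of `W` therefore converges for `0 < z < R` and blows up at `R`. The
recurrence gives `S(z) z (ψ(β) - q) = 1/h` at `z = e^{-βh}`. So `ψ - q` is positive as long as
`e^{-βh} < R` and vanishes at `e^{-βh} = R`, which identifies `Φ(q) = -log R / h` and yields the
Laplace transform exactly on `β > Φ(q)` (`hasScaleLaplaceTransform`). Uniqueness is injectivity of
the Laplace transform together with right-continuity (`IsScaleSolution.eqOn`).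

It remains to recognize `W` in the definition through `P_c`, `c = Φ(q)`. The measure `P_c` is built
by concatenating independent tilted unit-time blocks (`tiltedPathLaw`); under it the chain has jump
measure `e^{cx} ν(dx)`. The product of the `P_c(D_1 ≤ (r-1)h)` telescopes to a ratio of terms of the
scale sequence of that measure at killing rate `0` (`rawScale_eq`), and multiplication by
`e^{c(k+1)h}` turns this sequence into the one of `ν` at rate `ψ(c) = q`
(`exp_mul_scaleSeq_expTilt`). -/

/-- Convolution powers of a measure on the line. -/
noncomputable def convPow (ν : Measure ℝ) : ℕ → Measure ℝ
  | 0 => Measure.dirac 0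
  | n + 1 => (convPow ν n).conv ν

instance convPow_isFinite (ν : Measure ℝ) [IsFiniteMeasure ν] (n : ℕ) :
    IsFiniteMeasure (convPow ν n) := by
  induction n with
  | zero => unfold convPow; infer_instance
  | succ n ih => unfold convPow; infer_instance

/-- The Poisson weights of intensity `l t`, multiplied by `l ^ (-n)`. -/
noncomputable def poissonWeight (l : ℝ) (t : ℝ≥0) (n : ℕ) : ℝ :=
  Real.exp (-(l * t)) * ((t : ℝ) ^ n / n.factorial)

lemma poissonWeight_nonneg (l : ℝ) (t : ℝ≥0) (n : ℕ) : 0 ≤ poissonWeight l t n := by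
  unfold poissonWeight; positivity

/-- The compound Poisson law at time `t` with Lévy measure `ν`. -/
noncomputable def compoundPoissonLaw (ν : Measure ℝ) (t : ℝ≥0) : Measure ℝ :=
  Measure.sum fun n => ENNReal.ofReal (poissonWeight (ν.real univ) t n) • convPow ν n

lemma integrable_exp_convPow {ν : Measure ℝ} [IsFiniteMeasure ν] {c : ℝ}
    (hc : Integrable (fun x => Real.exp (c * x)) ν) (n : ℕ) :
    Integrable (fun x => Real.exp (c * x)) (convPow ν n) ∧
      ∫ x, Real.exp (c * x) ∂(convPow ν n) = (∫ x, Real.exp (c * x) ∂ν) ^ n := by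
  induction n with
  | zero =>
    unfold convPow
    exact ⟨integrable_dirac (by simp), by simp⟩
  | succ n ih =>
    have hint : Integrable (fun x => Real.exp (c * x)) ((convPow ν n).conv ν) := by
      unfold Measure.conv
      rw [integrable_map_measure (by fun_prop) (by fun_prop)]
      have := ih.1.mul_prod hc
      refine this.congr (Eventually.of_forall fun z => ?_)
      simp [mul_add, Real.exp_add]
    refine ⟨hint, ?_⟩
    unfold convPow
    rw [integral_conv hint]
    simp only [mul_add, Real.exp_add, integral_const_mul, integral_mul_const, ih.2, pow_succ]

lemma hasSum_poissonWeight (l : ℝ) (t : ℝ≥0) (M : ℝ) :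
    HasSum (fun n => poissonWeight l t n * M ^ n) (Real.exp (t * (M - l))) := by
  have h := (NormedSpace.expSeries_div_hasSum_exp ((t : ℝ) * M)).mul_left (Real.exp (-(l * t)))
  rw [← Real.exp_eq_exp_ℝ, ← Real.exp_add] at h
  have e : (t : ℝ) * (M - l) = -(l * t) + t * M := by ring
  rw [e]
  refine h.congr_fun fun n => ?_
  unfold poissonWeight
  rw [mul_pow]; ring

lemma integrable_compoundPoissonLaw {ν : Measure ℝ} [IsFiniteMeasure ν] {c : ℝ}
    (hc : Integrable (fun x => Real.exp (c * x)) ν) (t : ℝ≥0) :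
    Integrable (fun x => Real.exp (c * x)) (compoundPoissonLaw ν t) := by
  unfold compoundPoissonLaw
  refine integrable_sum_measure (fun n => ?_) ?_
  · exact (integrable_exp_convPow hc n).1.smul_measure ENNReal.ofReal_ne_top
  · have := (hasSum_poissonWeight (ν.real univ) t (∫ x, Real.exp (c * x) ∂ν)).summable
    refine this.congr fun n => ?_
    rw [integral_smul_measure, ENNReal.toReal_ofReal (poissonWeight_nonneg _ _ _)]
    simp only [Real.norm_eq_abs, Real.abs_exp, (integrable_exp_convPow hc n).2, smul_eq_mul]

lemma hasSum_integral_compoundPoissonLaw {ν : Measure ℝ} [IsFiniteMeasure ν] {E : Type*}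
    [NormedAddCommGroup E] [NormedSpace ℝ E] {f : ℝ → E}
    (t : ℝ≥0) (hf : Integrable f (compoundPoissonLaw ν t)) :
    HasSum (fun n => poissonWeight (ν.real univ) t n • ∫ x, f x ∂(convPow ν n))
      (∫ x, f x ∂(compoundPoissonLaw ν t)) := by
  refine (hasSum_integral_measure hf).congr_fun fun n => ?_
  rw [integral_smul_measure, ENNReal.toReal_ofReal (poissonWeight_nonneg _ _ _)]

lemma integral_exp_compoundPoissonLaw {ν : Measure ℝ} [IsFiniteMeasure ν] {c : ℝ}
    (hc : Integrable (fun x => Real.exp (c * x)) ν) (t : ℝ≥0) :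
    ∫ x, Real.exp (c * x) ∂(compoundPoissonLaw ν t) = Real.exp (t * laplaceExponent ν c) := by
  have h1 := hasSum_integral_compoundPoissonLaw t (integrable_compoundPoissonLaw hc t)
  have h2 := hasSum_poissonWeight (ν.real univ) t (∫ x, Real.exp (c * x) ∂ν)
  simp only [(integrable_exp_convPow hc _).2, smul_eq_mul] at h1
  rw [h1.unique h2, laplaceExponent, integral_sub hc (integrable_const _)]
  simp

instance compoundPoissonLaw_isFinite (ν : Measure ℝ) [IsFiniteMeasure ν] (t : ℝ≥0) :
    IsFiniteMeasure (compoundPoissonLaw ν t) := by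
  have := integrable_compoundPoissonLaw (ν := ν) (c := 0) (by simp) t
  simp only [zero_mul, Real.exp_zero] at this
  exact (integrable_const_iff_isFiniteMeasure one_ne_zero).1 this

lemma charFun_convPow (ν : Measure ℝ) [IsFiniteMeasure ν] (n : ℕ) (p : ℝ) :
    charFun (convPow ν n) p = charFun ν p ^ n := by
  induction n with
  | zero => unfold convPow; simp
  | succ n ih => unfold convPow; rw [charFun_conv, ih, pow_succ]

/-- Convolution powers have characteristic function `charFun ν p ^ n`, so the Poisson mixture is an
exponential series. By uniqueness of characteristic functions this identifies the law of `X_t` with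
an explicit series, for which real exponential moments are available as well. -/
lemma charFun_compoundPoissonLaw (ν : Measure ℝ) [IsFiniteMeasure ν] (t : ℝ≥0) (p : ℝ) :
    charFun (compoundPoissonLaw ν t) p =
      Complex.exp ((t : ℂ) * ∫ x, (Complex.exp (Complex.I * (p : ℂ) * (x : ℂ)) - 1) ∂ν) := by
  have hi : ∀ μ : Measure ℝ, IsFiniteMeasure μ →
      Integrable (fun x : ℝ => Complex.exp (Complex.I * (p : ℂ) * (x : ℂ))) μ := fun μ _ => by
    refine (integrable_const (1 : ℝ)).mono (by fun_prop) (Eventually.of_forall fun x => ?_)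
    have : Complex.I * (p : ℂ) * (x : ℂ) = ((p * x : ℝ) : ℂ) * Complex.I := by push_cast; ring
    rw [this, Complex.norm_exp_ofReal_mul_I]; simp
  have hcf : ∀ μ : Measure ℝ, charFun μ p =
      ∫ x : ℝ, Complex.exp (Complex.I * (p : ℂ) * (x : ℂ)) ∂μ := fun μ => by
    rw [charFun_apply_real]
    congr 1; ext x; congr 1; ring
  have h1 := hasSum_integral_compoundPoissonLaw t (hi (compoundPoissonLaw ν t) inferInstance)
  simp only [← hcf, charFun_convPow] at h1
  have h2 := (NormedSpace.expSeries_div_hasSum_exp ((t : ℂ) * charFun ν p)).mul_left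
    (Complex.exp (-(ν.real univ * t)))
  rw [← Complex.exp_eq_exp_ℂ, ← Complex.exp_add] at h2
  rw [integral_sub (hi ν inferInstance) (integrable_const _), ← hcf]
  have e : (t : ℂ) * (charFun ν p - ∫ _ : ℝ, (1 : ℂ) ∂ν)
      = -(ν.real univ * t) + t * charFun ν p := by
    simp; ring
  rw [e]
  refine h1.unique (h2.congr_fun fun n => ?_)
  unfold poissonWeight
  rw [mul_pow, Complex.real_smul]; push_cast; ring

lemma convPow_compl_latticeZ {ν : Measure ℝ} [IsFiniteMeasure ν] {h : ℝ}
    (hν : ∀ᵐ x ∂ν, x ∈ latticeZ h) (n : ℕ) : ∀ᵐ x ∂(convPow ν n), x ∈ latticeZ h := by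
  have hm : MeasurableSet (latticeZ h) := (countable_range _).measurableSet
  induction n with
  | zero =>
    unfold convPow
    rw [ae_dirac_iff (p := (· ∈ latticeZ h)) hm]
    exact ⟨0, by simp⟩
  | succ n ih =>
    unfold convPow Measure.conv
    rw [ae_map_iff (p := (· ∈ latticeZ h)) (by fun_prop) hm]
    filter_upwards [Measure.quasiMeasurePreserving_fst.ae ih,
      Measure.quasiMeasurePreserving_snd.ae hν] with z ⟨k, hk⟩ ⟨l, hl⟩
    refine ⟨k + l, ?_⟩
    simp only [] at hk hl ⊢
    rw [← hk, ← hl]; push_cast; ring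

lemma compoundPoissonLaw_mem_latticeZ {ν : Measure ℝ} [IsFiniteMeasure ν] {h : ℝ}
    (hν : ∀ᵐ x ∂ν, x ∈ latticeZ h) (t : ℝ≥0) :
    ∀ᵐ x ∂(compoundPoissonLaw ν t), x ∈ latticeZ h := by
  unfold compoundPoissonLaw
  rw [Measure.ae_sum_iff' (p := (· ∈ latticeZ h)) (countable_range _).measurableSet]
  intro n
  exact Measure.ae_smul_measure (convPow_compl_latticeZ hν n) _

/-- The generator of a compound Poisson process, on functions of exponential growth. -/
lemma tendsto_compoundPoissonLaw_generator {ν : Measure ℝ} [IsFiniteMeasure ν] {c : ℝ}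
    (hc : Integrable (fun x => Real.exp (c * x)) ν) {f : ℝ → ℝ} (hf : Measurable f)
    (hfc : ∀ x, |f x| ≤ Real.exp (c * x)) :
    Tendsto (fun t : ℝ≥0 => (∫ x, f x ∂(compoundPoissonLaw ν t) - f 0) / t) (𝓝[>] 0)
      (𝓝 (∫ x, (f x - f 0) ∂ν)) := by
  set l := ν.real univ with hl
  set M := ∫ x, Real.exp (c * x) ∂ν with hM
  have hM0 : 0 ≤ M := integral_nonneg fun x => (Real.exp_pos _).le
  set A := ∫ x, f x ∂ν with hA
  have hfi : ∀ μ : Measure ℝ, Integrable (fun x => Real.exp (c * x)) μ → Integrable f μ :=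
    fun μ hμ => hμ.mono' hf.aestronglyMeasurable (Eventually.of_forall hfc)
  have hbound : ∀ n, |∫ x, f x ∂(convPow ν n)| ≤ M ^ n := fun n => by
    rw [hM, ← (integrable_exp_convPow hc n).2]
    exact norm_integral_le_of_norm_le (f := f) (integrable_exp_convPow hc n).1
      (Eventually.of_forall hfc)
  -- After removal of the factor `e^{-lt}`, the terms `n = 0, 1` of the series are `f 0` and `t A`.
  -- The others are dominated by those of `e^{tM}`, which makes the remainder `O(t²)`.
  have hrem : ∀ t : ℝ≥0, |Real.exp (l * t) * ∫ x, f x ∂(compoundPoissonLaw ν t) - f 0 - t * A| ≤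
      Real.exp (t * M) - 1 - t * M := fun t => by
    have h1 := (hasSum_integral_compoundPoissonLaw t
      (hfi _ (integrable_compoundPoissonLaw hc t))).mul_left (Real.exp (l * t))
    have h2 : HasSum (fun n => (t : ℝ) ^ n / n.factorial * ∫ x, f x ∂(convPow ν n))
        (Real.exp (l * t) * ∫ x, f x ∂(compoundPoissonLaw ν t)) := by
      refine h1.congr_fun fun n => ?_
      unfold poissonWeight
      rw [smul_eq_mul, ← mul_assoc, ← mul_assoc, ← Real.exp_add, ← hl]; simp
    have h3 := NormedSpace.expSeries_div_hasSum_exp ((t : ℝ) * M)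
    rw [← Real.exp_eq_exp_ℝ] at h3
    have h2' := (hasSum_nat_add_iff' 2).2 h2
    have h3' := (hasSum_nat_add_iff' 2).2 h3
    have e1 : convPow ν 1 = ν := by simp [convPow, Measure.dirac_zero_conv]
    have e0 : ∫ x, f x ∂(convPow ν 0) = f 0 := by simp [convPow]
    simp only [Finset.sum_range_succ, Finset.sum_range_zero, e1, e0] at h2' h3'
    have := tsum_of_norm_bounded h3' (f := fun n => (t : ℝ) ^ (n + 2) / (n + 2).factorial *
      ∫ x, f x ∂(convPow ν (n + 2))) fun n => by
        rw [norm_mul, mul_pow, Real.norm_eq_abs, Real.norm_eq_abs, abs_of_nonneg (by positivity),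
          mul_div_right_comm]
        exact mul_le_mul_of_nonneg_left (hbound _) (by positivity)
    rw [h2'.tsum_eq] at this
    convert this using 1
    · rw [Real.norm_eq_abs]; congr 1; simp; ring
    · simp; ring
  have hcoe : Tendsto (fun t : ℝ≥0 => (t : ℝ)) (𝓝[>] 0) (𝓝[>] 0) := by
    refine tendsto_nhdsWithin_iff.2 ⟨?_, ?_⟩
    · exact (NNReal.continuous_coe.tendsto' 0 0 (by simp)).mono_left nhdsWithin_le_nhds
    · filter_upwards [self_mem_nhdsWithin] with t ht using by simpa using ht
  have hcoe0 : Tendsto (fun t : ℝ≥0 => (t : ℝ)) (𝓝[>] 0) (𝓝 0) :=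
    hcoe.mono_right nhdsWithin_le_nhds
  have hexp : Tendsto (fun t : ℝ≥0 => Real.exp (-(l * t))) (𝓝[>] 0) (𝓝 1) := by
    have : Tendsto (fun t : ℝ => Real.exp (-(l * t))) (𝓝 0) (𝓝 1) :=
      Continuous.tendsto' (by fun_prop) _ _ (by simp)
    exact this.comp hcoe0
  have hder : Tendsto (fun t : ℝ≥0 => (Real.exp (-(l * t)) - 1) / t) (𝓝[>] 0) (𝓝 (-l)) := by
    have h1 : HasDerivAt (fun t : ℝ => Real.exp (-(l * t))) (-l) 0 := by
      have := (((hasDerivAt_id (0 : ℝ)).const_mul l).neg).exp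
      simpa using this
    have h2 := h1.tendsto_slope.mono_left (nhdsWithin_mono 0 (fun x (hx : 0 < x) => ne_of_gt hx))
    refine (h2.comp hcoe).congr fun t => ?_
    simp [slope_def_field]
  have hR : Tendsto (fun t : ℝ≥0 =>
      (Real.exp (l * t) * ∫ x, f x ∂(compoundPoissonLaw ν t) - f 0 - t * A) / t)
      (𝓝[>] 0) (𝓝 0) := by
    have h1 : Tendsto (fun t : ℝ≥0 => (t : ℝ) * M ^ 2) (𝓝[>] 0) (𝓝 0) := by
      simpa using hcoe0.mul_const (M ^ 2)
    refine squeeze_zero_norm' ?_ h1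
    have h2 : ∀ᶠ t : ℝ≥0 in 𝓝[>] 0, (t : ℝ) * M < 1 := by
      have : Tendsto (fun t : ℝ≥0 => (t : ℝ) * M) (𝓝[>] 0) (𝓝 0) := by
        simpa using hcoe0.mul_const M
      exact this.eventually (gt_mem_nhds one_pos)
    filter_upwards [h2, self_mem_nhdsWithin] with t ht (ht0 : 0 < t)
    have ht0' : (0 : ℝ) < t := by simpa using ht0
    rw [norm_div, Real.norm_eq_abs, Real.norm_eq_abs, abs_of_pos ht0', div_le_iff₀ ht0']
    refine (hrem t).trans ?_
    have h3 : |(t : ℝ) * M| ≤ 1 := by rw [abs_of_nonneg (by positivity)]; exact ht.le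
    have := (le_abs_self _).trans (Real.abs_exp_sub_one_sub_id_le h3)
    refine this.trans (le_of_eq (by ring))
  -- The three summands are the limits of `e^{-lt}` times the remainder over `t`, of `e^{-lt} A`,
  -- and of `f 0 (e^{-lt} - 1) / t`.
  have hfin : ∫ x, (f x - f 0) ∂ν = 1 * 0 + 1 * A + f 0 * (-l) := by
    rw [integral_sub (hfi ν hc) (integrable_const _)]
    simp [← hl, ← hA]; ring
  rw [hfin]
  refine (((hexp.mul hR).add (hexp.mul_const A)).add (hder.const_mul (f 0))).congr' ?_
  filter_upwards [self_mem_nhdsWithin] with t (ht0 : 0 < t)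
  have ht0' : (t : ℝ) ≠ 0 := by simpa using ht0.ne'
  have e : Real.exp (-(l * t)) * Real.exp (l * t) = 1 := by rw [← Real.exp_add]; simp
  field_simp
  linear_combination (∫ x, f x ∂(compoundPoissonLaw ν t)) * e

/-! ### The path space `𝔻_h` -/

section PathSpace

variable {h : ℝ}

lemma latticeZ_sub_mem {x y : ℝ} (hx : x ∈ latticeZ h) (hy : y ∈ latticeZ h) :
    x - y ∈ latticeZ h := by
  obtain ⟨k, rfl⟩ := hx
  obtain ⟨l, rfl⟩ := hy
  exact ⟨k - l, by push_cast; ring⟩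

lemma latticeZ_add_mem {x y : ℝ} (hx : x ∈ latticeZ h) (hy : y ∈ latticeZ h) :
    x + y ∈ latticeZ h := by
  obtain ⟨k, rfl⟩ := hx
  obtain ⟨l, rfl⟩ := hy
  exact ⟨k + l, by push_cast; ring⟩

lemma eq_of_mem_latticeZ_of_abs_sub_lt (hh : 0 < h) {x y : ℝ} (hx : x ∈ latticeZ h)
    (hy : y ∈ latticeZ h) (hxy : |x - y| < h) : x = y := by
  obtain ⟨k, rfl⟩ := hx
  obtain ⟨l, rfl⟩ := hy
  have h1 : |((k - l : ℤ) : ℝ)| * h < 1 * h := by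
    rw [← abs_of_pos hh, ← abs_mul, abs_of_pos hh]
    push_cast
    simpa [sub_mul] using hxy
  have h2 : |((k - l : ℤ) : ℝ)| < 1 := lt_of_mul_lt_mul_right h1 hh.le
  rw [← Int.cast_abs, ← Int.cast_one, Int.cast_lt, Int.abs_lt_one_iff] at h2
  have : k = l := by omega
  rw [this]

lemma measurable_coord (h : ℝ) (t : ℝ≥0) : Measurable (coord h t) :=
  (measurable_pi_apply t).comp measurable_subtype_coe

lemma measurable_coord_coordSigma {s t : ℝ≥0} (hst : s ≤ t) :
    Measurable[coordSigma h t] (coord h s) := by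
  rw [measurable_iff_comap_le]
  exact le_iSup (fun s : Iic t => MeasurableSpace.comap (coord h s) inferInstance) ⟨s, hst⟩

lemma coordSigma_le (h : ℝ) (t : ℝ≥0) :
    coordSigma h t ≤ (inferInstance : MeasurableSpace (PathSpace h)) :=
  iSup_le fun s => (measurable_coord h s).comap_le

lemma coordSigma_mono {s t : ℝ≥0} (hst : s ≤ t) : coordSigma h s ≤ coordSigma h t :=
  iSup_le fun r => (measurable_coord_coordSigma (r.2.trans hst)).comap_le

/-- A càdlàg path with values in a lattice is locally constant to the right. -/
lemma PathSpace.exists_right_const (hh : 0 < h) (w : PathSpace h) (t : ℝ≥0) :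
    ∃ u > t, ∀ s, t ≤ s → s < u → w.1 s = w.1 t := by
  have h1 := (w.2.1 t).1
  have h2 : ∀ᶠ s in 𝓝[≥] t, w.1 s ∈ Metric.ball (w.1 t) h :=
    h1.eventually (Metric.ball_mem_nhds _ hh)
  obtain ⟨u, hu, hus⟩ := (mem_nhdsGE_iff_exists_Ico_subset' (show t < t + 1 by simp)).1 h2
  refine ⟨u, hu, fun s hs hsu => ?_⟩
  have := hus ⟨hs, hsu⟩
  exact eq_of_mem_latticeZ_of_abs_sub_lt hh (w.2.2 s) (w.2.2 t) (by simpa [Real.dist_eq] using this)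

/-- The finite-dimensional cylinder prescribing the values of a path at finitely many times. -/
def pathCylinder (h : ℝ) (L : Finset (ℝ≥0 × ℝ)) : Set (PathSpace h) :=
  {w | ∀ p ∈ L, coord h p.1 w = p.2}

/-- Paths take values in a countable set, so prescribing exact values at finitely many times already
generates. Laws on path space can then be compared, and independence checked, on point values. -/
lemma coordinates_eq_generateFrom_pathCylinder (I : Set ℝ≥0) :
    (⨆ s : I, MeasurableSpace.comap (coord h s) inferInstance) =
      MeasurableSpace.generateFrom
        {S | ∃ L : Finset (ℝ≥0 × ℝ), (∀ p ∈ L, p.1 ∈ I) ∧ pathCylinder h L = S} := by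
  apply le_antisymm
  · refine iSup_le fun s => ?_
    rintro _ ⟨B, -, rfl⟩
    have : coord h s ⁻¹' B = ⋃ k : ℤ, ⋃ _ : (k : ℝ) * h ∈ B,
        pathCylinder h {((s : ℝ≥0), (k : ℝ) * h)} := by
      ext w
      simp only [mem_preimage, mem_iUnion, pathCylinder, Finset.mem_singleton, forall_eq,
        mem_ofPred_eq, exists_prop]
      constructor
      · intro hw
        obtain ⟨k, hk⟩ := w.2.2 s
        have hk' : (k : ℝ) * h = coord h s w := hk
        exact ⟨k, by rwa [hk'], hk'.symm⟩
      · rintro ⟨k, hk, hk'⟩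
        rwa [hk']
    rw [this]
    refine MeasurableSet.iUnion fun k => MeasurableSet.iUnion fun _ => ?_
    refine MeasurableSpace.measurableSet_generateFrom ⟨_, ?_, rfl⟩
    simp
  · refine MeasurableSpace.generateFrom_le ?_
    rintro _ ⟨L, hL, rfl⟩
    have : pathCylinder h L = ⋂ p ∈ L, coord h p.1 ⁻¹' {p.2} := by
      ext w; simp [pathCylinder]
    rw [this]
    refine Finset.measurableSet_biInter _ fun p hp => ?_
    exact le_iSup (fun s : I => MeasurableSpace.comap (coord h s) inferInstance) ⟨p.1, hL p hp⟩ _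
      ⟨_, measurableSet_singleton _, rfl⟩

lemma isPiSystem_pathCylinder (I : Set ℝ≥0) :
    IsPiSystem {S | ∃ L : Finset (ℝ≥0 × ℝ), (∀ p ∈ L, p.1 ∈ I) ∧ pathCylinder h L = S} := by
  classical
  rintro _ ⟨L, hL, rfl⟩ _ ⟨L', hL', rfl⟩ -
  refine ⟨L ∪ L', fun p hp => ?_, ?_⟩
  · rcases Finset.mem_union.1 hp with hp | hp
    exacts [hL p hp, hL' p hp]
  · ext w
    simp only [pathCylinder, Finset.mem_union, mem_ofPred_eq, mem_inter_iff, or_imp, forall_and]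

lemma measurableSpace_pathSpace_eq :
    (inferInstance : MeasurableSpace (PathSpace h)) =
      MeasurableSpace.generateFrom
        {S | ∃ L : Finset (ℝ≥0 × ℝ), (∀ p ∈ L, p.1 ∈ (univ : Set ℝ≥0)) ∧
          pathCylinder h L = S} := by
  rw [← coordinates_eq_generateFrom_pathCylinder]
  apply le_antisymm
  · rintro _ ⟨B, hB, rfl⟩
    have hm : Measurable[⨆ s : (univ : Set ℝ≥0),
        MeasurableSpace.comap (coord h s) inferInstance] (Subtype.val : PathSpace h → ℝ≥0 → ℝ) := by
      refine @measurable_pi_lambda _ _ _ (_) _ _ fun t => ?_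
      rw [measurable_iff_comap_le]
      exact le_iSup (fun s : (univ : Set ℝ≥0) => MeasurableSpace.comap (coord h s) inferInstance)
        ⟨t, mem_univ t⟩
    exact hm hB
  · exact iSup_le fun s => (measurable_coord h s).comap_le

lemma measurable_pathSpace_iff {α : Type*} [MeasurableSpace α] {f : α → PathSpace h} :
    Measurable f ↔ ∀ t, Measurable fun a => coord h t (f a) := by
  refine ⟨fun hf t => (measurable_coord h t).comp hf, fun hf => ?_⟩
  exact Measurable.subtype_mk (measurable_pi_lambda _ hf)

lemma measurable_pathSpace_of_coordSigma {α : Type*} [MeasurableSpace α] {f : α → PathSpace h}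
    {t : ℝ≥0} (hf : ∀ s ≤ t, Measurable fun a => coord h s (f a)) :
    @Measurable _ _ _ (coordSigma h t) f := by
  rw [measurable_iff_comap_le]
  unfold coordSigma
  rw [MeasurableSpace.comap_iSup]
  refine iSup_le fun s => ?_
  rw [MeasurableSpace.comap_comp]
  exact (hf s s.2).comap_le

/-- Membership in an event of `coordSigma h t` only depends on the path up to time `t`. -/
lemma mem_iff_of_coordSigma {t : ℝ≥0} {A : Set (PathSpace h)}
    (hA : MeasurableSet[coordSigma h t] A) {w w' : PathSpace h}
    (hw : ∀ s ≤ t, coord h s w = coord h s w') : w ∈ A ↔ w' ∈ A := by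
  have hA' : MeasurableSet[MeasurableSpace.generateFrom
      {S | ∃ L : Finset (ℝ≥0 × ℝ), (∀ p ∈ L, p.1 ∈ Iic t) ∧ pathCylinder h L = S}] A := by
    rw [← coordinates_eq_generateFrom_pathCylinder]; exact hA
  induction A, hA' using MeasurableSpace.generateFrom_induction with
  | hC S hS _ =>
    obtain ⟨L, hL, rfl⟩ := hS
    simp only [pathCylinder, mem_ofPred_eq]
    exact forall₂_congr fun p hp => by rw [hw p.1 (hL p hp)]
  | empty => simp
  | compl S hS ih =>
    rw [← coordinates_eq_generateFrom_pathCylinder] at hS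
    exact not_congr (ih hS)
  | iUnion f hf ih =>
    rw [← coordinates_eq_generateFrom_pathCylinder] at hf
    simp only [mem_iUnion]
    exact exists_congr fun n => ih n (hf n)

lemma IsCadlagPath.comp_add {w : ℝ≥0 → ℝ} (hw : IsCadlagPath w) (s : ℝ≥0) (x : ℝ) :
    IsCadlagPath fun u => w (s + u) - x := by
  intro t
  constructor
  · have h1 : ContinuousWithinAt (fun u => w (s + u)) (Ici t) t :=
      (hw (s + t)).1.comp (by fun_prop) fun _ (hu : t ≤ _) => add_le_add_right hu s
    exact h1.sub continuousWithinAt_const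
  · obtain ⟨l, hl⟩ := (hw (s + t)).2
    refine ⟨l - x, (hl.comp ?_).sub_const x⟩
    refine tendsto_nhdsWithin_iff.2 ⟨?_, ?_⟩
    · exact ((continuous_const.add continuous_id).tendsto t).mono_left nhdsWithin_le_nhds
    · filter_upwards [self_mem_nhdsWithin] with u hu
      exact add_lt_add_right hu s

/-- The path after time `s`, recentred at `0`. -/
def PathSpace.shift (s : ℝ≥0) (w : PathSpace h) : PathSpace h :=
  ⟨fun u => w.1 (s + u) - w.1 s, w.2.1.comp_add s _,
    fun _ => latticeZ_sub_mem (w.2.2 _) (w.2.2 _)⟩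

lemma PathSpace.coord_shift (s u : ℝ≥0) (w : PathSpace h) :
    coord h u (w.shift s) = coord h (s + u) w - coord h s w := rfl

lemma PathSpace.measurable_shift (s : ℝ≥0) :
    Measurable (PathSpace.shift s : PathSpace h → PathSpace h) :=
  measurable_pathSpace_iff.2 fun _ => (measurable_coord h _).sub (measurable_coord h _)

lemma PathSpace.measurable_shift_coordSigma (s t : ℝ≥0) :
    @Measurable _ _ (coordSigma h (s + t)) (coordSigma h t)
      (PathSpace.shift s : PathSpace h → PathSpace h) := by
  refine @measurable_pathSpace_of_coordSigma h _ (coordSigma h (s + t)) _ _ fun r hr => ?_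
  exact (measurable_coord_coordSigma (add_le_add_right hr s)).sub
    (measurable_coord_coordSigma le_self_add)

/-- The coordinate process has stationary independent increments under `μ`. -/
structure IsLatticeLevy (μ : Measure (PathSpace h)) : Prop where
  prob : IsProbabilityMeasure μ
  incr : ∀ (s t : ℝ≥0) (A : Set (PathSpace h)), MeasurableSet[coordSigma h s] A → ∀ x : ℝ,
    μ (A ∩ {w | coord h (s + t) w - coord h s w = x}) = μ A * μ {w | coord h t w = x}

namespace IsLatticeLevy

variable {μ : Measure (PathSpace h)}

lemma ae_coord_zero (hμ : IsLatticeLevy μ) : ∀ᵐ w ∂μ, coord h 0 w = 0 := by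
  have := hμ.prob
  -- The increment over a time span of length `0` is identically `0`, so the identity reads `1 = μ
  -- (coord h 0 = 0)`.
  have h1 := hμ.incr 0 0 univ MeasurableSet.univ 0
  simp only [add_zero, sub_self, ofPred_true, inter_self, measure_univ, one_mul] at h1
  rw [ae_iff_measure_eq, ← h1, measure_univ]
  exact (measurable_coord h 0 (measurableSet_singleton 0)).nullMeasurableSet

lemma measurableSet_pathCylinder {I : Set ℝ≥0} {t : ℝ≥0} {L : Finset (ℝ≥0 × ℝ)}
    (hI : I ⊆ Iic t) (hL : ∀ p ∈ L, p.1 ∈ I) :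
    MeasurableSet[coordSigma h t] (pathCylinder h L) := by
  have : coordSigma h t = _ := coordinates_eq_generateFrom_pathCylinder (Iic t)
  rw [this]
  exact MeasurableSpace.measurableSet_generateFrom ⟨L, fun p hp => hI (hL p hp), rfl⟩

/-- Induction on the constraints, ordered by time: given the value prescribed at the latest earlier
time, the last constraint is a constraint on an increment, which is independent of everything before
it. -/
lemma measure_inter_shift_pathCylinder (hμ : IsLatticeLevy μ) (s : ℝ≥0) {A : Set (PathSpace h)}
    (hA : MeasurableSet[coordSigma h s] A) (L : Finset (ℝ≥0 × ℝ)) :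
    μ (A ∩ PathSpace.shift s ⁻¹' pathCylinder h L) = μ A * μ (pathCylinder h L) := by
  classical
  have := hμ.prob
  induction L using Finset.induction_on_max_value (fun p : ℝ≥0 × ℝ => p.1) with
  | empty => simp [pathCylinder]
  | insert p L _ hmax ih =>
    rcases L.eq_empty_or_nonempty with rfl | hne
    · have := hμ.incr s p.1 A hA p.2
      simpa [pathCylinder, PathSpace.coord_shift, preimage] using this
    · obtain ⟨p', hp', hp'max⟩ := L.exists_max_image (fun p => p.1) hne
      obtain ⟨d, hd⟩ := exists_add_of_le (hmax p' hp')
      have hC : pathCylinder h (insert p L) = pathCylinder h L ∩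
          {w | coord h (p'.1 + d) w - coord h p'.1 w = p.2 - p'.2} := by
        ext w
        simp only [pathCylinder, Finset.forall_mem_insert, mem_ofPred_eq, mem_inter_iff]
        rw [hd, and_comm]
        refine and_congr_right fun hw => ?_
        rw [hw p' hp']
        constructor <;> intro h1 <;> linarith
      have hCs : A ∩ PathSpace.shift s ⁻¹' pathCylinder h (insert p L) =
          (A ∩ PathSpace.shift s ⁻¹' pathCylinder h L) ∩
          {w | coord h ((s + p'.1) + d) w - coord h (s + p'.1) w = p.2 - p'.2} := by
        rw [hC, preimage_inter, ← inter_assoc]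
        congr 1
        ext w
        simp [PathSpace.coord_shift, add_assoc]
      have hL : MeasurableSet[coordSigma h p'.1] (pathCylinder h L) :=
        measurableSet_pathCylinder (I := Iic p'.1) subset_rfl hp'max
      rw [hCs, hμ.incr _ _ _ ?_, ih, hC, hμ.incr _ _ _ hL, mul_assoc]
      exact (coordSigma_mono le_self_add _ hA).inter
        (PathSpace.measurable_shift_coordSigma s p'.1 hL)

/-- The Markov property at a fixed time: after restriction to an event of the past, the recentred
future has law `μ` up to mass. Both sides are finite measures that agree on the π-system of
cylinders. -/
lemma map_restrict_shift (hμ : IsLatticeLevy μ) (s : ℝ≥0) {A : Set (PathSpace h)}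
    (hA : MeasurableSet[coordSigma h s] A) :
    (μ.restrict A).map (PathSpace.shift s) = μ A • μ := by
  have := hμ.prob
  have hA' := coordSigma_le h s _ hA
  refine ext_of_generate_finite _ measurableSpace_pathSpace_eq (isPiSystem_pathCylinder univ)
    ?_ ?_
  · rintro _ ⟨L, -, rfl⟩
    have hL : MeasurableSet (pathCylinder h L) :=
      measurableSpace_pathSpace_eq (h := h).ge _
        (MeasurableSpace.measurableSet_generateFrom ⟨L, fun _ _ => mem_univ _, rfl⟩)
    rw [Measure.map_apply (PathSpace.measurable_shift s) hL,
      Measure.restrict_apply (PathSpace.measurable_shift s hL), inter_comm,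
      hμ.measure_inter_shift_pathCylinder s hA]
    rfl
  · rw [Measure.map_apply (PathSpace.measurable_shift s) .univ]
    simp

lemma measure_inter_shift (hμ : IsLatticeLevy μ) (s : ℝ≥0) {A : Set (PathSpace h)}
    (hA : MeasurableSet[coordSigma h s] A) {B : Set (PathSpace h)} (hB : MeasurableSet B) :
    μ (A ∩ PathSpace.shift s ⁻¹' B) = μ A * μ B := by
  have h2 := congrArg (fun m => m B) (hμ.map_restrict_shift s hA)
  simp only [Measure.map_apply (PathSpace.measurable_shift s) hB,
    Measure.restrict_apply (PathSpace.measurable_shift s hB), Measure.smul_apply,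
    smul_eq_mul] at h2
  rw [inter_comm, h2]

lemma setIntegral_shift (hμ : IsLatticeLevy μ) (s : ℝ≥0) {A : Set (PathSpace h)}
    (hA : MeasurableSet[coordSigma h s] A) {G : PathSpace h → ℝ} (hG : Measurable G) :
    ∫ w in A, G (w.shift s) ∂μ = μ.real A * ∫ w, G w ∂μ := by
  rw [← integral_map (PathSpace.measurable_shift s).aemeasurable hG.aestronglyMeasurable,
    hμ.map_restrict_shift s hA, integral_smul_measure]
  rfl

lemma map_shift (hμ : IsLatticeLevy μ) (s : ℝ≥0) : μ.map (PathSpace.shift s) = μ := by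
  have := hμ.prob
  ext B hB
  rw [Measure.map_apply (PathSpace.measurable_shift s) hB]
  simpa using hμ.measure_inter_shift s (A := univ) MeasurableSet.univ hB

lemma indep_shift (hμ : IsLatticeLevy μ) (s : ℝ≥0) :
    Indep (coordSigma h s)
      (MeasurableSpace.comap (PathSpace.shift s : PathSpace h → PathSpace h) inferInstance) μ := by
  have := hμ.prob
  rw [Indep_iff]
  rintro A _ hA ⟨B, hB, rfl⟩
  rw [hμ.measure_inter_shift s hA hB, ← Measure.map_apply (PathSpace.measurable_shift s) hB,
    hμ.map_shift]

/-- The simple Markov property, for nonnegative functionals. -/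
lemma lintegral_mul_shift (hμ : IsLatticeLevy μ) (s : ℝ≥0) {F G : PathSpace h → ℝ≥0∞}
    (hF : Measurable[coordSigma h s] F) (hG : Measurable G) :
    ∫⁻ w, F w * G (w.shift s) ∂μ = (∫⁻ w, F w ∂μ) * ∫⁻ w, G w ∂μ := by
  have hG' : Measurable[MeasurableSpace.comap (PathSpace.shift s : PathSpace h → PathSpace h)
      inferInstance] fun w => G (w.shift s) := hG.comp (comap_measurable (PathSpace.shift s))
  have h1 : ∫⁻ w, F w * G (w.shift s) ∂μ = (∫⁻ w, F w ∂μ) * ∫⁻ w, G (w.shift s) ∂μ :=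
    lintegral_mul_eq_lintegral_mul_lintegral_of_independent_measurableSpace
      (coordSigma_le h s) (PathSpace.measurable_shift s).comap_le (hμ.indep_shift s) hF hG'
  have h2 : ∫⁻ w, G (w.shift s) ∂μ = ∫⁻ w, G w ∂μ := by
    rw [← lintegral_map hG (PathSpace.measurable_shift s), hμ.map_shift]
  rw [h1, h2]

end IsLatticeLevy

end PathSpace

/-! ### First passage functionals on path space -/

section Passage

variable {h : ℝ}

lemma firstEntrance_eq_top_iff {y : ℝ} {w : PathSpace h} :
    firstEntrance (coord h) y w = ⊤ ↔ ∀ s, coord h s w < y := by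
  unfold firstEntrance
  rw [hittingAfter_eq_top_iff]
  simp

lemma firstEntrance_le_of_le {y : ℝ} {w : PathSpace h} {s : ℝ≥0} (hs : y ≤ coord h s w) :
    firstEntrance (coord h) y w ≤ s :=
  hittingAfter_le_of_mem zero_le hs

lemma coord_lt_of_lt_firstEntrance {y : ℝ} {w : PathSpace h} {s : ℝ≥0}
    (hs : (s : WithTop ℝ≥0) < firstEntrance (coord h) y w) : coord h s w < y := by
  by_contra! hy
  exact (firstEntrance_le_of_le hy).not_gt hs

/-- The infimum is attained: a lattice-valued càdlàg path that is below `y` at time `t` stays at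
that value for a while, which would push the first entrance beyond `t`. -/
lemma le_coord_of_firstEntrance_eq (hh : 0 < h) {y : ℝ} {w : PathSpace h} {t : ℝ≥0}
    (ht : firstEntrance (coord h) y w = t) : y ≤ coord h t w := by
  by_contra! hy
  have hex : ∃ s, y ≤ coord h s w := by
    by_contra! hno
    rw [firstEntrance_eq_top_iff.2 hno] at ht
    exact absurd ht (WithTop.coe_ne_top (a := t)).symm
  obtain ⟨s, hs⟩ := hex
  have hlt : ∀ r < t, coord h r w < y := fun r hr =>
    coord_lt_of_lt_firstEntrance (by rw [ht]; exact_mod_cast hr)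
  obtain ⟨u, hu, huc⟩ := w.exists_right_const hh t
  have hlt' : ∀ r < u, coord h r w < y := fun r hr => by
    rcases lt_or_ge r t with h1 | h1
    · exact hlt r h1
    · exact (huc r h1 hr).trans_lt hy
  have : (u : WithTop ℝ≥0) ≤ firstEntrance (coord h) y w := by
    unfold firstEntrance hittingAfter
    rw [if_pos ⟨s, zero_le, hs⟩]
    refine WithTop.coe_le_coe.2 (le_csInf ⟨s, zero_le, hs⟩ ?_)
    rintro r ⟨-, hr⟩
    by_contra! hru
    exact (hlt' r hru).not_ge hr
  rw [ht] at this
  exact (WithTop.coe_le_coe.1 this).not_gt hu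

lemma firstEntrance_eq_coe_iff (hh : 0 < h) {y : ℝ} {w : PathSpace h} {t : ℝ≥0} :
    firstEntrance (coord h) y w = t ↔ y ≤ coord h t w ∧ ∀ s < t, coord h s w < y := by
  constructor
  · intro ht
    exact ⟨le_coord_of_firstEntrance_eq hh ht, fun r hr =>
      coord_lt_of_lt_firstEntrance (by rw [ht]; exact_mod_cast hr)⟩
  · rintro ⟨h1, h2⟩
    refine le_antisymm (firstEntrance_le_of_le h1) ?_
    by_contra! hlt
    obtain ⟨r, hr⟩ := WithTop.ne_top_iff_exists.1 hlt.ne_top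
    rw [← hr] at hlt
    exact (h2 r (WithTop.coe_lt_coe.1 hlt)).not_ge (le_coord_of_firstEntrance_eq hh hr.symm)

lemma firstEntrance_shift (hh : 0 < h) {y : ℝ} {w : PathSpace h} {t : ℝ≥0}
    (ht : ∀ s ≤ t, coord h s w < y) :
    firstEntrance (coord h) y w =
      t + firstEntrance (coord h) (y - coord h t w) (w.shift t) := by
  rcases hT : firstEntrance (coord h) (y - coord h t w) (w.shift t) with _ | u
  · change _ = ⊤ at hT
    change _ = (t : WithTop ℝ≥0) + ⊤
    rw [add_top, firstEntrance_eq_top_iff]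
    rw [firstEntrance_eq_top_iff] at hT
    intro s
    rcases le_total s t with hs | hs
    · exact ht s hs
    · obtain ⟨d, rfl⟩ := exists_add_of_le hs
      have := hT d
      rw [PathSpace.coord_shift] at this
      linarith
  · change _ = (u : WithTop ℝ≥0) at hT
    change _ = (t : WithTop ℝ≥0) + u
    rw [← WithTop.coe_add, firstEntrance_eq_coe_iff hh]
    rw [firstEntrance_eq_coe_iff hh] at hT
    obtain ⟨h1, h2⟩ := hT
    rw [PathSpace.coord_shift] at h1
    refine ⟨by linarith, fun s hs => ?_⟩
    rcases le_total s t with hst | hst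
    · exact ht s hst
    · obtain ⟨d, rfl⟩ := exists_add_of_le hst
      have := h2 d (lt_of_add_lt_add_left hs)
      rw [PathSpace.coord_shift] at this
      linarith

lemma discount_coe_add (q : ℝ) (t : ℝ≥0) (τ : WithTop ℝ≥0) :
    discount q (t + τ) = Real.exp (-q * t) * discount q τ := by
  rcases τ with _ | u
  · change discount q ((t : WithTop ℝ≥0) + ⊤) = Real.exp (-q * t) * discount q ⊤
    rw [add_top]
    by_cases hq : q = 0 <;> simp [discount, hq]
  · change discount q ((t : WithTop ℝ≥0) + u) = Real.exp (-q * t) * discount q u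
    rw [← WithTop.coe_add]
    simp only [discount]
    rw [← Real.exp_add]; push_cast; ring_nf

lemma discount_nonneg (q : ℝ) (τ : WithTop ℝ≥0) : 0 ≤ discount q τ := by
  rcases τ with _ | u
  · change 0 ≤ discount q ⊤
    unfold discount; split_ifs <;> norm_num
  · exact (Real.exp_pos _).le

lemma discount_le_one {q : ℝ} (hq : 0 ≤ q) (τ : WithTop ℝ≥0) : discount q τ ≤ 1 := by
  rcases τ with _ | u
  · change discount q ⊤ ≤ 1
    unfold discount; split_ifs <;> norm_num
  · change Real.exp (-q * u) ≤ 1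
    rw [Real.exp_le_one_iff]
    have : 0 ≤ q * u := by positivity
    linarith

open Classical in
/-- The discounted indicator of the event that the path passes above `y` before going
below `-x`. -/
noncomputable def passage (h q x y : ℝ) (w : PathSpace h) : ℝ :=
  if ∀ s : ℝ≥0, (s : WithTop ℝ≥0) ≤ firstEntrance (coord h) y w → -x ≤ coord h s w
  then discount q (firstEntrance (coord h) y w) else 0

lemma passage_nonneg (q x y : ℝ) (w : PathSpace h) : 0 ≤ passage h q x y w := by
  unfold passage; split_ifs
  exacts [discount_nonneg _ _, le_rfl]

lemma passage_le_one {q : ℝ} (hq : 0 ≤ q) (x y : ℝ) (w : PathSpace h) :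
    passage h q x y w ≤ 1 := by
  unfold passage; split_ifs
  exacts [discount_le_one hq _, zero_le_one]

lemma passage_mono (q : ℝ) {x x' : ℝ} (hx : x ≤ x') (y : ℝ) (w : PathSpace h) :
    passage h q x y w ≤ passage h q x' y w := by
  unfold passage
  split_ifs with h1 h2
  · exact le_rfl
  · exact absurd (fun s hs => (neg_le_neg hx).trans (h1 s hs)) h2
  · exact discount_nonneg _ _
  · exact le_rfl

/-- While the path stays in `[-x, y)` nothing has been decided; waiting until `t` costs the discount
`e^{-qt}` and moves both barriers relative to the new origin. -/
lemma passage_shift (hh : 0 < h) (q : ℝ) {x y : ℝ} {w : PathSpace h} {t : ℝ≥0}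
    (ht : ∀ s ≤ t, -x ≤ coord h s w ∧ coord h s w < y) :
    passage h q x y w =
      Real.exp (-q * t) * passage h q (x + coord h t w) (y - coord h t w) (w.shift t) := by
  have hT := firstEntrance_shift hh fun s hs => (ht s hs).2
  unfold passage
  have hiff : (∀ s : ℝ≥0, (s : WithTop ℝ≥0) ≤ firstEntrance (coord h) y w → -x ≤ coord h s w) ↔
      ∀ s : ℝ≥0, (s : WithTop ℝ≥0) ≤ firstEntrance (coord h) (y - coord h t w) (w.shift t) →
        -(x + coord h t w) ≤ coord h s (w.shift t) := by
    rw [hT]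
    constructor
    · intro h1 s hs
      have := h1 (t + s) (by push_cast; exact add_le_add_right hs _)
      rw [PathSpace.coord_shift]
      linarith
    · intro h1 s hs
      rcases le_total s t with hst | hst
      · exact (ht s hst).1
      · obtain ⟨d, rfl⟩ := exists_add_of_le hst
        have h2 : (d : WithTop ℝ≥0) ≤
            firstEntrance (coord h) (y - coord h t w) (w.shift t) := by
          push_cast at hs
          exact (WithTop.add_le_add_iff_left (WithTop.coe_ne_top)).1 hs
        have := h1 d h2
        rw [PathSpace.coord_shift] at this
        linarith
  by_cases hc : ∀ s : ℝ≥0, (s : WithTop ℝ≥0) ≤ firstEntrance (coord h) y w → -x ≤ coord h s w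
  · rw [if_pos hc, if_pos (hiff.1 hc), hT, discount_coe_add]
  · rw [if_neg hc, if_neg fun h' => hc (hiff.2 h'), mul_zero]

/-- Values attained by a path on a half-open time interval are attained at times of a dense set. -/
lemma PathSpace.exists_mem_dense (hh : 0 < h) {D : Set ℝ≥0} (hD : Dense D) (w : PathSpace h)
    {s : ℝ≥0} {τ : WithTop ℝ≥0} (hs : (s : WithTop ℝ≥0) < τ) :
    ∃ d ∈ D, (d : WithTop ℝ≥0) < τ ∧ coord h d w = coord h s w := by
  obtain ⟨u, hu, huc⟩ := w.exists_right_const hh s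
  rcases τ with _ | t
  · obtain ⟨d, hd, h1, h2⟩ := hD.exists_between hu
    exact ⟨d, hd, WithTop.coe_lt_top d, huc d h1.le h2⟩
  · have hs' : s < t := WithTop.coe_lt_coe.1 hs
    obtain ⟨d, hd, h1, h2⟩ := hD.exists_between (lt_min hu hs')
    exact ⟨d, hd, WithTop.coe_lt_coe.2 (h2.trans_le (min_le_right _ _)),
      huc d h1.le (h2.trans_le (min_le_left _ _))⟩

/-- Paths are locally constant to the right, so times before `t` reduce to a countable dense set.
The time `t` itself is treated apart: the dense times that would reveal its value lie after `t`,
outside `coordSigma h t`. -/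
lemma measurableSet_forall_le (hh : 0 < h) (t : ℝ≥0) {B : Set ℝ} (hB : MeasurableSet B) :
    MeasurableSet[coordSigma h t] {w : PathSpace h | ∀ s ≤ t, coord h s w ∈ B} := by
  obtain ⟨D, hDc, hD⟩ := TopologicalSpace.exists_countable_dense ℝ≥0
  have : {w : PathSpace h | ∀ s ≤ t, coord h s w ∈ B} =
      coord h t ⁻¹' B ∩ ⋂ d ∈ D ∩ Iio t, coord h d ⁻¹' B := by
    ext w
    simp only [mem_ofPred_eq, mem_inter_iff, mem_preimage, mem_iInter]
    constructor
    · exact fun hw => ⟨hw t le_rfl, fun d hd => hw d hd.2.le⟩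
    · rintro ⟨h1, h2⟩ s hs
      rcases hs.eq_or_lt with rfl | hs
      · exact h1
      · obtain ⟨d, hd, hdt, hdw⟩ := w.exists_mem_dense hh hD (WithTop.coe_lt_coe.2 hs)
        rw [← hdw]
        exact h2 d ⟨hd, WithTop.coe_lt_coe.1 hdt⟩
  rw [this]
  refine (measurable_coord_coordSigma le_rfl hB).inter ?_
  exact MeasurableSet.biInter (hDc.mono inter_subset_left) fun d hd =>
    measurable_coord_coordSigma hd.2.le hB

lemma measurableSet_firstEntrance_le (hh : 0 < h) (y : ℝ) (t : ℝ≥0) :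
    MeasurableSet {w : PathSpace h | firstEntrance (coord h) y w ≤ t} := by
  have : {w : PathSpace h | firstEntrance (coord h) y w ≤ t} =
      {w : PathSpace h | ∀ s ≤ t, coord h s w ∈ Iio y}ᶜ := by
    ext w
    simp only [mem_ofPred_eq, mem_compl_iff, mem_Iio, not_forall, not_lt]
    constructor
    · intro hw
      obtain ⟨r, hr⟩ := WithTop.ne_top_iff_exists.1 (ne_top_of_le_ne_top WithTop.coe_ne_top hw)
      rw [← hr] at hw
      exact ⟨r, WithTop.coe_le_coe.1 hw, le_coord_of_firstEntrance_eq hh hr.symm⟩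
    · rintro ⟨s, hs, hsw⟩
      exact (firstEntrance_le_of_le hsw).trans (WithTop.coe_le_coe.2 hs)
  rw [this]
  exact (coordSigma_le h t _ (measurableSet_forall_le hh t measurableSet_Iio)).compl

lemma measurable_discount_firstEntrance (hh : 0 < h) {q : ℝ} (hq : 0 ≤ q) (y : ℝ) :
    Measurable fun w : PathSpace h => discount q (firstEntrance (coord h) y w) := by
  rcases hq.eq_or_lt with rfl | hq
  · have : (fun w : PathSpace h => discount 0 (firstEntrance (coord h) y w)) = fun _ => 1 := by
      ext w
      rcases firstEntrance (coord h) y w with _ | u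
      · change discount 0 ⊤ = 1; simp [discount]
      · change Real.exp (-0 * u) = 1; simp
    rw [this]; exact measurable_const
  refine measurable_of_Ici fun a => ?_
  rcases le_or_gt a 0 with ha | ha
  · convert MeasurableSet.univ
    ext w; simpa using ha.trans (discount_nonneg q _)
  rcases lt_or_ge 1 a with ha1 | ha1
  · convert MeasurableSet.empty
    ext w; simpa using (discount_le_one hq.le _).trans_lt ha1
  -- For `0 < a ≤ 1` and `q > 0`, `a ≤ e^{-qT}` means `T ≤ -log a / q`.
  convert measurableSet_firstEntrance_le hh y (Real.toNNReal (-Real.log a / q))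
  ext w
  simp only [mem_preimage, mem_Ici, mem_ofPred_eq]
  rcases firstEntrance (coord h) y w with _ | u
  · change a ≤ discount q ⊤ ↔ (⊤ : WithTop ℝ≥0) ≤ _
    have h0 : discount q ⊤ = 0 := by simp [discount, hq.ne']
    rw [h0]
    exact iff_of_false ha.not_ge fun h1 => WithTop.coe_ne_top (top_le_iff.1 h1)
  · change a ≤ Real.exp (-q * u) ↔ (u : WithTop ℝ≥0) ≤ _
    rw [WithTop.coe_le_coe, ← Real.log_le_iff_le_exp ha, Real.le_toNNReal_iff_coe_le, le_div_iff₀ hq]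
    · constructor <;> intro h1 <;> linarith
    · have := Real.log_nonpos ha.le ha1
      exact div_nonneg (by linarith) hq.le

lemma measurable_passage (hh : 0 < h) {q : ℝ} (hq : 0 ≤ q) {x y : ℝ} (hxy : -x ≤ y) :
    Measurable (passage h q x y) := by
  refine Measurable.ite ?_ (measurable_discount_firstEntrance hh hq y) measurable_const
  obtain ⟨D, hDc, hD⟩ := TopologicalSpace.exists_countable_dense ℝ≥0
  have : {w : PathSpace h | ∀ s : ℝ≥0, (s : WithTop ℝ≥0) ≤ firstEntrance (coord h) y w →
      -x ≤ coord h s w} =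
      ⋂ d ∈ D, ({w | firstEntrance (coord h) y w ≤ d} ∪ coord h d ⁻¹' Ici (-x)) := by
    ext w
    simp only [mem_ofPred_eq, mem_iInter, mem_union, mem_preimage, mem_Ici]
    constructor
    · intro hw d _
      rcases le_or_gt (firstEntrance (coord h) y w) d with h1 | h1
      · exact Or.inl h1
      · exact Or.inr (hw d h1.le)
    · intro hw s hs
      rcases hs.eq_or_lt with hs | hs
      -- At the entrance time itself the path is at least `y ≥ -x`, so only times strictly before it
      -- are tested, and those reduce to the dense set.
      · exact hxy.trans (le_coord_of_firstEntrance_eq hh hs.symm)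
      · obtain ⟨d, hd, hdt, hdw⟩ := w.exists_mem_dense hh hD hs
        rw [← hdw]
        exact (hw d hd).resolve_left hdt.not_ge
  rw [this]
  exact MeasurableSet.biInter hDc fun d _ =>
    (measurableSet_firstEntrance_le hh y d).union (measurable_coord h d measurableSet_Ici)

lemma passage_zero {q x : ℝ} (hx : 0 ≤ x) {w : PathSpace h} (hw : coord h 0 w = 0) :
    passage h q x 0 w = 1 := by
  have h0 : firstEntrance (coord h) 0 w = ((0 : ℝ≥0) : WithTop ℝ≥0) :=
    le_antisymm (firstEntrance_le_of_le hw.ge) zero_le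
  unfold passage
  rw [if_pos, h0]
  · simp [discount]
  · intro s hs
    rw [h0] at hs
    have : s = 0 := le_antisymm (WithTop.coe_le_coe.1 hs) zero_le
    rw [this, hw]; linarith

end Passage

/-! ### The path up to a small time has at most one jump -/

section OneJump

variable {h : ℝ}

/-- The paths started at `0` that have at most one jump on `[0, t]`. -/
def atMostOneJump (h : ℝ) (t : ℝ≥0) : Set (PathSpace h) :=
  {w | coord h 0 w = 0 ∧ ∀ r ≤ t, coord h r w = 0 ∨
    ∀ s, r ≤ s → s ≤ t → coord h s w = coord h t w}

/-- The `i`-th point of the grid that splits `[0, t]` into `n` equal parts. -/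
noncomputable def gridTime (t : ℝ≥0) (n i : ℕ) : ℝ≥0 := i * (t / n)

lemma gridTime_mono (t : ℝ≥0) (n : ℕ) {i j : ℕ} (hij : i ≤ j) :
    gridTime t n i ≤ gridTime t n j := by
  unfold gridTime; gcongr

lemma gridTime_succ (t : ℝ≥0) (n i : ℕ) : gridTime t n (i + 1) = gridTime t n i + t / n := by
  unfold gridTime; push_cast; ring

lemma gridTime_self (t : ℝ≥0) {n : ℕ} (hn : n ≠ 0) : gridTime t n n = t := by
  unfold gridTime
  have : (n : ℝ≥0) ≠ 0 := by exact_mod_cast hn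
  field_simp

/-- The event that the path changes over the `i`-th cell of the grid. -/
def gridChange (h : ℝ) (t : ℝ≥0) (n i : ℕ) : Set (PathSpace h) :=
  {w | coord h (gridTime t n (i + 1)) w ≠ coord h (gridTime t n i) w}

/-- The event that the path changes over two different cells of the grid. -/
def twoGridChanges (h : ℝ) (t : ℝ≥0) (n : ℕ) : Set (PathSpace h) :=
  ⋃ i ∈ Finset.range n, ⋃ j ∈ Finset.range i, gridChange h t n j ∩ gridChange h t n i

lemma exists_gridChange {t : ℝ≥0} {n i j : ℕ} (hij : i ≤ j) {w : PathSpace h}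
    (hw : coord h (gridTime t n i) w ≠ coord h (gridTime t n j) w) :
    ∃ l, i ≤ l ∧ l < j ∧ w ∈ gridChange h t n l := by
  by_contra! hno
  apply hw
  induction j, hij using Nat.le_induction with
  | base => rfl
  | succ j hij ih =>
    have h1 : coord h (gridTime t n i) w = coord h (gridTime t n j) w := by
      by_contra hne
      exact hne (ih hne fun l h1 h2 => hno l h1 (h2.trans (Nat.lt_succ_self j)))
    have h2 := hno j hij (Nat.lt_succ_self j)
    unfold gridChange at h2
    simp only [mem_ofPred_eq, ne_eq, not_not] at h2
    rw [h1, h2]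

lemma measurableSet_gridChange (t : ℝ≥0) (n i : ℕ) :
    MeasurableSet[coordSigma h (gridTime t n (i + 1))] (gridChange h t n i) := by
  have h1 : Measurable[coordSigma h (gridTime t n (i + 1))] fun w =>
      coord h (gridTime t n (i + 1)) w - coord h (gridTime t n i) w :=
    (measurable_coord_coordSigma le_rfl).sub
      (measurable_coord_coordSigma (gridTime_mono t n (Nat.le_succ i)))
  convert h1 (measurableSet_singleton (0 : ℝ)).compl using 1
  ext w
  simp [gridChange, sub_eq_zero]

lemma IsLatticeLevy.measure_gridChange_inter {μ : Measure (PathSpace h)} (hμ : IsLatticeLevy μ)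
    (t : ℝ≥0) (n i : ℕ) {A : Set (PathSpace h)}
    (hA : MeasurableSet[coordSigma h (gridTime t n i)] A) :
    μ (A ∩ gridChange h t n i) = μ A * μ {w | coord h (t / n) w ≠ 0} := by
  have h1 : gridChange h t n i = PathSpace.shift (gridTime t n i) ⁻¹'
      {w | coord h (t / n) w ≠ 0} := by
    ext w
    simp [gridChange, PathSpace.coord_shift, gridTime_succ, sub_eq_zero]
  rw [h1, hμ.measure_inter_shift _ hA]
  exact measurable_coord h _ (measurableSet_singleton (0 : ℝ)).compl

/-- Changes over two different cells are independent and equally likely; the bound is the sum over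
all pairs of cells. -/
lemma IsLatticeLevy.measure_twoGridChanges_le {μ : Measure (PathSpace h)} (hμ : IsLatticeLevy μ)
    (t : ℝ≥0) (n : ℕ) :
    μ (twoGridChanges h t n) ≤ (n * μ {w | coord h (t / n) w ≠ 0}) ^ 2 := by
  have := hμ.prob
  set p := μ {w | coord h (t / n) w ≠ 0} with hp
  have h1 : ∀ j, μ (gridChange h t n j) = p := fun j => by
    have := hμ.measure_gridChange_inter t n j (A := univ) MeasurableSet.univ
    rwa [univ_inter, measure_univ, one_mul] at this
  have h2 : ∀ i j, j < i → μ (gridChange h t n j ∩ gridChange h t n i) = p * p := fun i j hj => by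
    rw [hμ.measure_gridChange_inter t n i
      (coordSigma_mono (gridTime_mono t n hj) _ (measurableSet_gridChange t n j)), h1]
  calc μ (twoGridChanges h t n)
      ≤ ∑ i ∈ Finset.range n, μ (⋃ j ∈ Finset.range i, gridChange h t n j ∩ gridChange h t n i) :=
        measure_biUnion_finset_le _ _
    _ ≤ ∑ i ∈ Finset.range n, ∑ j ∈ Finset.range i, p * p := by
        refine Finset.sum_le_sum fun i _ => (measure_biUnion_finset_le _ _).trans ?_
        exact Finset.sum_le_sum fun j hj => (h2 i j (Finset.mem_range.1 hj)).le
    _ ≤ ∑ i ∈ Finset.range n, ∑ j ∈ Finset.range n, p * p := by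
        refine Finset.sum_le_sum fun i hi => Finset.sum_le_sum_of_subset ?_
        exact Finset.range_subset_range.2 (Finset.mem_range.1 hi).le
    _ = (n * p) ^ 2 := by simp; ring

lemma exists_gridTime_mem_Ico {t r : ℝ≥0} (hrt : r ≤ t) (ht : 0 < t) {n : ℕ} (hn : n ≠ 0) :
    r ≤ gridTime t n ⌈r / (t / n)⌉₊ ∧ gridTime t n ⌈r / (t / n)⌉₊ < r + t / n ∧
      ⌈r / (t / n)⌉₊ ≤ n := by
  have hn' : (0 : ℝ≥0) < n := by exact_mod_cast Nat.pos_of_ne_zero hn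
  have hd : 0 < t / n := by positivity
  unfold gridTime
  refine ⟨?_, ?_, ?_⟩
  · rw [← div_le_iff₀ hd]; exact Nat.le_ceil _
  · have := mul_lt_mul_of_pos_right (Nat.ceil_lt_add_one (zero_le (a := r / (t / n)))) hd
    rwa [add_mul, div_mul_cancel₀ _ hd.ne', one_mul] at this
  · rw [Nat.ceil_le, div_le_iff₀ hd, mul_div_cancel₀ _ hn'.ne']; exact hrt

/-- A path outside `atMostOneJump` has times `r ≤ s < t` with a nonzero value at `r` and a value at
`s` other than the final one. Both values persist to the right, so on a fine grid the grid points
just after `r` and `s` still carry them; this forces one change before the first grid point and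
another after the second. -/
lemma compl_atMostOneJump_subset (hh : 0 < h) {t : ℝ≥0} {w : PathSpace h} (hw0 : coord h 0 w = 0)
    (hw : w ∉ atMostOneJump h t) : ∀ᶠ n : ℕ in atTop, w ∈ twoGridChanges h t n := by
  simp only [atMostOneJump, mem_ofPred_eq, not_and, not_forall, not_or] at hw
  obtain ⟨r, hrt, hr0, s, hrs, hst, hsw⟩ := hw hw0
  have hst' : s < t := lt_of_le_of_ne hst fun h1 => hsw (by rw [h1])
  have ht : 0 < t := zero_le.trans_lt hst'
  obtain ⟨u, hu, huc⟩ := w.exists_right_const hh r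
  obtain ⟨v, hv, hvc⟩ := w.exists_right_const hh s
  have hlim : Tendsto (fun n : ℕ => t / (n : ℝ≥0)) atTop (𝓝 0) := by
    simpa using tendsto_const_div_atTop_nhds_zero_nat t
  have e1 : ∀ᶠ n : ℕ in atTop, r + t / n < u := by
    have : Tendsto (fun n : ℕ => r + t / (n : ℝ≥0)) atTop (𝓝 r) := by
      simpa using hlim.const_add r
    exact this.eventually (gt_mem_nhds hu)
  have e2 : ∀ᶠ n : ℕ in atTop, s + t / n < v := by
    have : Tendsto (fun n : ℕ => s + t / (n : ℝ≥0)) atTop (𝓝 s) := by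
      simpa using hlim.const_add s
    exact this.eventually (gt_mem_nhds hv)
  filter_upwards [e1, e2, eventually_ne_atTop 0] with n h1 h2 hn
  obtain ⟨a1, a2, a3⟩ := exists_gridTime_mem_Ico hrt ht hn
  obtain ⟨b1, b2, b3⟩ := exists_gridTime_mem_Ico hst ht hn
  set i := ⌈r / (t / n)⌉₊
  set i' := ⌈s / (t / n)⌉₊
  have hii : i ≤ i' := Nat.ceil_mono (by gcongr)
  have w1 : coord h (gridTime t n i) w = coord h r w := huc _ a1 (a2.trans h1)
  have w2 : coord h (gridTime t n i') w = coord h s w := hvc _ b1 (b2.trans h2)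
  obtain ⟨j, -, hji, hj⟩ := exists_gridChange (t := t) (n := n) (zero_le (a := i)) (w := w) (by
    rw [w1]; simp only [gridTime, Nat.cast_zero, zero_mul]; rw [hw0]; exact fun h1 => hr0 h1.symm)
  obtain ⟨l, hil, hln, hl⟩ := exists_gridChange (t := t) (n := n) b3 (w := w) (by
    rw [w2, gridTime_self t hn]; exact hsw)
  simp only [twoGridChanges, mem_iUnion, Finset.mem_range]
  exact ⟨l, hln, j, by omega, hj, hl⟩

/-- With `n` cells, each changes with probability at most `C t / n`, so the bound `(n · C t / n)²`
does not depend on `n` and survives refinement of the grid. -/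
lemma IsLatticeLevy.measure_compl_atMostOneJump_le (hh : 0 < h) {μ : Measure (PathSpace h)}
    (hμ : IsLatticeLevy μ) {C : ℝ} {t : ℝ≥0}
    (hC : ∀ s ≤ t, μ.real {w | coord h s w ≠ 0} ≤ C * s) :
    μ.real (atMostOneJump h t)ᶜ ≤ (C * t) ^ 2 := by
  have := hμ.prob
  have h0 : μ (atMostOneJump h t)ᶜ ≤ μ (⋃ N : ℕ, ⋂ n : Ici N, twoGridChanges h t (n.1 + 1)) := by
    refine measure_mono_ae ?_
    filter_upwards [hμ.ae_coord_zero] with w hw0 hw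
    obtain ⟨N, hN⟩ := eventually_atTop.1 (compl_atMostOneJump_subset hh hw0 hw)
    refine mem_iUnion.2 ⟨N, mem_iInter.2 fun n => hN _ ?_⟩
    exact (mem_Ici.1 n.2).trans (Nat.le_succ _)
  -- The intersections over `n ≥ N` increase with `N`, so the measure of their union is a supremum,
  -- and each of them lies in a single grid event.
  have h1 : Monotone fun N : ℕ => ⋂ n : Ici N, twoGridChanges h t (n.1 + 1) := by
    intro N M hNM
    exact iInter_mono' fun n => ⟨⟨n, hNM.trans (mem_Ici.1 n.2)⟩, subset_rfl⟩
  rw [h1.measure_iUnion] at h0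
  refine ENNReal.toReal_le_of_le_ofReal (sq_nonneg _) (h0.trans (iSup_le fun N => ?_))
  refine (measure_mono (iInter_subset _ (⟨N, self_mem_Ici⟩ : Ici N))).trans
    ((hμ.measure_twoGridChanges_le t (N + 1)).trans ?_)
  have hn : ((N + 1 : ℕ) : ℝ) ≠ 0 := by positivity
  have h2 : t / ((N + 1 : ℕ) : ℝ≥0) ≤ t := by
    refine div_le_self zero_le ?_
    exact_mod_cast Nat.le_add_left 1 N
  have h3 := hC _ h2
  have h4 : ((N + 1 : ℕ) : ℝ≥0∞) * μ {w | coord h (t / ((N + 1 : ℕ) : ℝ≥0)) w ≠ 0} ≤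
      ENNReal.ofReal (C * t) := by
    rw [← ENNReal.ofReal_natCast, ← ofReal_measureReal, ← ENNReal.ofReal_mul (by positivity)]
    refine ENNReal.ofReal_le_ofReal ?_
    calc ((N + 1 : ℕ) : ℝ) * μ.real {w | coord h (t / ((N + 1 : ℕ) : ℝ≥0)) w ≠ 0}
        ≤ ((N + 1 : ℕ) : ℝ) * (C * (t / ((N + 1 : ℕ) : ℝ≥0) : ℝ≥0)) := by gcongr
      _ = C * t := by push_cast at hn ⊢; field_simp
  have h5 : 0 ≤ C * t := measureReal_nonneg.trans (hC t le_rfl)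
  rw [ENNReal.ofReal_pow h5]
  gcongr

end OneJump

/-! ### First-step analysis for two-sided passage -/

section Recurrence

variable {h : ℝ}

/-- Measures on the line that are Lévy measures of upwards skip-free chains of span `h`. -/
structure IsSkipFreeMeasure (h : ℝ) (ν : Measure ℝ) : Prop where
  finite : IsFiniteMeasure ν
  zero : ν {0} = 0
  lattice : ∀ᵐ x ∂ν, ∃ k : ℤ, k ≤ 1 ∧ x = k * h
  pos : 0 < ν.real {h}

/-- The marginals of the coordinate process are generated, at time `0`, by the jump measure `ν`. -/
def HasGenerator (μ : Measure (PathSpace h)) (ν : Measure ℝ) : Prop :=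
  ∀ f : ℝ → ℝ, Measurable f → (∀ x, |f x| ≤ 1) →
    Tendsto (fun t : ℝ≥0 => (∫ w, f (coord h t w) ∂μ - f 0) / t) (𝓝[>] 0)
      (𝓝 (∫ x, (f x - f 0) ∂ν))

/-- The mean of the discounted passage above `m h` before going below `-k h`. -/
noncomputable def passageMean (μ : Measure (PathSpace h)) (q : ℝ) (k m : ℤ) : ℝ :=
  ∫ w, passage h q (k * h) (m * h) w ∂μ

/-- The mean of the discounted passage for the two-sided problem restarted at `j h`. -/
noncomputable def passageValue (μ : Measure (PathSpace h)) (q : ℝ) (k m j : ℤ) : ℝ :=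
  if j < -k then 0 else if j < m then passageMean μ q (k + j) (m - j) else 1

lemma floor_intCast_mul_div (hh : 0 < h) (j : ℤ) : ⌊(j : ℝ) * h / h⌋ = j := by
  rw [mul_div_cancel_right₀ _ hh.ne', Int.floor_intCast]

variable {μ : Measure (PathSpace h)}

lemma passageMean_nonneg (q : ℝ) (k m : ℤ) : 0 ≤ passageMean μ q k m :=
  integral_nonneg fun _ => passage_nonneg _ _ _ _

lemma integrable_passage [IsFiniteMeasure μ] (hh : 0 < h) {q : ℝ} (hq : 0 ≤ q) {x y : ℝ}
    (hxy : -x ≤ y) : Integrable (passage h q x y) μ := by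
  refine (integrable_const (1 : ℝ)).mono' (measurable_passage hh hq hxy).aestronglyMeasurable
    (Eventually.of_forall fun w => ?_)
  rw [Real.norm_eq_abs, abs_of_nonneg (passage_nonneg _ _ _ _)]
  exact passage_le_one hq _ _ _

lemma passageMean_le_one [IsProbabilityMeasure μ] (hh : 0 < h) {q : ℝ} (hq : 0 ≤ q) {k m : ℤ}
    (hkm : -k ≤ m) : passageMean μ q k m ≤ 1 := by
  have hkm' : -((k : ℝ) * h) ≤ m * h := by
    rw [← neg_mul]; exact mul_le_mul_of_nonneg_right (by exact_mod_cast hkm) hh.le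
  have := integral_mono (integrable_passage (μ := μ) hh hq hkm') (integrable_const 1)
    fun w => passage_le_one hq _ _ w
  simpa [passageMean] using this

lemma passageMean_mono [IsFiniteMeasure μ] (hh : 0 < h) {q : ℝ} (hq : 0 ≤ q) {k k' m : ℤ}
    (hkk : k ≤ k') (hkm : -k ≤ m) : passageMean μ q k m ≤ passageMean μ q k' m := by
  have h1 : (k : ℝ) * h ≤ k' * h := mul_le_mul_of_nonneg_right (by exact_mod_cast hkk) hh.le
  have h2 : -((k : ℝ) * h) ≤ m * h := by
    rw [← neg_mul]; exact mul_le_mul_of_nonneg_right (by exact_mod_cast hkm) hh.le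
  exact integral_mono (integrable_passage hh hq h2) (integrable_passage hh hq (by linarith))
    fun w => passage_mono q h1 _ w

lemma IsLatticeLevy.passageMean_zero (hμ : IsLatticeLevy μ) (hh : 0 < h) (q : ℝ) {k : ℤ}
    (hk : 0 ≤ k) : passageMean μ q k 0 = 1 := by
  have := hμ.prob
  have hk' : (0 : ℝ) ≤ k * h := mul_nonneg (by exact_mod_cast hk) hh.le
  have h1 : ∀ᵐ w ∂μ, passage h q (k * h) ((0 : ℤ) * h) w = 1 := by
    filter_upwards [hμ.ae_coord_zero] with w hw
    rw [Int.cast_zero, zero_mul]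
    exact passage_zero hk' hw
  unfold passageMean
  rw [integral_congr_ae h1]; simp

lemma passageValue_mem_Icc [IsProbabilityMeasure μ] (hh : 0 < h) {q : ℝ} (hq : 0 ≤ q) {k m : ℤ}
    (j : ℤ) : passageValue μ q k m j ∈ Icc (0 : ℝ) 1 := by
  unfold passageValue
  split_ifs with h1 h2
  · simp
  · exact ⟨passageMean_nonneg _ _ _, passageMean_le_one hh hq (by omega)⟩
  · simp

lemma measurable_passageValue (q : ℝ) (k m : ℤ) :
    Measurable fun x : ℝ => passageValue μ q k m ⌊x / h⌋ :=
  (measurable_from_top (f := passageValue μ q k m)).comp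
    (Int.measurable_floor.comp (measurable_id.div_const h))

/-- If a path with one jump leaves the strip, that jump is the exit. An exit below gives `0` on both
sides. An exit above at time `τ ≤ t` gives `e^{-qτ}` against `e^{-qt}`. Recording that the path has
moved makes the expected error of second order in `t`. -/
lemma abs_sub_passageValue_le (hh : 0 < h) {q : ℝ} (hq : 0 ≤ q) {k m : ℤ} (hk : 0 ≤ k)
    (hm : 0 < m) {t : ℝ≥0} {w : PathSpace h} (hw : w ∈ atMostOneJump h t)
    (hexit : ¬ ∀ s ≤ t, coord h s w ∈ Ico (-(k * h)) (m * h)) :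
    coord h t w ≠ 0 ∧ |passage h q (k * h) (m * h) w -
      Real.exp (-q * t) * passageValue μ q k m ⌊coord h t w / h⌋| ≤ 1 - Real.exp (-q * t) := by
  have hk' : (0 : ℝ) ≤ k * h := mul_nonneg (by exact_mod_cast hk) hh.le
  have hm' : (0 : ℝ) < m * h := mul_pos (by exact_mod_cast hm) hh
  have he1 : Real.exp (-q * t) ≤ 1 := by
    rw [Real.exp_le_one_iff]
    have : 0 ≤ q * t := by positivity
    linarith
  simp only [not_forall] at hexit
  obtain ⟨r, hrt, hr⟩ := hexit
  have hr0 : coord h r w ≠ 0 := fun h0 => hr (by rw [h0]; exact ⟨by linarith, hm'⟩)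
  have hrt' : coord h r w = coord h t w :=
    ((hw.2 r hrt).resolve_left hr0) r le_rfl hrt
  have hvals : ∀ s ≤ t, coord h s w = 0 ∨ coord h s w = coord h t w := fun s hs =>
    (hw.2 s hs).imp_right fun h1 => h1 s le_rfl hs
  refine ⟨hrt' ▸ hr0, ?_⟩
  obtain ⟨j, hj⟩ := w.2.2 t
  replace hj : coord h t w = j * h := hj.symm
  rw [hj, floor_intCast_mul_div hh]
  rw [hrt', hj] at hr
  rcases lt_or_ge j (-k) with hjk | hjk
  · have hjk' : (j : ℝ) * h < -(k * h) := by
      rw [← neg_mul]; exact mul_lt_mul_of_pos_right (by exact_mod_cast hjk) hh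
    have hT : (t : WithTop ℝ≥0) ≤ firstEntrance (coord h) (m * h) w := by
      by_contra! hlt
      obtain ⟨τ, hτ⟩ := WithTop.ne_top_iff_exists.1 hlt.ne_top
      have h1 := le_coord_of_firstEntrance_eq hh hτ.symm
      rw [← hτ] at hlt
      rcases hvals τ (WithTop.coe_le_coe.1 hlt.le) with h2 | h2 <;> rw [h2] at h1 <;> linarith
    have hp : passage h q (k * h) (m * h) w = 0 := by
      unfold passage
      rw [if_neg]
      intro hc
      have := hc t hT
      linarith
    rw [hp, passageValue, if_pos hjk]
    simpa using he1
  · have hjm : m ≤ j := by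
      by_contra! hjm
      refine hr ⟨?_, mul_lt_mul_of_pos_right (by exact_mod_cast hjm) hh⟩
      rw [← neg_mul]; exact mul_le_mul_of_nonneg_right (by exact_mod_cast hjk) hh.le
    have hjm' : (m : ℝ) * h ≤ j * h := mul_le_mul_of_nonneg_right (by exact_mod_cast hjm) hh.le
    have hT : firstEntrance (coord h) (m * h) w ≤ t := firstEntrance_le_of_le (by rw [hj]; exact hjm')
    obtain ⟨τ, hτ⟩ := WithTop.ne_top_iff_exists.1 (ne_top_of_le_ne_top WithTop.coe_ne_top hT)
    rw [← hτ] at hT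
    have hτt : τ ≤ t := WithTop.coe_le_coe.1 hT
    have hp : passage h q (k * h) (m * h) w = Real.exp (-q * τ) := by
      unfold passage
      rw [if_pos, ← hτ]
      · rfl
      · intro s hs
        rw [← hτ] at hs
        rcases hvals s ((WithTop.coe_le_coe.1 hs).trans hτt) with h2 | h2
        · rw [h2]; linarith
        · rw [h2, hj]; linarith
    rw [hp, passageValue, if_neg (by omega), if_neg (by omega), mul_one]
    have h1 : Real.exp (-q * τ) ≤ 1 := by
      rw [Real.exp_le_one_iff]
      have : 0 ≤ q * τ := by positivity
      linarith
    have h2 : Real.exp (-q * t) ≤ Real.exp (-q * τ) := by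
      rw [Real.exp_le_exp]
      have : q * τ ≤ q * t := mul_le_mul_of_nonneg_left (by exact_mod_cast hτt) hq
      linarith
    rw [abs_of_nonneg (by linarith)]; linarith

/-- On paths that stay in the strip up to `t` there is no error on average: this is the Markov
property at `t`, applied separately on each of the finitely many possible positions at `t`. -/
lemma IsLatticeLevy.setIntegral_passage_sub (hμ : IsLatticeLevy μ) (hh : 0 < h) {q : ℝ}
    (hq : 0 ≤ q) {k m : ℤ} (t : ℝ≥0) :
    ∫ w in {w | ∀ s ≤ t, coord h s w ∈ Ico (-(k * h)) (m * h)},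
      (passage h q (k * h) (m * h) w -
        Real.exp (-q * t) * passageValue μ q k m ⌊coord h t w / h⌋) ∂μ = 0 := by
  have := hμ.prob
  set N : Set (PathSpace h) := {w | ∀ s ≤ t, coord h s w ∈ Ico (-(k * h)) (m * h)} with hN
  have hNm : MeasurableSet[coordSigma h t] N := measurableSet_forall_le hh t measurableSet_Ico
  have hAm : ∀ j : ℤ, MeasurableSet[coordSigma h t] (N ∩ {w | coord h t w = j * h}) := fun j =>
    hNm.inter (measurable_coord_coordSigma le_rfl (measurableSet_singleton _))
  have hNj : ∀ w ∈ N, ∀ j : ℤ, coord h t w = j * h → -k ≤ j ∧ j < m := fun w hw j hj => by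
    have h1 := hw t le_rfl
    rw [hj, ← neg_mul] at h1
    constructor
    · exact_mod_cast le_of_mul_le_mul_right h1.1 hh
    · exact_mod_cast lt_of_mul_lt_mul_right h1.2 hh.le
  have hNU : N = ⋃ j ∈ Finset.Ico (-k) m, N ∩ {w | coord h t w = j * h} := by
    ext w
    simp only [mem_iUnion, Finset.mem_Ico, mem_inter_iff, mem_ofPred_eq, exists_prop]
    constructor
    · intro hw
      obtain ⟨j, hj⟩ := w.2.2 t
      exact ⟨j, hNj w hw j hj.symm, hw, hj.symm⟩
    · rintro ⟨j, -, hw, -⟩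
      exact hw
  have hzero : ∀ j ∈ Finset.Ico (-k) m, ∫ w in N ∩ {w | coord h t w = j * h},
      (passage h q (k * h) (m * h) w -
        Real.exp (-q * t) * passageValue μ q k m ⌊coord h t w / h⌋) ∂μ = 0 := fun j hj => by
    rw [Finset.mem_Ico] at hj
    have hxy : -(((k + j : ℤ) : ℝ) * h) ≤ ((m - j : ℤ) : ℝ) * h := by
      rw [← neg_mul]
      refine mul_le_mul_of_nonneg_right ?_ hh.le
      have : -(k + j) ≤ m - j := by omega
      exact_mod_cast this
    have hcongr : ∀ w ∈ N ∩ {w | coord h t w = j * h}, (passage h q (k * h) (m * h) w -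
        Real.exp (-q * t) * passageValue μ q k m ⌊coord h t w / h⌋) = Real.exp (-q * t) *
        (passage h q ((k + j : ℤ) * h) ((m - j : ℤ) * h) (w.shift t)
          - passageMean μ q (k + j) (m - j)) := by
      rintro w ⟨hw, hwj : coord h t w = j * h⟩
      rw [passage_shift hh q hw, hwj, floor_intCast_mul_div hh, passageValue,
        if_neg (by omega), if_pos (by omega), mul_sub]
      push_cast
      rw [add_mul, sub_mul]
    have hmp := measurable_passage hh hq hxy
    rw [setIntegral_congr_fun (coordSigma_le h t _ (hAm j)) hcongr, integral_const_mul,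
      hμ.setIntegral_shift t (hAm j) (G := fun w => passage h q ((k + j : ℤ) * h)
        ((m - j : ℤ) * h) w - passageMean μ q (k + j) (m - j)) (hmp.sub_const _),
      integral_sub (integrable_passage hh hq hxy) (integrable_const _)]
    simp [passageMean]
  rw [hNU, integral_biUnion_finset]
  · exact Finset.sum_eq_zero hzero
  · exact fun j _ => coordSigma_le h t _ (hAm j)
  · intro i _ j _ hij
    refine disjoint_left.2 ?_
    rintro w ⟨-, h1 : coord h t w = i * h⟩ ⟨-, h2 : coord h t w = j * h⟩
    have : (i : ℝ) = j := mul_right_cancel₀ hh.ne' (h1.symm.trans h2)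
    exact hij (by exact_mod_cast this)
  · intro j hj
    rw [Finset.mem_Ico] at hj
    refine Integrable.integrableOn ?_
    have hkm : -k ≤ m := by omega
    refine (integrable_passage hh hq ?_).sub (Integrable.const_mul ?_ _)
    · rw [← neg_mul]; exact mul_le_mul_of_nonneg_right (by exact_mod_cast hkm) hh.le
    · refine (integrable_const (1 : ℝ)).mono'
        ((measurable_passageValue q k m).comp (measurable_coord h t)).aestronglyMeasurable
        (Eventually.of_forall fun w => ?_)
      have h1 := passageValue_mem_Icc (μ := μ) hh hq (k := k) (m := m) ⌊coord h t w / h⌋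
      rw [Real.norm_eq_abs, abs_of_nonneg h1.1]
      exact h1.2

/-- The error lives on paths that left the strip: those with two jumps contribute at most their
probability, those with one jump at most `1 - e^{-qt}` each. Both contributions are `O(t²)`. -/
lemma IsLatticeLevy.abs_passageMean_sub_le (hμ : IsLatticeLevy μ) (hh : 0 < h) {q : ℝ}
    (hq : 0 ≤ q) {k m : ℤ} (hk : 0 ≤ k) (hm : 0 < m) (t : ℝ≥0) :
    |passageMean μ q k m -
      Real.exp (-q * t) * ∫ w, passageValue μ q k m ⌊coord h t w / h⌋ ∂μ| ≤
      μ.real (atMostOneJump h t)ᶜ + (1 - Real.exp (-q * t)) * μ.real {w | coord h t w ≠ 0} := by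
  have := hμ.prob
  have hkm : -k ≤ m := by omega
  have hkm' : -((k : ℝ) * h) ≤ m * h := by
    rw [← neg_mul]; exact mul_le_mul_of_nonneg_right (by exact_mod_cast hkm) hh.le
  have he1 : Real.exp (-q * t) ≤ 1 := by
    rw [Real.exp_le_one_iff]
    have : 0 ≤ q * t := by positivity
    linarith
  set N : Set (PathSpace h) := {w | ∀ s ≤ t, coord h s w ∈ Ico (-(k * h)) (m * h)} with hN
  have hNm : MeasurableSet N :=
    coordSigma_le h t _ (measurableSet_forall_le hh t measurableSet_Ico)
  have hV : Integrable (fun w => passageValue μ q k m ⌊coord h t w / h⌋) μ := by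
    refine (integrable_const (1 : ℝ)).mono'
      ((measurable_passageValue q k m).comp (measurable_coord h t)).aestronglyMeasurable
      (Eventually.of_forall fun w => ?_)
    have h1 := passageValue_mem_Icc (μ := μ) hh hq (k := k) (m := m) ⌊coord h t w / h⌋
    rw [Real.norm_eq_abs, abs_of_nonneg h1.1]
    exact h1.2
  have hF := integrable_passage (μ := μ) hh hq hkm'
  set D : PathSpace h → ℝ := fun w => passage h q (k * h) (m * h) w -
    Real.exp (-q * t) * passageValue μ q k m ⌊coord h t w / h⌋ with hD
  have hDi : Integrable D μ := hF.sub (hV.const_mul _)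
  have h1 : passageMean μ q k m -
      Real.exp (-q * t) * ∫ w, passageValue μ q k m ⌊coord h t w / h⌋ ∂μ = ∫ w in Nᶜ, D w ∂μ := by
    rw [passageMean, ← integral_const_mul, ← integral_sub hF (hV.const_mul _),
      ← integral_add_compl hNm hDi, hμ.setIntegral_passage_sub hh hq t, zero_add]
  -- The measurable hull has the same measure, so measurability of `atMostOneJump` is not needed.
  set B := toMeasurable μ (atMostOneJump h t)ᶜ with hB
  have hBm : MeasurableSet B := measurableSet_toMeasurable _ _
  have hJm : MeasurableSet {w : PathSpace h | coord h t w ≠ 0} :=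
    measurable_coord h t (measurableSet_singleton (0 : ℝ)).compl
  have hbi : Integrable (fun w => B.indicator (fun _ => (1 : ℝ)) w +
      (1 - Real.exp (-q * t)) * {w : PathSpace h | coord h t w ≠ 0}.indicator
        (fun _ => (1 : ℝ)) w) μ :=
    ((integrable_const (1 : ℝ)).indicator hBm).add
      (((integrable_const (1 : ℝ)).indicator hJm).const_mul _)
  have hpos : ∀ w, 0 ≤ B.indicator (fun _ => (1 : ℝ)) w +
      (1 - Real.exp (-q * t)) * {w : PathSpace h | coord h t w ≠ 0}.indicator
        (fun _ => (1 : ℝ)) w := fun w =>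
    add_nonneg (indicator_nonneg (fun _ _ => zero_le_one) _)
      (mul_nonneg (by linarith) (indicator_nonneg (fun _ _ => zero_le_one) _))
  have h2 : ‖∫ w in Nᶜ, D w ∂μ‖ ≤ ∫ w in Nᶜ, (B.indicator (fun _ => (1 : ℝ)) w +
      (1 - Real.exp (-q * t)) * {w : PathSpace h | coord h t w ≠ 0}.indicator
        (fun _ => (1 : ℝ)) w) ∂μ := by
    refine norm_integral_le_of_norm_le hbi.integrableOn ?_
    refine (ae_restrict_iff' hNm.compl).2 (Eventually.of_forall fun w hw => ?_)
    by_cases hwB : w ∈ B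
    · have h3 := passage_nonneg (h := h) q (k * h) (m * h) w
      have h4 := passage_le_one hq (k * h) (m * h) w
      have h5 := passageValue_mem_Icc (μ := μ) hh hq (k := k) (m := m) ⌊coord h t w / h⌋
      have h6 : 0 ≤ Real.exp (-q * t) * passageValue μ q k m ⌊coord h t w / h⌋ :=
        mul_nonneg (Real.exp_pos _).le h5.1
      have h7 : Real.exp (-q * t) * passageValue μ q k m ⌊coord h t w / h⌋ ≤ 1 :=
        mul_le_one₀ he1 h5.1 h5.2
      have h8 : ‖D w‖ ≤ 1 := by
        rw [Real.norm_eq_abs, abs_le]; constructor <;> simp only [hD] <;> linarith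
      rw [indicator_of_mem hwB]
      refine h8.trans (le_add_of_nonneg_right ?_)
      exact mul_nonneg (by linarith) (indicator_nonneg (fun _ _ => zero_le_one) _)
    · have hwG : w ∈ atMostOneJump h t := by
        by_contra hc
        exact hwB (subset_toMeasurable _ _ hc)
      obtain ⟨h3, h4⟩ := abs_sub_passageValue_le (μ := μ) hh hq hk hm hwG hw
      rw [indicator_of_notMem hwB, indicator_of_mem (show w ∈ {w | coord h t w ≠ 0} from h3),
        zero_add, mul_one]
      exact h4
  rw [h1, ← Real.norm_eq_abs]
  refine h2.trans ((setIntegral_le_integral hbi (Eventually.of_forall hpos)).trans ?_)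
  rw [integral_add ((integrable_const (1 : ℝ)).indicator hBm)
    (((integrable_const (1 : ℝ)).indicator hJm).const_mul _), integral_const_mul,
    integral_indicator_const _ hBm, integral_indicator_const _ hJm]
  simp only [smul_eq_mul, mul_one, measureReal_def, hB, measure_toMeasurable]
  exact le_rfl

end Recurrence

/-! ### The recurrence for two-sided passage -/

section RecurrenceLimit

variable {h : ℝ} {μ : Measure (PathSpace h)} {ν : Measure ℝ}

lemma tendsto_coe_nhdsGT_zero : Tendsto (fun t : ℝ≥0 => (t : ℝ)) (𝓝[>] 0) (𝓝[>] 0) := by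
  refine tendsto_nhdsWithin_iff.2 ⟨?_, ?_⟩
  · exact (NNReal.continuous_coe.tendsto' 0 0 (by simp)).mono_left nhdsWithin_le_nhds
  · filter_upwards [self_mem_nhdsWithin] with t ht using by simpa using ht

lemma tendsto_exp_sub_one_div (a : ℝ) :
    Tendsto (fun t : ℝ≥0 => (Real.exp (a * t) - 1) / t) (𝓝[>] 0) (𝓝 a) := by
  have h1 : HasDerivAt (fun t : ℝ => Real.exp (a * t)) a 0 := by
    have := ((hasDerivAt_id (0 : ℝ)).const_mul a).exp
    simpa using this
  have h2 := h1.tendsto_slope.mono_left (nhdsWithin_mono 0 (fun x (hx : 0 < x) => ne_of_gt hx))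
  refine (h2.comp tendsto_coe_nhdsGT_zero).congr fun t => ?_
  simp [slope_def_field]

lemma HasGenerator.exists_measureReal_ne_zero_le (hg : HasGenerator μ ν) (hμ : IsLatticeLevy μ) :
    ∃ C : ℝ, ∀ᶠ t : ℝ≥0 in 𝓝[>] 0, ∀ s ≤ t, μ.real {w | coord h s w ≠ 0} ≤ C * s := by
  have := hμ.prob
  have hm : MeasurableSet ({0}ᶜ : Set ℝ) := (measurableSet_singleton 0).compl
  have h1 := hg (({0}ᶜ : Set ℝ).indicator fun _ => 1) (measurable_const.indicator hm) fun x => by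
    by_cases hx : x ∈ ({0}ᶜ : Set ℝ)
    · rw [indicator_of_mem hx]; simp
    · rw [indicator_of_notMem hx]; simp
  set l := ∫ x, (({0}ᶜ : Set ℝ).indicator (fun _ => (1 : ℝ)) x -
    ({0}ᶜ : Set ℝ).indicator (fun _ => (1 : ℝ)) 0) ∂ν with hl
  -- `l` is the derivative at `0` of the probability of having moved; the `1` is slack for passing
  -- from the limit to small positive times.
  refine ⟨l + 1, ?_⟩
  have h2 : ∀ s : ℝ≥0, ∫ w, ({0}ᶜ : Set ℝ).indicator (fun _ => (1 : ℝ)) (coord h s w) ∂μ =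
      μ.real {w | coord h s w ≠ 0} := fun s => by
    have hms : MeasurableSet {w : PathSpace h | coord h s w ≠ 0} := measurable_coord h s hm
    have := integral_indicator_const (μ := μ) (1 : ℝ) hms
    rw [smul_eq_mul, mul_one] at this
    exact this
  have h3 := h1.eventually (gt_mem_nhds (lt_add_one l))
  obtain ⟨δ, hδ, hδs⟩ := (mem_nhdsGT_iff_exists_Ioo_subset' (zero_lt_one (α := ℝ≥0))).1 h3
  filter_upwards [Ioo_mem_nhdsGT hδ] with t ht s hs
  rcases (zero_le (a := s)).eq_or_lt with rfl | hs0
  · have h0 : μ {w | coord h 0 w ≠ 0} = 0 := hμ.ae_coord_zero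
    simp [measureReal_def, h0]
  · have h4 := hδs ⟨hs0, hs.trans_lt ht.2⟩
    have hs0' : (0 : ℝ) < s := by exact_mod_cast hs0
    simp only [mem_ofPred_eq] at h4
    rw [h2, div_lt_iff₀ hs0'] at h4
    simp only [mem_compl_iff, mem_singleton_iff, not_true_eq_false, not_false_eq_true,
      indicator_of_notMem, sub_zero] at h4
    exact h4.le

/-- The generator applied to the value function, which equals `u` at `0`, gives one limit of `(I t -
u) / t`; the short-time estimate with its `O(t²)` error gives the other, `q u`. -/
lemma IsLatticeLevy.mul_passageMean_eq_integral (hμ : IsLatticeLevy μ) (hh : 0 < h)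
    (hg : HasGenerator μ ν) {q : ℝ} (hq : 0 ≤ q) {k m : ℤ} (hk : 0 ≤ k) (hm : 0 < m) :
    q * passageMean μ q k m =
      ∫ x, (passageValue μ q k m ⌊x / h⌋ - passageMean μ q k m) ∂ν := by
  have := hμ.prob
  have hkm : -k ≤ m := by omega
  set u := passageMean μ q k m with hu
  have hV0 : passageValue μ q k m ⌊(0 : ℝ) / h⌋ = u := by
    rw [zero_div, Int.floor_zero, passageValue, if_neg (by omega), if_pos hm, add_zero, sub_zero]
  have h1 := hg (fun x => passageValue μ q k m ⌊x / h⌋) (measurable_passageValue q k m) fun x => by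
    have h1 := passageValue_mem_Icc (μ := μ) hh hq (k := k) (m := m) ⌊x / h⌋
    rw [abs_of_nonneg h1.1]; exact h1.2
  simp only [hV0] at h1
  refine tendsto_nhds_unique ?_ h1
  obtain ⟨C, hC⟩ := hg.exists_measureReal_ne_zero_le hμ
  set I : ℝ≥0 → ℝ := fun t => ∫ w, passageValue μ q k m ⌊coord h t w / h⌋ ∂μ with hI
  have hcoe0 : Tendsto (fun t : ℝ≥0 => (t : ℝ)) (𝓝[>] 0) (𝓝 0) :=
    tendsto_coe_nhdsGT_zero.mono_right nhdsWithin_le_nhds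
  have hexp : Tendsto (fun t : ℝ≥0 => Real.exp (q * t)) (𝓝[>] 0) (𝓝 1) := by
    have : Tendsto (fun t : ℝ => Real.exp (q * t)) (𝓝 0) (𝓝 1) :=
      Continuous.tendsto' (by fun_prop) _ _ (by simp)
    exact this.comp hcoe0
  have hrem : Tendsto (fun t : ℝ≥0 => (u - Real.exp (-q * t) * I t) / t) (𝓝[>] 0) (𝓝 0) := by
    have hlim : Tendsto (fun t : ℝ≥0 => C ^ 2 * t + q * t * C) (𝓝[>] 0) (𝓝 0) := by
      have := (hcoe0.const_mul (C ^ 2)).add ((hcoe0.const_mul q).mul_const C)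
      simpa using this
    refine squeeze_zero_norm' ?_ hlim
    filter_upwards [hC, self_mem_nhdsWithin] with t ht (ht0 : 0 < t)
    have ht0' : (0 : ℝ) < t := by exact_mod_cast ht0
    rw [norm_div, Real.norm_eq_abs, Real.norm_eq_abs, abs_of_pos ht0', div_le_iff₀ ht0']
    refine (hμ.abs_passageMean_sub_le hh hq hk hm t).trans ?_
    have a1 := hμ.measure_compl_atMostOneJump_le hh ht
    have a2 := ht t le_rfl
    have a3 : 1 - Real.exp (-q * t) ≤ q * t := by
      have := Real.add_one_le_exp (-q * t); linarith
    have a4 : (0 : ℝ) ≤ q * t := by positivity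
    have a5 : (1 - Real.exp (-q * t)) * μ.real {w | coord h t w ≠ 0} ≤ q * t * (C * t) :=
      mul_le_mul a3 a2 measureReal_nonneg a4
    calc _ ≤ (C * t) ^ 2 + q * t * (C * t) := add_le_add a1 a5
      _ = _ := by ring
  -- This uses `(I - u)/t = u (e^{qt} - 1)/t - e^{qt} (u - e^{-qt} I)/t`.
  have hfin := ((tendsto_exp_sub_one_div q).mul_const u).sub (hexp.mul hrem)
  rw [mul_zero, sub_zero] at hfin
  refine hfin.congr' ?_
  filter_upwards [self_mem_nhdsWithin] with t (ht0 : 0 < t)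
  have ht0' : (t : ℝ) ≠ 0 := by exact_mod_cast ht0.ne'
  have e : Real.exp (q * t) * Real.exp (-q * t) = 1 := by rw [← Real.exp_add]; simp
  field_simp
  rw [neg_mul] at e
  linear_combination (I t) * e

lemma integral_eq_sum_of_isSkipFreeMeasure (hh : 0 < h) (hν : IsSkipFreeMeasure h ν) {k : ℤ}
    {g : ℤ → ℝ} (hg : ∀ j < -k, g j = 0) :
    ∫ x, g ⌊x / h⌋ ∂ν = ∑ j ∈ Finset.Icc (-k) 1, g j * ν.real {(j : ℝ) * h} := by
  have := hν.finite
  have h1 : ∀ᵐ x ∂ν, g ⌊x / h⌋ =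
      ∑ j ∈ Finset.Icc (-k) 1, ({(j : ℝ) * h} : Set ℝ).indicator (fun _ => g j) x := by
    filter_upwards [hν.lattice] with x ⟨i, hi, hx⟩
    rw [hx, floor_intCast_mul_div hh]
    have h2 : ∀ j : ℤ, ({(j : ℝ) * h} : Set ℝ).indicator (fun _ => g j) ((i : ℝ) * h) =
        if j = i then g i else 0 := fun j => by
      by_cases hj : j = i
      · subst hj; simp
      · rw [if_neg hj, indicator_of_notMem]
        intro hc
        have : (i : ℝ) = j := mul_right_cancel₀ hh.ne' hc
        exact hj (by exact_mod_cast this.symm)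
    simp only [h2, Finset.sum_ite_eq', Finset.mem_Icc]
    split_ifs with h3
    · rfl
    · exact hg i (by omega)
  rw [integral_congr_ae h1, integral_finsetSum]
  · refine Finset.sum_congr rfl fun j _ => ?_
    rw [integral_indicator_const _ (measurableSet_singleton _), smul_eq_mul, mul_comm]
  · exact fun j _ => (integrable_const _).indicator (measurableSet_singleton _)

/-- First-step analysis: the mean passage functional solves the skip-free recurrence. -/
lemma IsLatticeLevy.passageMean_recurrence (hμ : IsLatticeLevy μ) (hh : 0 < h)
    (hg : HasGenerator μ ν) (hν : IsSkipFreeMeasure h ν) {q : ℝ} (hq : 0 ≤ q) (k m : ℕ) :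
    (ν.real univ + q) * passageMean μ q k (m + 1) =
      ν.real {h} * passageMean μ q (k + 1) m +
        ∑ i ∈ Finset.range (k + 1),
          ν.real {-(i * h)} * passageMean μ q ((k - i : ℕ) : ℤ) ((m + 1 + i : ℕ) : ℤ) := by
  have := hμ.prob
  have := hν.finite
  have h1 := hμ.mul_passageMean_eq_integral hh hg hq (k := k) (m := m + 1) (by omega) (by omega)
  have hgz : ∀ j < -(k : ℤ), passageValue μ q k (m + 1) j = 0 := fun j hj => by
    rw [passageValue, if_pos hj]
  have hi : Integrable (fun x => passageValue μ q k (m + 1) ⌊x / h⌋) ν := by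
    refine (integrable_const (1 : ℝ)).mono'
      (measurable_passageValue q k (m + 1)).aestronglyMeasurable (Eventually.of_forall fun x => ?_)
    have h1 := passageValue_mem_Icc (μ := μ) (k := k) (m := m + 1) hh hq ⌊x / h⌋
    rw [Real.norm_eq_abs, abs_of_nonneg h1.1]
    exact h1.2
  rw [integral_sub hi (integrable_const _), integral_eq_sum_of_isSkipFreeMeasure hh hν hgz,
    integral_const, smul_eq_mul] at h1
  have h2 : Finset.Icc (-(k : ℤ)) 1 = insert 1
      ((Finset.range (k + 1)).image fun i : ℕ => -(i : ℤ)) := by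
    ext j
    simp only [Finset.mem_Icc, Finset.mem_insert, Finset.mem_image, Finset.mem_range]
    constructor
    · rintro ⟨h2, h3⟩
      rcases h3.eq_or_lt with h3 | h3
      · exact Or.inl h3
      · exact Or.inr ⟨(-j).toNat, by omega, by omega⟩
    · rintro (rfl | ⟨i, hi, rfl⟩) <;> omega
  have h3 : ∑ j ∈ Finset.Icc (-(k : ℤ)) 1, passageValue μ q k (m + 1) j * ν.real {(j : ℝ) * h} =
      ν.real {h} * passageMean μ q (k + 1) m + ∑ i ∈ Finset.range (k + 1),
          ν.real {-(i * h)} * passageMean μ q ((k - i : ℕ) : ℤ) ((m + 1 + i : ℕ) : ℤ) := by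
    rw [h2, Finset.sum_insert, Finset.sum_image]
    · congr 1
      · rw [Int.cast_one, one_mul, mul_comm, passageValue, if_neg (by omega)]
        congr 1
        -- For `m = 0` the upward jump reaches the level and the value is `1`, which is also the
        -- passage mean at distance `0`; the recurrence thus needs no boundary case.
        split_ifs with h4
        · congr 1; omega
        · have : (m : ℤ) = 0 := by omega
          rw [this, hμ.passageMean_zero hh q (by omega)]
      · refine Finset.sum_congr rfl fun i hi => ?_
        have hik : i < k + 1 := Finset.mem_range.1 hi
        simp only [Int.cast_neg, Int.cast_natCast, neg_mul]
        rw [mul_comm, passageValue, if_neg (by omega), if_pos (by omega)]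
        congr 2
        · omega
        · push_cast; ring
    · exact fun a _ b _ hab => by simpa using hab
    · simp only [Finset.mem_image, not_exists, not_and]
      intro i _ hi
      omega
  rw [h3] at h1
  linarith

end RecurrenceLimit

/-! ### Scale sequences -/

section ScaleSequence

variable {h q : ℝ} {ν : Measure ℝ}

/-- The solution of the skip-free recurrence with the normalization of the scale function. -/
noncomputable def scaleSeq (h : ℝ) (ν : Measure ℝ) (q : ℝ) : ℕ → ℝ
  -- Forced by the Laplace transform as `β → ∞`: there `W_0 / β` is compared with `e^{βh} / (βh ·
  -- ν{h} e^{βh})`.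
  | 0 => 1 / (ν.real {h} * h)
  | k + 1 => ((ν.real univ + q) * scaleSeq h ν q k -
      ∑ i : Fin (k + 1), ν.real {-((i : ℕ) * h)} * scaleSeq h ν q (k - i)) / ν.real {h}
  decreasing_by all_goals omega

lemma scaleSeq_zero : scaleSeq h ν q 0 = 1 / (ν.real {h} * h) := by rw [scaleSeq]

lemma scaleSeq_succ (hν : IsSkipFreeMeasure h ν) (k : ℕ) :
    ν.real {h} * scaleSeq h ν q (k + 1) = (ν.real univ + q) * scaleSeq h ν q k -
      ∑ i ∈ Finset.range (k + 1), ν.real {-(i * h)} * scaleSeq h ν q (k - i) := by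
  rw [scaleSeq, mul_div_cancel₀ _ hν.pos.ne',
    Finset.sum_range fun i => ν.real {-(i * h)} * scaleSeq h ν q (k - i)]

/-- As `ν{h} > 0`, each step can be solved for the newest term, so the initial value decides. The
horizon `N` is there because passage means satisfy the recurrence only along a finite diagonal. -/
lemma eq_scaleSeq (hν : IsSkipFreeMeasure h ν) {V : ℕ → ℝ} {N : ℕ}
    (h0 : V 0 = scaleSeq h ν q 0)
    (hV : ∀ k < N, ν.real {h} * V (k + 1) = (ν.real univ + q) * V k -
      ∑ i ∈ Finset.range (k + 1), ν.real {-(i * h)} * V (k - i)) :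
    ∀ k ≤ N, V k = scaleSeq h ν q k := by
  intro k
  induction k using Nat.strong_induction_on with
  | _ k ih =>
    intro hk
    rcases k with _ | k
    · exact h0
    · have h1 := hV k hk
      rw [ih k (Nat.lt_succ_self k) (by omega), Finset.sum_congr rfl fun i hi => by
        rw [ih (k - i) (by omega) (by omega)], ← scaleSeq_succ hν] at h1
      exact mul_left_cancel₀ hν.pos.ne' h1

/-- The properties of the scale sequence that come from its probabilistic meaning. -/
structure IsScaleSequence (h : ℝ) (ν : Measure ℝ) (q : ℝ) : Prop where
  pos : ∀ k, 0 < scaleSeq h ν q k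
  le_succ : ∀ k, scaleSeq h ν q k ≤ scaleSeq h ν q (k + 1)
  ratio_mono : Monotone fun k => scaleSeq h ν q k / scaleSeq h ν q (k + 1)

section

variable {μ : Measure (PathSpace h)}

/-- Along the diagonal `k + m = N` the first-step equation is the recurrence of `scaleSeq`, so the
two sequences are proportional. The cross-multiplied form allows for `passageMean μ q 0 N = 0`,
which is excluded only afterwards. -/
lemma IsLatticeLevy.passageMean_mul_scaleSeq (hμ : IsLatticeLevy μ) (hh : 0 < h)
    (hg : HasGenerator μ ν) (hν : IsSkipFreeMeasure h ν) (hq : 0 ≤ q) (N k : ℕ) (hk : k ≤ N) :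
    passageMean μ q k ((N - k : ℕ) : ℤ) * scaleSeq h ν q 0 =
      passageMean μ q 0 N * scaleSeq h ν q k := by
  by_cases h0 : passageMean μ q 0 N = 0
  · rw [h0, zero_mul]
    suffices hz : ∀ k ≤ N, passageMean μ q k ((N - k : ℕ) : ℤ) = 0 by rw [hz k hk, zero_mul]
    intro k
    induction k using Nat.strong_induction_on with
    | _ k ih =>
      intro hk
      rcases k with _ | k
      · simpa using h0
      · have h1 := hμ.passageMean_recurrence hh hg hν hq k (N - (k + 1))
        have e1 : ((N - (k + 1) : ℕ) : ℤ) + 1 = ((N - k : ℕ) : ℤ) := by omega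
        rw [e1, ih k (Nat.lt_succ_self k) (by omega), Finset.sum_eq_zero, mul_zero, add_zero] at h1
        · exact (mul_eq_zero.1 h1.symm).resolve_left hν.pos.ne'
        · intro i hi
          rw [Finset.mem_range] at hi
          have e2 : N - (k + 1) + 1 + i = N - (k - i) := by omega
          rw [e2, ih (k - i) (by omega) (by omega), mul_zero]
  · have hV := eq_scaleSeq (q := q) (N := N) hν
      (V := fun k => passageMean μ q k ((N - k : ℕ) : ℤ) * (scaleSeq h ν q 0 / passageMean μ q 0 N))
      (by simp only [Nat.sub_zero, Nat.cast_zero]; field_simp) (fun k hk => by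
        have h1 := hμ.passageMean_recurrence hh hg hν hq k (N - (k + 1))
        have e1 : ((N - (k + 1) : ℕ) : ℤ) + 1 = ((N - k : ℕ) : ℤ) := by omega
        rw [e1] at h1
        have e3 : ∀ i ∈ Finset.range (k + 1), ν.real {-(i * h)} * passageMean μ q
            ((k - i : ℕ) : ℤ) ((N - (k + 1) + 1 + i : ℕ) : ℤ) = ν.real {-(i * h)} *
            passageMean μ q ((k - i : ℕ) : ℤ) ((N - (k - i) : ℕ) : ℤ) := fun i hi => by
          rw [Finset.mem_range] at hi
          have e2 : N - (k + 1) + 1 + i = N - (k - i) := by omega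
          rw [e2]
        rw [Finset.sum_congr rfl e3] at h1
        simp only [← mul_assoc, ← Finset.sum_mul]
        push_cast at h1 ⊢
        linear_combination -(scaleSeq h ν q 0 / passageMean μ q 0 N) * h1) k hk
    rw [← hV]
    field_simp

lemma scaleSeq_zero_pos (hh : 0 < h) (hν : IsSkipFreeMeasure h ν) : 0 < scaleSeq h ν q 0 := by
  rw [scaleSeq_zero]
  have := hν.pos
  positivity

/-- At `k = N` proportionality reads `W_0 = u(0, N) W_N`, with `W_0 > 0` and `u(0, N) ≥ 0`. -/
lemma IsLatticeLevy.scaleSeq_pos (hμ : IsLatticeLevy μ) (hh : 0 < h)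
    (hg : HasGenerator μ ν) (hν : IsSkipFreeMeasure h ν) (hq : 0 ≤ q) (N : ℕ) :
    0 < scaleSeq h ν q N := by
  have h1 := hμ.passageMean_mul_scaleSeq hh hg hν hq N N le_rfl
  rw [Nat.sub_self, Nat.cast_zero, hμ.passageMean_zero hh q (by omega), one_mul] at h1
  have h2 := scaleSeq_zero_pos (q := q) hh hν
  rw [h1] at h2
  exact pos_of_mul_pos_right h2 (passageMean_nonneg _ _ _)

/-- Two-sided passage probabilities are ratios of values of the scale sequence. -/
lemma IsLatticeLevy.passageMean_eq_div (hμ : IsLatticeLevy μ) (hh : 0 < h)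
    (hg : HasGenerator μ ν) (hν : IsSkipFreeMeasure h ν) (hq : 0 ≤ q) (k m : ℕ) :
    passageMean μ q k m = scaleSeq h ν q k / scaleSeq h ν q (k + m) := by
  have h1 := hμ.passageMean_mul_scaleSeq hh hg hν hq (k + m) k (by omega)
  have h2 := hμ.passageMean_mul_scaleSeq hh hg hν hq (k + m) (k + m) le_rfl
  rw [Nat.sub_self, Nat.cast_zero, hμ.passageMean_zero hh q (by omega), one_mul] at h2
  rw [Nat.add_sub_cancel_left] at h1
  have p0 := scaleSeq_zero_pos (q := q) hh hν
  have p1 := hμ.scaleSeq_pos hh hg hν hq (k + m)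
  rw [eq_div_iff p1.ne']
  refine mul_right_cancel₀ p0.ne' ?_
  linear_combination scaleSeq h ν q (k + m) * h1 - scaleSeq h ν q k * h2

/-- The ratio `W_k / W_{k+1}` is the mean passage from `0` to `h` with barrier at `-kh`: it is at
most `1`, and lowering the barrier increases it. -/
lemma IsLatticeLevy.isScaleSequence (hμ : IsLatticeLevy μ) (hh : 0 < h)
    (hg : HasGenerator μ ν) (hν : IsSkipFreeMeasure h ν) (hq : 0 ≤ q) :
    IsScaleSequence h ν q := by
  have := hμ.prob
  have hpos := hμ.scaleSeq_pos hh hg hν hq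
  have hr : ∀ k : ℕ, scaleSeq h ν q k / scaleSeq h ν q (k + 1) = passageMean μ q k (1 : ℕ) :=
    fun k => (hμ.passageMean_eq_div hh hg hν hq k 1).symm
  refine ⟨hpos, fun k => ?_, fun k l hkl => ?_⟩
  · have h1 : passageMean μ q k (1 : ℕ) ≤ 1 := passageMean_le_one hh hq (by omega)
    rw [← hr, div_le_one (hpos _)] at h1
    exact h1
  · simp only [hr]
    exact passageMean_mono hh hq (by exact_mod_cast hkl) (by omega)

end

end ScaleSequence

/-! ### The generating function of the scale sequence -/

section GeneratingFunction

variable {h q : ℝ} {ν : Measure ℝ}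

lemma IsSkipFreeMeasure.ae_le (hν : IsSkipFreeMeasure h ν) (hh : 0 < h) : ∀ᵐ x ∂ν, x ≤ h := by
  filter_upwards [hν.lattice] with x ⟨k, hk, hx⟩
  rw [hx]
  have : (k : ℝ) ≤ 1 := by exact_mod_cast hk
  nlinarith

lemma IsSkipFreeMeasure.integrable_exp (hν : IsSkipFreeMeasure h ν) (hh : 0 < h) {β : ℝ}
    (hβ : 0 ≤ β) : Integrable (fun x => Real.exp (β * x)) ν := by
  have := hν.finite
  refine (integrable_const (Real.exp (β * h))).mono' (by fun_prop) ?_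
  filter_upwards [hν.ae_le hh] with x hx
  rw [Real.norm_eq_abs, Real.abs_exp, Real.exp_le_exp]
  exact mul_le_mul_of_nonneg_left hx hβ

lemma IsSkipFreeMeasure.hasSum_integral (hν : IsSkipFreeMeasure h ν) (hh : 0 < h) {f : ℝ → ℝ}
    (hf : Integrable f ν) :
    HasSum (fun i : ℕ => ν.real {-(i * h)} * f (-(i * h))) (∫ x, f x ∂ν - ν.real {h} * f h) := by
  let s : ℕ → Set ℝ := fun n => {(1 - n) * h}
  have hs : ∀ᵐ x ∂ν, x ∈ ⋃ n, s n := by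
    filter_upwards [hν.lattice] with x ⟨k, hk, hx⟩
    refine mem_iUnion.2 ⟨(1 - k).toNat, ?_⟩
    have h1 : (((1 - k).toNat : ℤ) : ℝ) = ((1 - k : ℤ) : ℝ) := by
      rw [Int.toNat_of_nonneg (by omega)]
    simp only [s, mem_singleton_iff]
    rw [Int.cast_natCast] at h1
    rw [h1, hx]; push_cast; ring
  have h1 := hasSum_integral_iUnion (μ := ν) (f := f) (s := s) (fun n => measurableSet_singleton _)
    (fun i j hij => by
      refine disjoint_singleton.2 fun hc => hij ?_
      have := mul_right_cancel₀ hh.ne' hc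
      exact_mod_cast (sub_right_inj.1 this)) hf.integrableOn
  have h0 : ν.restrict (⋃ n, s n) = ν := Measure.restrict_eq_self_of_ae_mem hs
  rw [h0] at h1
  simp only [s, integral_singleton, smul_eq_mul] at h1
  have h2 := (hasSum_nat_add_iff' 1).2 h1
  simp only [Finset.sum_range_one, Nat.cast_zero, sub_zero, one_mul] at h2
  refine h2.congr_fun fun n => ?_
  have e : ((1 : ℝ) - ((n + 1 : ℕ) : ℝ)) * h = -(n * h) := by push_cast; ring
  rw [e]

lemma exp_neg_mul_pow (β : ℝ) (i : ℕ) : Real.exp (β * -(i * h)) = Real.exp (-(β * h)) ^ i := by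
  rw [← Real.exp_nat_mul]; congr 1; ring

lemma IsSkipFreeMeasure.hasSum_laplaceExponent (hν : IsSkipFreeMeasure h ν) (hh : 0 < h) {β : ℝ}
    (hβ : 0 ≤ β) :
    HasSum (fun i : ℕ => ν.real {-(i * h)} * Real.exp (-(β * h)) ^ i)
      (laplaceExponent ν β + ν.real univ - ν.real {h} * Real.exp (β * h)) := by
  have := hν.finite
  have hi := hν.integrable_exp hh hβ
  have h1 := hν.hasSum_integral hh hi
  simp only [exp_neg_mul_pow] at h1
  convert h1 using 2
  rw [laplaceExponent, integral_sub hi (integrable_const _)]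
  simp

/-- The limit of the ratios of consecutive terms of the scale sequence. -/
noncomputable def scaleRatio (h : ℝ) (ν : Measure ℝ) (q : ℝ) : ℝ :=
  ⨆ k, scaleSeq h ν q k / scaleSeq h ν q (k + 1)

namespace IsScaleSequence

lemma ratio_le_one (hs : IsScaleSequence h ν q) (k : ℕ) :
    scaleSeq h ν q k / scaleSeq h ν q (k + 1) ≤ 1 :=
  (div_le_one (hs.pos _)).2 (hs.le_succ k)

lemma bddAbove_ratio (hs : IsScaleSequence h ν q) :
    BddAbove (range fun k => scaleSeq h ν q k / scaleSeq h ν q (k + 1)) :=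
  ⟨1, by rintro _ ⟨k, rfl⟩; exact hs.ratio_le_one k⟩

lemma ratio_le_scaleRatio (hs : IsScaleSequence h ν q) (k : ℕ) :
    scaleSeq h ν q k / scaleSeq h ν q (k + 1) ≤ scaleRatio h ν q :=
  le_ciSup hs.bddAbove_ratio k

lemma scaleRatio_pos (hs : IsScaleSequence h ν q) : 0 < scaleRatio h ν q :=
  (div_pos (hs.pos 0) (hs.pos 1)).trans_le (hs.ratio_le_scaleRatio 0)

lemma scaleRatio_le_one (hs : IsScaleSequence h ν q) : scaleRatio h ν q ≤ 1 :=
  ciSup_le hs.ratio_le_one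

/-- Ratio test: some ratio `W_K / W_{K+1}` exceeds `z`, and by monotonicity all later ones do. -/
lemma summable (hs : IsScaleSequence h ν q) {z : ℝ} (hz : 0 < z) (hz' : z < scaleRatio h ν q) :
    Summable fun k => scaleSeq h ν q k * z ^ k := by
  obtain ⟨K, hK⟩ := exists_lt_of_lt_ciSup hz'
  have hK0 : 0 < scaleSeq h ν q K / scaleSeq h ν q (K + 1) := div_pos (hs.pos _) (hs.pos _)
  refine summable_of_ratio_norm_eventually_le ((div_lt_one hK0).2 hK) ?_
  filter_upwards [eventually_ge_atTop K] with k hk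
  have h1 := hs.ratio_mono hk
  simp only at h1
  set g := scaleSeq h ν q K / scaleSeq h ν q (K + 1)
  rw [le_div_iff₀ (hs.pos _)] at h1
  have p1 := hs.pos k
  have p2 := hs.pos (k + 1)
  rw [Real.norm_of_nonneg (by positivity), Real.norm_of_nonneg (by positivity),
    div_mul_eq_mul_div, le_div_iff₀ hK0]
  have : 0 ≤ z ^ (k + 1) := by positivity
  calc _ = (g * scaleSeq h ν q (k + 1)) * z ^ (k + 1) := by ring
    _ ≤ scaleSeq h ν q k * z ^ (k + 1) := mul_le_mul_of_nonneg_right h1 this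
    _ = _ := by ring

lemma le_scaleSeq (hs : IsScaleSequence h ν q) (k : ℕ) :
    scaleSeq h ν q 0 ≤ scaleSeq h ν q k * scaleRatio h ν q ^ k := by
  induction k with
  | zero => simp
  | succ k ih =>
    have h1 := hs.ratio_le_scaleRatio k
    rw [div_le_iff₀ (hs.pos _)] at h1
    have h2 := pow_pos hs.scaleRatio_pos k
    calc _ ≤ _ := ih
      _ ≤ (scaleRatio h ν q * scaleSeq h ν q (k + 1)) * scaleRatio h ν q ^ k := by gcongr
      _ = _ := by ring

/-- From `W_k ≥ W_0 R^{-k}` comes a geometric minorant; it makes the generating function blow up as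
`z` approaches `R`. -/
lemma le_tsum (hs : IsScaleSequence h ν q) {z : ℝ} (hz : 0 < z) (hz' : z < scaleRatio h ν q) :
    scaleSeq h ν q 0 / (1 - z / scaleRatio h ν q) ≤ ∑' k, scaleSeq h ν q k * z ^ k := by
  have hr := hs.scaleRatio_pos
  have h1 : z / scaleRatio h ν q < 1 := (div_lt_one hr).2 hz'
  have h2 := (hasSum_geometric_of_lt_one (by positivity) h1).mul_left (scaleSeq h ν q 0)
  rw [div_eq_mul_inv, ← h2.tsum_eq]
  refine h2.summable.tsum_le_tsum (fun k => ?_) (hs.summable hz hz')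
  rw [div_pow, mul_div_assoc', div_le_iff₀ (pow_pos hr k)]
  have := hs.le_scaleSeq k
  have h3 := pow_pos hz k
  calc _ ≤ (scaleSeq h ν q k * scaleRatio h ν q ^ k) * z ^ k := by gcongr
    _ = _ := by ring

/-- The generating function of the scale sequence. -/
lemma tsum_mul_eq (hs : IsScaleSequence h ν q) (hh : 0 < h) (hν : IsSkipFreeMeasure h ν) {β : ℝ}
    (hβ : 0 ≤ β) (hβ' : Real.exp (-(β * h)) < scaleRatio h ν q) :
    (∑' k, scaleSeq h ν q k * Real.exp (-(β * h)) ^ k) *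
      (Real.exp (-(β * h)) * (laplaceExponent ν β - q)) = 1 / h := by
  set z := Real.exp (-(β * h)) with hz
  have hz0 : 0 < z := Real.exp_pos _
  have hS := hs.summable hz0 hβ'
  have hB := hν.hasSum_laplaceExponent hh hβ
  rw [← hz] at hB
  have hprod := hasSum_sum_range_mul_of_summable_norm
    (f := fun i : ℕ => ν.real {-(i * h)} * z ^ i) (g := fun k => scaleSeq h ν q k * z ^ k)
    (hB.summable.congr fun i => (Real.norm_of_nonneg (by positivity)).symm)
    (hS.congr fun k => (Real.norm_of_nonneg (mul_nonneg (hs.pos k).le (by positivity))).symm)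
  rw [hB.tsum_eq] at hprod
  set S := ∑' k, scaleSeq h ν q k * z ^ k with hSdef
  have hshift := (hasSum_nat_add_iff' 1).2 hS.hasSum
  rw [← hSdef, Finset.sum_range_one, pow_zero, mul_one] at hshift
  have h1 := hshift.mul_left (ν.real {h})
  have h2 := ((hS.hasSum.mul_left (ν.real univ + q)).sub hprod).mul_left z
  -- The recurrence times `z^{k+1}`, summed over `k`: `ν{h} (S - W_0) = z (ν(ℝ) + q) S - z B S`,
  -- where `B = ψ(β) + ν(ℝ) - ν{h} e^{βh}`. Since `z e^{βh} = 1`, the terms `ν{h} S` cancel.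
  have h3 := h1.unique (h2.congr_fun fun k => by
    have e := scaleSeq_succ (q := q) hν k
    have e2 : ∑ i ∈ Finset.range (k + 1), ν.real {-(i * h)} * z ^ i *
        (scaleSeq h ν q (k - i) * z ^ (k - i)) =
        (∑ i ∈ Finset.range (k + 1), ν.real {-(i * h)} * scaleSeq h ν q (k - i)) * z ^ k := by
      rw [Finset.sum_mul]
      refine Finset.sum_congr rfl fun i hi => ?_
      have : z ^ k = z ^ i * z ^ (k - i) := by
        rw [← pow_add, Nat.add_sub_cancel' (Nat.lt_succ_iff.1 (Finset.mem_range.1 hi))]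
      rw [this]; ring
    rw [e2, pow_succ, ← mul_assoc, e]; ring)
  have h4 : Real.exp (β * h) * z = 1 := by rw [hz, ← Real.exp_add]; simp
  have h5 : ν.real {h} * scaleSeq h ν q 0 = 1 / h := by
    have := hν.pos.ne'
    rw [scaleSeq_zero]; field_simp
  rw [← h5]
  linear_combination h3 + ν.real {h} * S * h4

end IsScaleSequence

lemma IsSkipFreeMeasure.continuousOn_laplaceExponent (hν : IsSkipFreeMeasure h ν) (hh : 0 < h) :
    ContinuousOn (laplaceExponent ν) (Ici 0) := by
  have := hν.finite
  intro β hβ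
  refine continuousWithinAt_of_dominated (bound := fun _ => Real.exp ((β + 1) * h) + 1)
    (Eventually.of_forall fun b => by fun_prop) ?_ (integrable_const _)
    (Eventually.of_forall fun x => by fun_prop)
  have h1 : ∀ᶠ b in 𝓝[Ici 0] β, b < β + 1 :=
    mem_nhdsWithin_of_mem_nhds (gt_mem_nhds (lt_add_one β))
  filter_upwards [h1, self_mem_nhdsWithin] with b hb (hb0 : 0 ≤ b)
  filter_upwards [hν.ae_le hh] with x hx
  refine (norm_sub_le _ _).trans ?_
  rw [Real.norm_eq_abs, Real.abs_exp, norm_one]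
  refine add_le_add (Real.exp_le_exp.2 ?_) le_rfl
  calc b * x ≤ b * h := mul_le_mul_of_nonneg_left hx hb0
    _ ≤ (β + 1) * h := mul_le_mul_of_nonneg_right hb.le hh.le

namespace IsScaleSequence

lemma exp_lt_scaleRatio (hs : IsScaleSequence h ν q) (hh : 0 < h) {β : ℝ}
    (hβ : -Real.log (scaleRatio h ν q) / h < β) : Real.exp (-(β * h)) < scaleRatio h ν q := by
  rw [← Real.lt_log_iff_exp_lt hs.scaleRatio_pos]
  rw [div_lt_iff₀ hh] at hβ
  linarith

lemma neg_log_scaleRatio_nonneg (hs : IsScaleSequence h ν q) (hh : 0 < h) :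
    0 ≤ -Real.log (scaleRatio h ν q) / h :=
  div_nonneg (neg_nonneg.2 (Real.log_nonpos hs.scaleRatio_pos.le hs.scaleRatio_le_one)) hh.le

lemma tsum_pos (hs : IsScaleSequence h ν q) {z : ℝ} (hz : 0 < z) (hz' : z < scaleRatio h ν q) :
    0 < ∑' k, scaleSeq h ν q k * z ^ k := by
  have hr := hs.scaleRatio_pos
  refine (div_pos (hs.pos 0) ?_).trans_le (hs.le_tsum hz hz')
  rw [sub_pos, div_lt_one hr]; exact hz'

/-- In `S z (ψ(β) - q) = 1/h` both `S` and `z` are positive. -/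
lemma lt_laplaceExponent (hs : IsScaleSequence h ν q) (hh : 0 < h) (hν : IsSkipFreeMeasure h ν)
    {β : ℝ} (hβ : -Real.log (scaleRatio h ν q) / h < β) : q < laplaceExponent ν β := by
  have h1 := hs.exp_lt_scaleRatio hh hβ
  have h2 := hs.tsum_mul_eq hh hν ((hs.neg_log_scaleRatio_nonneg hh).trans hβ.le) h1
  have h3 : 0 < 1 / h := by positivity
  rw [← h2] at h3
  have h4 := pos_of_mul_pos_right h3 (hs.tsum_pos (Real.exp_pos _) h1).le
  have h5 := pos_of_mul_pos_right h4 (Real.exp_pos _).le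
  linarith

/-- As `β` decreases to `-log R / h`, `z (ψ(β) - q) = 1/(hS)` is squeezed between `0` and `(1 -
z/R)/(h W_0)`, which tends to `0`. Continuity of `ψ` concludes, without any use of convexity. -/
lemma laplaceExponent_neg_log_scaleRatio (hs : IsScaleSequence h ν q) (hh : 0 < h)
    (hν : IsSkipFreeMeasure h ν) :
    laplaceExponent ν (-Real.log (scaleRatio h ν q) / h) = q := by
  set b := -Real.log (scaleRatio h ν q) / h with hb
  have hb0 : 0 ≤ b := hs.neg_log_scaleRatio_nonneg hh
  have hr := hs.scaleRatio_pos
  have hW := hs.pos 0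
  have hcont : Tendsto (laplaceExponent ν) (𝓝[>] b) (𝓝 (laplaceExponent ν b)) :=
    (hν.continuousOn_laplaceExponent hh b hb0).mono_left
      (nhdsWithin_mono b fun x (hx : b < x) => hb0.trans hx.le)
  have he : Tendsto (fun β : ℝ => Real.exp (-(β * h))) (𝓝[>] b) (𝓝 (scaleRatio h ν q)) := by
    have h1 : Real.exp (-(b * h)) = scaleRatio h ν q := by
      rw [hb, div_mul_cancel₀ _ hh.ne', neg_neg, Real.exp_log hr]
    rw [← h1]
    exact ((by fun_prop : Continuous fun β : ℝ => Real.exp (-(β * h))).tendsto b).mono_left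
      nhdsWithin_le_nhds
  have hl := he.mul (hcont.sub_const q)
  have hu : Tendsto (fun β : ℝ => (1 - Real.exp (-(β * h)) / scaleRatio h ν q) /
      (h * scaleSeq h ν q 0)) (𝓝[>] b) (𝓝 0) := by
    have := ((he.div_const (scaleRatio h ν q)).const_sub 1).div_const (h * scaleSeq h ν q 0)
    rwa [div_self hr.ne', sub_self, zero_div] at this
  have h0 : scaleRatio h ν q * (laplaceExponent ν b - q) = 0 := by
    refine tendsto_nhds_unique hl (squeeze_zero' ?_ ?_ hu)
    · filter_upwards [self_mem_nhdsWithin] with β hβ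
      have := hs.lt_laplaceExponent hh hν hβ
      exact mul_nonneg (Real.exp_pos _).le (by linarith)
    · filter_upwards [self_mem_nhdsWithin] with β hβ
      have h1 := hs.exp_lt_scaleRatio hh hβ
      have h2 := hs.tsum_mul_eq hh hν (hb0.trans (le_of_lt hβ)) h1
      have h3 := hs.le_tsum (Real.exp_pos _) h1
      have h4 : 0 < 1 - Real.exp (-(β * h)) / scaleRatio h ν q := by
        rw [sub_pos, div_lt_one hr]; exact h1
      have h5 := hs.lt_laplaceExponent hh hν hβ
      have h6 : 0 ≤ Real.exp (-(β * h)) * (laplaceExponent ν β - q) :=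
        mul_nonneg (Real.exp_pos _).le (by linarith)
      have h7 := mul_le_mul_of_nonneg_right h3 h6
      rw [h2, div_mul_eq_mul_div, div_le_div_iff₀ h4 hh] at h7
      rw [le_div_iff₀ (by positivity)]
      linarith
  have := (mul_eq_zero.1 h0).resolve_left hr.ne'
  linarith

lemma isGreatest_root (hs : IsScaleSequence h ν q) (hh : 0 < h) (hν : IsSkipFreeMeasure h ν) :
    IsGreatest {β | 0 ≤ β ∧ laplaceExponent ν β = q} (-Real.log (scaleRatio h ν q) / h) := by
  refine ⟨⟨hs.neg_log_scaleRatio_nonneg hh, hs.laplaceExponent_neg_log_scaleRatio hh hν⟩, ?_⟩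
  rintro β ⟨-, hβ⟩
  by_contra! hlt
  exact (hs.lt_laplaceExponent hh hν hlt).ne' hβ

lemma largestRoot_eq (hs : IsScaleSequence h ν q) (hh : 0 < h) (hν : IsSkipFreeMeasure h ν) :
    largestRoot (laplaceExponent ν) q = -Real.log (scaleRatio h ν q) / h :=
  (hs.isGreatest_root hh hν).csSup_eq

end IsScaleSequence

end GeneratingFunction

/-! ### Scale functions as step functions -/

section StepFunction

variable {h q : ℝ} {ν : Measure ℝ}

lemma floor_div_eq_of_mem_Ico (hh : 0 < h) {n : ℕ} {x : ℝ} (hx : x ∈ Ico (n * h) ((n + 1) * h)) :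
    ⌊x / h⌋₊ = n := by
  have h0 : 0 ≤ x / h := div_nonneg ((by positivity : (0 : ℝ) ≤ n * h).trans hx.1) hh.le
  rw [Nat.floor_eq_iff h0, le_div_iff₀ hh, div_lt_iff₀ hh]
  exact hx

lemma mem_Ico_floor_div (hh : 0 < h) {x : ℝ} (hx : 0 ≤ x) :
    x ∈ Ico (⌊x / h⌋₊ * h) ((⌊x / h⌋₊ + 1) * h) := by
  rw [mem_Ico, ← le_div_iff₀ hh, ← div_lt_iff₀ hh]
  exact ⟨Nat.floor_le (div_nonneg hx hh.le), Nat.lt_floor_add_one _⟩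

lemma iUnion_Ico_mul (hh : 0 < h) : ⋃ n : ℕ, Ico ((n : ℝ) * h) ((n + 1) * h) = Ici 0 := by
  ext x
  simp only [mem_iUnion, mem_Ici]
  constructor
  · rintro ⟨n, hn⟩
    exact (by positivity : (0 : ℝ) ≤ n * h).trans hn.1
  · exact fun hx => ⟨_, mem_Ico_floor_div hh hx⟩

lemma setIntegral_exp_neg_Ico {β : ℝ} (hβ : 0 < β) (hh : 0 < h) (n : ℕ) :
    ∫ x in Ico ((n : ℝ) * h) ((n + 1) * h), Real.exp (-β * x) =
      Real.exp (-(β * h)) ^ n * ((1 - Real.exp (-(β * h))) / β) := by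
  have hle : (n : ℝ) * h ≤ (n + 1) * h := by nlinarith
  rw [integral_Ico_eq_integral_Ioc, ← intervalIntegral.integral_of_le hle,
    intervalIntegral.integral_eq_sub_of_hasDerivAt (f := fun x => -(Real.exp (-β * x) / β))]
  · have e1 : Real.exp (-β * ((n + 1) * h)) = Real.exp (-(β * h)) ^ n * Real.exp (-(β * h)) := by
      rw [← pow_succ, ← Real.exp_nat_mul]; congr 1; push_cast; ring
    have e2 : Real.exp (-β * (n * h)) = Real.exp (-(β * h)) ^ n := by
      rw [← Real.exp_nat_mul]; congr 1; ring
    rw [e1, e2]; ring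
  · intro x _
    have h1 := (((hasDerivAt_id x).const_mul (-β)).exp.div_const β).neg
    refine h1.congr_deriv ?_
    simp only [id_eq]
    field_simp
  · exact (by fun_prop : Continuous fun x : ℝ => Real.exp (-β * x)).intervalIntegrable _ _

lemma hasSum_laplace_step (hh : 0 < h) {β : ℝ} (hβ : 0 < β) {V : ℕ → ℝ} (hV : ∀ k, 0 ≤ V k)
    (hs : Summable fun k => V k * Real.exp (-(β * h)) ^ k) :
    IntegrableOn (fun x => Real.exp (-β * x) * V ⌊x / h⌋₊) (Ioi 0) ∧
      ∫ x in Ioi (0 : ℝ), Real.exp (-β * x) * V ⌊x / h⌋₊ =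
        (∑' k, V k * Real.exp (-(β * h)) ^ k) * ((1 - Real.exp (-(β * h))) / β) := by
  have hcongr : ∀ n : ℕ, EqOn (fun x => Real.exp (-β * x) * V ⌊x / h⌋₊)
      (fun x => Real.exp (-β * x) * V n) (Ico ((n : ℝ) * h) ((n + 1) * h)) := fun n x hx => by
    simp only [floor_div_eq_of_mem_Ico hh hx]
  have hint : ∀ n : ℕ, ∫ x in Ico ((n : ℝ) * h) ((n + 1) * h), Real.exp (-β * x) * V ⌊x / h⌋₊ =
      V n * Real.exp (-(β * h)) ^ n * ((1 - Real.exp (-(β * h))) / β) := fun n => by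
    rw [setIntegral_congr_fun measurableSet_Ico (hcongr n), integral_mul_const,
      setIntegral_exp_neg_Ico hβ hh]
    ring
  have hon : ∀ n : ℕ, IntegrableOn (fun x => Real.exp (-β * x) * V ⌊x / h⌋₊)
      (Ico ((n : ℝ) * h) ((n + 1) * h)) := fun n => by
    rw [integrableOn_congr_fun (hcongr n) measurableSet_Ico]
    exact ((by fun_prop : Continuous fun x : ℝ => Real.exp (-β * x) * V n).integrableOn_Icc).mono_set
      Ico_subset_Icc_self
  have hsum := hs.mul_right ((1 - Real.exp (-(β * h))) / β)
  have hIci : IntegrableOn (fun x => Real.exp (-β * x) * V ⌊x / h⌋₊) (Ici 0) := by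
    rw [← iUnion_Ico_mul hh]
    refine integrableOn_iUnion_of_summable_integral_norm hon ?_
    refine hsum.congr fun n => ?_
    rw [← hint]
    refine setIntegral_congr_fun measurableSet_Ico fun x _ => ?_
    exact (Real.norm_of_nonneg (mul_nonneg (Real.exp_pos _).le (hV _))).symm
  refine ⟨hIci.mono_set Ioi_subset_Ici_self, ?_⟩
  rw [← integral_Ici_eq_integral_Ioi, ← tsum_mul_right, ← iUnion_Ico_mul hh,
    integral_iUnion (fun _ => measurableSet_Ico) _ (by rwa [iUnion_Ico_mul hh])]
  · exact tsum_congr hint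
  · intro i j hij
    refine disjoint_left.2 fun x hi hj => hij ?_
    rw [← floor_div_eq_of_mem_Ico hh hi, floor_div_eq_of_mem_Ico hh hj]

lemma IsScaleSequence.hasScaleLaplaceTransform (hs : IsScaleSequence h ν q) (hh : 0 < h)
    (hν : IsSkipFreeMeasure h ν) :
    HasScaleLaplaceTransform h (laplaceExponent ν) q fun x => scaleSeq h ν q ⌊x / h⌋₊ := by
  intro β hβ
  rw [hs.largestRoot_eq hh hν] at hβ
  have hβ0 : 0 < β := (hs.neg_log_scaleRatio_nonneg hh).trans_lt hβ
  have hr := hs.exp_lt_scaleRatio hh hβ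
  obtain ⟨h1, h2⟩ := hasSum_laplace_step hh hβ0 (fun k => (hs.pos k).le)
    (hs.summable (Real.exp_pos _) hr)
  refine ⟨h1, ?_⟩
  have h3 := hs.tsum_mul_eq hh hν hβ0.le hr
  have h4 : laplaceExponent ν β - q ≠ 0 := (sub_pos.2 (hs.lt_laplaceExponent hh hν hβ)).ne'
  have h5 : Real.exp (β * h) * Real.exp (-(β * h)) = 1 := by rw [← Real.exp_add]; simp
  rw [h2]
  set S := ∑' k, scaleSeq h ν q k * Real.exp (-(β * h)) ^ k
  set z := Real.exp (-(β * h))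
  set E := Real.exp (β * h)
  rw [mul_div_assoc', div_eq_div_iff hβ0.ne' (by positivity)]
  have h6 : S * (z * (laplaceExponent ν β - q)) * h = 1 := by rw [h3]; field_simp
  have hz : z ≠ 0 := (Real.exp_pos _).ne'
  have hmain : S * (1 - z) * (h * (laplaceExponent ν β - q)) = E - 1 := by
    linear_combination (E - 1) * h6 - S * h * (laplaceExponent ν β - q) * h5
  linear_combination β * hmain

/-- The step function of a sequence is continuous from the right. -/
lemma eventually_floor_div_eq_right (hh : 0 < h) {x : ℝ} (hx : 0 ≤ x) :
    ∀ᶠ y in 𝓝[≥] x, ⌊y / h⌋₊ = ⌊x / h⌋₊ := by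
  have h1 := mem_Ico_floor_div hh hx
  filter_upwards [Ico_mem_nhdsGE h1.2] with y hy
  exact floor_div_eq_of_mem_Ico hh ⟨h1.1.trans hy.1, hy.2⟩

lemma exists_eventually_floor_div_eq_left (hh : 0 < h) {x : ℝ} (hx : 0 < x) :
    ∃ n : ℕ, ∀ᶠ y in 𝓝[<] x, ⌊y / h⌋₊ = n := by
  obtain ⟨m, hm⟩ : ∃ m : ℕ, ⌈x / h⌉₊ = m + 1 :=
    Nat.exists_eq_succ_of_ne_zero (Nat.ceil_pos.2 (by positivity)).ne'
  have h1 := Nat.ceil_lt_add_one (a := x / h) (by positivity)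
  have h2 := Nat.le_ceil (x / h)
  rw [hm] at h1 h2
  push_cast at h1 h2
  have h3 : (m : ℝ) * h < x := by
    rw [← lt_div_iff₀ hh]; linarith
  rw [div_le_iff₀ hh] at h2
  refine ⟨m, ?_⟩
  filter_upwards [Ico_mem_nhdsLT h3] with y hy
  exact floor_div_eq_of_mem_Ico hh ⟨hy.1, hy.2.trans_le h2⟩

lemma isPiecewiseContinuous_step (hh : 0 < h) (V : ℕ → ℝ) :
    IsPiecewiseContinuous fun x => V ⌊x / h⌋₊ := by
  refine ⟨fun R => ?_, fun x hx => ?_, fun x hx => ?_⟩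
  · refine ((Finset.range (⌊R / h⌋₊ + 1)).finite_toSet.image fun n : ℕ => (n : ℝ) * h).subset ?_
    rintro x ⟨hx, hxc⟩
    refine ⟨⌊x / h⌋₊, ?_, ?_⟩
    · simp only [Finset.coe_range, mem_Iio, Nat.lt_succ_iff]
      exact Nat.floor_mono (div_le_div_of_nonneg_right hx.2 hh.le)
    · by_contra hne
      apply hxc
      have h1 := mem_Ico_floor_div hh hx.1
      have h2 : ∀ᶠ y in 𝓝 x, V ⌊y / h⌋₊ = V ⌊x / h⌋₊ := by
        filter_upwards [Ioo_mem_nhds (lt_of_le_of_ne h1.1 hne) h1.2] with y hy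
        rw [floor_div_eq_of_mem_Ico hh ⟨hy.1.le, hy.2⟩]
      exact ((continuousAt_const (y := V ⌊x / h⌋₊)).congr
        (h2.mono fun y hy => hy.symm)).continuousWithinAt
  · obtain ⟨n, hn⟩ := exists_eventually_floor_div_eq_left hh hx
    exact ⟨V n, tendsto_const_nhds.congr' (hn.mono fun y hy => by simp only [hy])⟩
  · refine ⟨V ⌊x / h⌋₊, tendsto_const_nhds.congr' ?_⟩
    have := nhdsWithin_mono x Ioi_subset_Ici_self (eventually_floor_div_eq_right hh hx)
    filter_upwards [this] with y hy
    have hy' : ⌊y / h⌋₊ = ⌊x / h⌋₊ := hy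
    rw [hy']

lemma IsScaleSequence.isOfExponentialOrder (hs : IsScaleSequence h ν q) (hh : 0 < h) :
    IsOfExponentialOrder fun x => scaleSeq h ν q ⌊x / h⌋₊ := by
  -- The ratios increase, so the first is the smallest and bounds the growth: `W_k ≤ W_0 g^{-k}`.
  set g := scaleSeq h ν q 0 / scaleSeq h ν q 1 with hg
  have hg0 : 0 < g := div_pos (hs.pos 0) (hs.pos 1)
  have hg1 : g ≤ 1 := hs.ratio_le_one 0
  have hle : ∀ k, scaleSeq h ν q k ≤ scaleSeq h ν q 0 * Real.exp (k * -Real.log g) := fun k => by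
    induction k with
    | zero => simp
    | succ k ih =>
      have h1 := hs.ratio_mono (Nat.zero_le k)
      simp only [zero_add, ← hg] at h1
      rw [le_div_iff₀ (hs.pos _)] at h1
      have h2 : Real.exp (((k + 1 : ℕ) : ℝ) * -Real.log g) =
          Real.exp (k * -Real.log g) * g⁻¹ := by
        rw [← Real.exp_log (inv_pos.2 hg0), ← Real.exp_add, Real.log_inv]
        congr 1; push_cast; ring
      rw [h2, ← mul_assoc, ← div_eq_mul_inv, le_div_iff₀ hg0]
      linarith
  have hl : 0 ≤ -Real.log g := neg_nonneg.2 (Real.log_nonpos hg0.le hg1)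
  refine ⟨-Real.log g / h, scaleSeq h ν q 0, div_nonneg hl hh.le, (hs.pos 0).le, fun x hx => ?_⟩
  refine (hle _).trans (mul_le_mul_of_nonneg_left (Real.exp_le_exp.2 ?_) (hs.pos 0).le)
  calc (⌊x / h⌋₊ : ℝ) * -Real.log g ≤ x / h * -Real.log g :=
        mul_le_mul_of_nonneg_right (Nat.floor_le (div_nonneg hx hh.le)) hl
    _ = _ := by ring

lemma IsScaleSequence.isScaleSolution (hs : IsScaleSequence h ν q) (hh : 0 < h)
    (hν : IsSkipFreeMeasure h ν) :
    IsScaleSolution h (laplaceExponent ν) q fun x => scaleSeq h ν q ⌊x / h⌋₊ where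
  nonneg _ _ := (hs.pos _).le
  rightCont x hx := by
    refine (continuousWithinAt_const (b := scaleSeq h ν q ⌊x / h⌋₊)).congr_of_eventuallyEq ?_ rfl
    filter_upwards [eventually_floor_div_eq_right hh hx] with y hy
    rw [hy]
  piecewise := isPiecewiseContinuous_step hh _
  expOrder := hs.isOfExponentialOrder hh
  laplace := hs.hasScaleLaplaceTransform hh hν

/-- Being a scale solution only depends on the values on `[0, ∞)`. -/
lemma IsScaleSolution.congr {ψ f g : ℝ → ℝ} (hf : IsScaleSolution h ψ q f)
    (hfg : EqOn f g (Ici 0)) : IsScaleSolution h ψ q g where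
  nonneg x hx := hfg hx ▸ hf.nonneg x hx
  rightCont x hx := (hf.rightCont x hx).congr
    (fun y hy => (hfg (le_trans hx hy)).symm) (hfg hx).symm
  piecewise := by
    refine ⟨fun R => (hf.piecewise.1 R).subset ?_, fun x hx => ?_, fun x hx => ?_⟩
    · rintro x ⟨hx, hxc⟩
      exact ⟨hx, fun hc => hxc (hc.congr (fun y hy => (hfg hy).symm) (hfg hx.1).symm)⟩
    · obtain ⟨l, hl⟩ := hf.piecewise.2.1 x hx
      refine ⟨l, hl.congr' ?_⟩
      filter_upwards [mem_nhdsWithin_of_mem_nhds (Ioi_mem_nhds hx)] with y hy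
      exact hfg (mem_Ici.2 (le_of_lt hy))
    · obtain ⟨l, hl⟩ := hf.piecewise.2.2 x hx
      refine ⟨l, hl.congr' ?_⟩
      filter_upwards [self_mem_nhdsWithin] with y hy
      exact hfg (le_trans hx (le_of_lt hy))
  expOrder := by
    obtain ⟨α, A, hα, hA, hle⟩ := hf.expOrder
    exact ⟨α, A, hα, hA, fun x hx => hfg hx ▸ hle x hx⟩
  laplace β hβ := by
    obtain ⟨h1, h2⟩ := hf.laplace β hβ
    have h3 : EqOn (fun x => Real.exp (-β * x) * f x) (fun x => Real.exp (-β * x) * g x)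
        (Ioi 0) := fun x hx => by
      simp only [hfg (Ioi_subset_Ici_self hx)]
    exact ⟨(integrableOn_congr_fun h3 measurableSet_Ioi).1 h1,
      (setIntegral_congr_fun measurableSet_Ioi h3) ▸ h2⟩

end StepFunction

/-! ### Uniqueness of scale functions -/

section Uniqueness

/-- Finite measures with the same moment generating function on a half-line containing `0` in its
interior coincide. -/
lemma measure_eq_of_mgf_eqOn_Iio {μ μ' : Measure ℝ} [IsFiniteMeasure μ] [IsFiniteMeasure μ']
    {δ : ℝ} (hδ : 0 < δ) (hi : ∀ t < δ, Integrable (fun x => Real.exp (t * x)) μ)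
    (hi' : ∀ t < δ, Integrable (fun x => Real.exp (t * x)) μ')
    (he : ∀ t < δ, ∫ x, Real.exp (t * x) ∂μ = ∫ x, Real.exp (t * x) ∂μ') : μ = μ' := by
  have hsub : ∀ ρ : Measure ℝ, (∀ t < δ, Integrable (fun x => Real.exp (t * x)) ρ) →
      AnalyticOnNhd ℂ (complexMGF id ρ) {z | z.re < δ} := fun ρ hρ => by
    refine analyticOnNhd_complexMGF.mono fun z hz => ?_
    exact interior_maximal (s := integrableExpSet id ρ) (fun t ht => hρ t ht) isOpen_Iio hz
  have hconv : Convex ℝ {z : ℂ | z.re < δ} := convex_halfSpace_re_lt δ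
  have hreal : ∀ t : ℝ, t < δ → complexMGF id μ t = complexMGF id μ' t := fun t ht => by
    rw [complexMGF_ofReal, complexMGF_ofReal]
    exact congrArg _ (he t ht)
  -- Agreement on a real segment accumulating at `0` spreads over the half-plane `Re z < δ` by the
  -- identity theorem. As `δ > 0`, this half-plane contains the imaginary axis, where the
  -- characteristic functions are read off.
  have hfreq : ∃ᶠ z : ℂ in 𝓝[≠] 0, complexMGF id μ z = complexMGF id μ' z := by
    have h1 : Tendsto (fun t : ℝ => (t : ℂ)) (𝓝[<] 0) (𝓝[≠] 0) := by
      refine tendsto_nhdsWithin_iff.2 ⟨?_, ?_⟩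
      · exact (Complex.continuous_ofReal.tendsto' 0 0 (by simp)).mono_left nhdsWithin_le_nhds
      · filter_upwards [self_mem_nhdsWithin] with t (ht : t < 0)
        simpa using ht.ne
    refine h1.frequently (Eventually.frequently ?_)
    filter_upwards [self_mem_nhdsWithin] with t (ht : t < 0)
    exact hreal t (ht.trans hδ)
  have hE := (hsub μ hi).eqOn_of_preconnected_of_frequently_eq (hsub μ' hi')
    hconv.isPreconnected (z₀ := 0) (by simpa using hδ) hfreq
  refine Measure.ext_of_charFun (funext fun t => ?_)
  rw [← complexMGF_id_mul_I, ← complexMGF_id_mul_I]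
  exact hE (by simpa using hδ)

/-- The finite measure with density `e^{-bx} f(x)` on `(0, ∞)`. -/
noncomputable def tiltedDensity (b : ℝ) (f : ℝ → ℝ) : Measure ℝ :=
  (volume.restrict (Ioi 0)).withDensity fun x => ENNReal.ofReal (Real.exp (-b * x) * f x)

lemma isFiniteMeasure_tiltedDensity {b : ℝ} {f : ℝ → ℝ}
    (hi : IntegrableOn (fun x => Real.exp (-b * x) * f x) (Ioi 0)) :
    IsFiniteMeasure (tiltedDensity b f) := by
  refine isFiniteMeasure_withDensity_ofReal ?_
  exact hi.2

/-- The moment generating function of the tilted measure at `t` is the Laplace transform of `f` at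
`b - t`. -/
lemma integral_exp_tiltedDensity {b : ℝ} {f : ℝ → ℝ} (hf : ∀ x, 0 ≤ x → 0 ≤ f x)
    (hi : IntegrableOn (fun x => Real.exp (-b * x) * f x) (Ioi 0)) {t : ℝ}
    (ht : IntegrableOn (fun x => Real.exp (-(b - t) * x) * f x) (Ioi 0)) :
    Integrable (fun x => Real.exp (t * x)) (tiltedDensity b f) ∧
      ∫ x, Real.exp (t * x) ∂(tiltedDensity b f) =
        ∫ x in Ioi (0 : ℝ), Real.exp (-(b - t) * x) * f x := by
  have hm : AEMeasurable (fun x => ENNReal.ofReal (Real.exp (-b * x) * f x))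
      (volume.restrict (Ioi 0)) := hi.aestronglyMeasurable.aemeasurable.ennreal_ofReal
  have hc : ∀ x ∈ Ioi (0 : ℝ), (ENNReal.ofReal (Real.exp (-b * x) * f x)).toReal •
      Real.exp (t * x) = Real.exp (-(b - t) * x) * f x := fun x hx => by
    rw [ENNReal.toReal_ofReal (mul_nonneg (Real.exp_pos _).le (hf x (le_of_lt hx))), smul_eq_mul,
      mul_right_comm, ← Real.exp_add]
    congr 2; ring
  unfold tiltedDensity
  constructor
  · rw [integrable_withDensity_iff_integrable_smul₀' hm (by simp)]
    exact (integrableOn_congr_fun hc measurableSet_Ioi).2 ht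
  · rw [integral_withDensity_eq_integral_toReal_smul₀ hm (by simp)]
    exact setIntegral_congr_fun measurableSet_Ioi hc

/-- Tilting by `b = Φ(q) + 1` gives finite measures whose moment generating functions are prescribed
for all `t < 1`, a half-line with `0` in its interior. Equal measures have densities equal a.e., and
right-continuity removes the exceptional set. -/
lemma IsScaleSolution.eqOn {h q : ℝ} {ψ f g : ℝ → ℝ} (hf : IsScaleSolution h ψ q f)
    (hg : IsScaleSolution h ψ q g) : EqOn f g (Ici 0) := by
  set b := largestRoot ψ q + 1 with hb
  have hlt : ∀ t < (1 : ℝ), largestRoot ψ q < b - t := fun t ht => by rw [hb]; linarith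
  have hb0 : largestRoot ψ q < b := by rw [hb]; linarith
  have hfi := (hf.laplace b hb0).1
  have hgi := (hg.laplace b hb0).1
  have := isFiniteMeasure_tiltedDensity hfi
  have := isFiniteMeasure_tiltedDensity hgi
  have hμ : tiltedDensity b f = tiltedDensity b g := by
    refine measure_eq_of_mgf_eqOn_Iio one_pos
      (fun t ht => (integral_exp_tiltedDensity hf.nonneg hfi (hf.laplace _ (hlt t ht)).1).1)
      (fun t ht => (integral_exp_tiltedDensity hg.nonneg hgi (hg.laplace _ (hlt t ht)).1).1)
      fun t ht => ?_
    rw [(integral_exp_tiltedDensity hf.nonneg hfi (hf.laplace _ (hlt t ht)).1).2,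
      (integral_exp_tiltedDensity hg.nonneg hgi (hg.laplace _ (hlt t ht)).1).2,
      (hf.laplace _ (hlt t ht)).2, (hg.laplace _ (hlt t ht)).2]
  unfold tiltedDensity at hμ
  rw [withDensity_eq_iff_of_sigmaFinite hfi.aestronglyMeasurable.aemeasurable.ennreal_ofReal
    hgi.aestronglyMeasurable.aemeasurable.ennreal_ofReal] at hμ
  have hae : ∀ᵐ x, x ∈ Ioi (0 : ℝ) → f x = g x := by
    filter_upwards [(ae_restrict_iff' measurableSet_Ioi).1 hμ] with x hx hx0
    have h1 := hx hx0
    rw [ENNReal.ofReal_eq_ofReal_iff (mul_nonneg (Real.exp_pos _).le (hf.nonneg x (le_of_lt hx0)))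
      (mul_nonneg (Real.exp_pos _).le (hg.nonneg x (le_of_lt hx0)))] at h1
    exact mul_left_cancel₀ (Real.exp_pos _).ne' h1
  intro x hx
  have hfreq : ∃ᶠ y in 𝓝[>] x, f y = g y := by
    intro hc
    obtain ⟨u, hu, huc⟩ := (mem_nhdsGT_iff_exists_Ioo_subset' (lt_add_one x)).1 hc
    have h1 : volume (Ioo x u) = 0 := by
      refine measure_mono_null (fun y hy => ?_) hae
      simp only [mem_compl_iff, mem_ofPred_eq, not_forall]
      exact ⟨lt_of_le_of_lt hx hy.1, huc hy⟩
    rw [Real.volume_Ioo, ENNReal.ofReal_eq_zero] at h1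
    have : x < u := hu
    linarith
  exact tendsto_nhds_unique_of_frequently_eq
    ((hf.rightCont x hx).mono_left (nhdsWithin_mono x Ioi_subset_Ici_self))
    ((hg.rightCont x hx).mono_left (nhdsWithin_mono x Ioi_subset_Ici_self)) hfreq

end Uniqueness

/-! ### The law of an upwards skip-free Lévy chain on path space -/

section PathLaw

lemma isClosed_latticeZ {h : ℝ} (hh : 0 < h) : IsClosed (latticeZ h) := by
  have h1 : latticeZ h = (fun x : ℝ => x / h) ⁻¹' range ((↑) : ℤ → ℝ) := by
    ext x
    simp only [latticeZ, mem_range, mem_preimage]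
    exact exists_congr fun k => by rw [eq_div_iff hh.ne']
  rw [h1]
  exact Int.isClosedEmbedding_coe_real.isClosed_range.preimage (by fun_prop)

lemma IsCadlagPath.forall_mem_of_dense {w : ℝ≥0 → ℝ} (hw : IsCadlagPath w) {S : Set ℝ}
    (hS : IsClosed S) {D : Set ℝ≥0} (hD : Dense D) (hwD : ∀ d ∈ D, w d ∈ S) (t : ℝ≥0) :
    w t ∈ S := by
  by_contra hc
  have h1 : ∀ᶠ s in 𝓝[≥] t, w s ∈ Sᶜ := (hw t).1.eventually (hS.isOpen_compl.mem_nhds hc)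
  obtain ⟨u, hu, hus⟩ := (mem_nhdsGE_iff_exists_Ico_subset' (show t < t + 1 by simp)).1 h1
  obtain ⟨d, hd, h2, h3⟩ := hD.exists_between hu
  exact hus ⟨h2.le, h3⟩ (hwD d hd)

variable {Ω : Type*} [mΩ : MeasurableSpace Ω] {P : Measure Ω} {𝔽 : Filtration ℝ≥0 mΩ}
  {X : ℝ≥0 → Ω → ℝ} {h : ℝ} {ν : Measure ℝ}

namespace IsUpwardsSkipFreeLevyChain

/-- A measure on the line is carried by its support, which leaves only lattice points, and among the
positive ones only `h`. If `h` were not charged, `ν` would vanish on `(0, ∞)` and the support there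
would be empty. -/
lemma isSkipFreeMeasure (hX : IsUpwardsSkipFreeLevyChain P 𝔽 X h ν) : IsSkipFreeMeasure h ν := by
  have := hX.finite
  have hh := hX.h_pos
  have h1 : ∀ᵐ x ∂ν, x ∈ latticeZ h := by
    filter_upwards [Measure.support_mem_ae (μ := ν)] with x hx using hX.support_subset hx
  have h2 : ∀ᵐ x ∂ν, x ∈ Ioi (0 : ℝ) → x = h := by
    have := Measure.support_mem_ae (μ := ν.restrict (Ioi 0))
    rw [hX.support_pos] at this
    exact (ae_restrict_iff' measurableSet_Ioi).1 this
  refine ⟨hX.finite, hX.no_atom_zero, ?_, ?_⟩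
  · filter_upwards [h1, h2] with x ⟨k, hk⟩ hx
    rcases lt_or_ge 1 k with hk1 | hk1
    · have hk1' : (1 : ℝ) < k := by exact_mod_cast hk1
      have h3 : h < x := by rw [← hk]; nlinarith
      exact absurd (hx (hh.trans h3)) h3.ne'
    · exact ⟨k, hk1, hk.symm⟩
  · refine ENNReal.toReal_pos (fun h0 => ?_) (measure_ne_top _ _)
    have h3 : ν.restrict (Ioi 0) = 0 := by
      rw [Measure.restrict_eq_zero]
      have h4 : ∀ᵐ x ∂ν, x ≠ h := by simpa [ae_iff] using h0
      have h5 : ∀ᵐ x ∂ν, x ∉ Ioi (0 : ℝ) := by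
        filter_upwards [h2, h4] with x hx hx' hc using hx' (hx hc)
      rw [ae_iff] at h5
      simpa only [not_not, ofPred_mem_eq] using h5
    have h6 := hX.support_pos
    rw [h3, Measure.support_zero] at h6
    exact (singleton_ne_empty h) h6.symm

lemma measurable (hX : IsUpwardsSkipFreeLevyChain P 𝔽 X h ν) (t : ℝ≥0) : Measurable (X t) :=
  (hX.adapted t).mono (𝔽.le t) le_rfl

lemma map_eq (hX : IsUpwardsSkipFreeLevyChain P 𝔽 X h ν) [IsProbabilityMeasure P] (t : ℝ≥0) :
    P.map (X t) = compoundPoissonLaw ν t := by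
  have := hX.finite
  have := Measure.isProbabilityMeasure_map (μ := P) (hX.measurable t).aemeasurable
  exact Measure.ext_of_charFun (funext fun p => by
    rw [hX.compoundPoisson, charFun_compoundPoissonLaw])

lemma exists_measurableSet_forall_mem (hX : IsUpwardsSkipFreeLevyChain P 𝔽 X h ν) :
    MeasurableSet {ω | ∀ t, X t ω ∈ latticeZ h} := by
  obtain ⟨D, hDc, hD⟩ := TopologicalSpace.exists_countable_dense ℝ≥0
  have : {ω | ∀ t, X t ω ∈ latticeZ h} = ⋂ d ∈ D, X d ⁻¹' latticeZ h := by
    ext ω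
    simp only [mem_ofPred_eq, mem_iInter, mem_preimage]
    exact ⟨fun hω d _ => hω d,
      fun hω => (hX.cadlag ω).forall_mem_of_dense (isClosed_latticeZ hX.h_pos) hD hω⟩
  rw [this]
  exact MeasurableSet.biInter hDc fun d _ =>
    hX.measurable d (isClosed_latticeZ hX.h_pos).measurableSet

/-- Almost surely this holds at countably many dense times; right-continuity and closedness of the
lattice extend it to all times. -/
lemma ae_forall_mem (hX : IsUpwardsSkipFreeLevyChain P 𝔽 X h ν) [IsProbabilityMeasure P] :
    ∀ᵐ ω ∂P, ∀ t, X t ω ∈ latticeZ h := by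
  have := hX.finite
  obtain ⟨D, hDc, hD⟩ := TopologicalSpace.exists_countable_dense ℝ≥0
  have h1 : ∀ᵐ ω ∂P, ∀ d ∈ D, X d ω ∈ latticeZ h := by
    rw [ae_ball_iff hDc]
    intro d _
    have h2 := compoundPoissonLaw_mem_latticeZ (h := h)
      (hX.isSkipFreeMeasure.lattice.mono fun x ⟨k, _, hk⟩ => ⟨k, hk.symm⟩) d
    rw [← hX.map_eq d] at h2
    exact ae_of_ae_map (hX.measurable d).aemeasurable h2
  filter_upwards [h1] with ω hω
  exact (hX.cadlag ω).forall_mem_of_dense (isClosed_latticeZ hX.h_pos) hD hω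

lemma coord_samplePath (hX : IsUpwardsSkipFreeLevyChain P 𝔽 X h ν) {ω : Ω}
    (hω : ∀ t, X t ω ∈ latticeZ h) (t : ℝ≥0) : coord h t (samplePath h X ω) = X t ω := by
  unfold samplePath
  rw [dif_pos ⟨hX.cadlag ω, hω⟩]
  rfl

lemma measurable_samplePath (hX : IsUpwardsSkipFreeLevyChain P 𝔽 X h ν) :
    Measurable (samplePath h X) := by
  classical
  refine measurable_pathSpace_iff.2 fun t => ?_
  have h1 : (fun ω => coord h t (samplePath h X ω)) =
      fun ω => if ∀ t, X t ω ∈ latticeZ h then X t ω else 0 := by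
    ext ω
    split_ifs with hω
    · exact hX.coord_samplePath hω t
    · unfold samplePath
      rw [dif_neg fun hc => hω hc.2]
      rfl
  rw [h1]
  exact Measurable.ite hX.exists_measurableSet_forall_mem (hX.measurable t) measurable_const

/-- `samplePath` is modified on a null event that depends on the whole path and need not lie in `𝔽
s`. Preimages of events up to time `s` therefore agree with events of `𝔽 s` only almost surely,
which is enough for independence. -/
lemma exists_ae_eq_samplePath_preimage (hX : IsUpwardsSkipFreeLevyChain P 𝔽 X h ν)
    [IsProbabilityMeasure P] {s : ℝ≥0} {A : Set (PathSpace h)}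
    (hA : MeasurableSet[coordSigma h s] A) :
    ∃ A' : Set Ω, MeasurableSet[𝔽 s] A' ∧ ∀ᵐ ω ∂P, samplePath h X ω ∈ A ↔ ω ∈ A' := by
  have hA' : MeasurableSet[MeasurableSpace.generateFrom
      {S | ∃ L : Finset (ℝ≥0 × ℝ), (∀ p ∈ L, p.1 ∈ Iic s) ∧ pathCylinder h L = S}] A := by
    rw [← coordinates_eq_generateFrom_pathCylinder]; exact hA
  clear hA
  induction A, hA' using MeasurableSpace.generateFrom_induction with
  | hC S hS _ =>
    obtain ⟨L, hL, rfl⟩ := hS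
    refine ⟨⋂ p ∈ L, X p.1 ⁻¹' {p.2}, Finset.measurableSet_biInter _ fun p hp => ?_, ?_⟩
    · exact 𝔽.mono (hL p hp) _ (hX.adapted p.1 (measurableSet_singleton _))
    · filter_upwards [hX.ae_forall_mem] with ω hω
      simp [pathCylinder, hX.coord_samplePath hω]
  | empty => exact ⟨∅, @MeasurableSet.empty _ (𝔽 s), by simp⟩
  | compl S _ ih =>
    obtain ⟨A', h1, h2⟩ := ih
    exact ⟨A'ᶜ, h1.compl, h2.mono fun ω hω => not_congr hω⟩
  | iUnion f _ ih =>
    choose A' h1 h2 using ih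
    refine ⟨⋃ n, A' n, MeasurableSet.iUnion h1, ?_⟩
    filter_upwards [ae_all_iff.2 h2] with ω hω
    simp only [mem_iUnion]
    exact exists_congr hω

lemma isLatticeLevy (hX : IsUpwardsSkipFreeLevyChain P 𝔽 X h ν) [IsProbabilityMeasure P] :
    IsLatticeLevy (pathLaw P h X) where
  prob := Measure.isProbabilityMeasure_map hX.measurable_samplePath.aemeasurable
  incr s t A hA x := by
    have hm := hX.measurable_samplePath
    have hAm := coordSigma_le h s _ hA
    have hI : MeasurableSet {w : PathSpace h | coord h (s + t) w - coord h s w = x} :=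
      ((measurable_coord h _).sub (measurable_coord h _)) (measurableSet_singleton x)
    have hT : MeasurableSet {w : PathSpace h | coord h t w = x} :=
      measurable_coord h _ (measurableSet_singleton x)
    obtain ⟨A', hA', hAA⟩ := hX.exists_ae_eq_samplePath_preimage hA
    unfold pathLaw
    rw [Measure.map_apply hm (hAm.inter hI), Measure.map_apply hm hAm, Measure.map_apply hm hT]
    have e1 : P (samplePath h X ⁻¹' (A ∩ {w | coord h (s + t) w - coord h s w = x})) =
        P (A' ∩ (fun ω => X (s + t) ω - X s ω) ⁻¹' {x}) := by
      refine measure_congr ?_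
      filter_upwards [hAA, hX.ae_forall_mem] with ω h1 h2
      refine propext (and_congr h1 ?_)
      change coord h (s + t) (samplePath h X ω) - coord h s (samplePath h X ω) = x ↔
        X (s + t) ω - X s ω = x
      rw [hX.coord_samplePath h2, hX.coord_samplePath h2]
    have e2 : P (samplePath h X ⁻¹' A) = P A' := by
      refine measure_congr ?_
      filter_upwards [hAA] with ω h1 using propext h1
    have e3 : P (samplePath h X ⁻¹' {w | coord h t w = x}) = P (X t ⁻¹' {x}) := by
      refine measure_congr ?_
      filter_upwards [hX.ae_forall_mem] with ω h2
      refine propext ?_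
      change coord h t (samplePath h X ω) = x ↔ X t ω = x
      rw [hX.coord_samplePath h2]
    have h3 := (Indep_iff _ _ P).1 (hX.indep s t) _ A' ⟨{x}, measurableSet_singleton x, rfl⟩ hA'
    rw [e1, e2, e3, inter_comm, h3, mul_comm,
      (hX.stationary s t).measure_mem_eq (measurableSet_singleton x)]

lemma map_coord_pathLaw (hX : IsUpwardsSkipFreeLevyChain P 𝔽 X h ν) [IsProbabilityMeasure P]
    (t : ℝ≥0) : (pathLaw P h X).map (coord h t) = compoundPoissonLaw ν t := by
  unfold pathLaw
  rw [Measure.map_map (measurable_coord h t) hX.measurable_samplePath, ← hX.map_eq t]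
  refine Measure.map_congr ?_
  filter_upwards [hX.ae_forall_mem] with ω hω using hX.coord_samplePath hω t

end IsUpwardsSkipFreeLevyChain

lemma hasGenerator_of_map_coord {h : ℝ} {ν : Measure ℝ} [IsFiniteMeasure ν]
    {μ : Measure (PathSpace h)} (hμ : ∀ t, μ.map (coord h t) = compoundPoissonLaw ν t) :
    HasGenerator μ ν := by
  intro f hf hf1
  have h1 := tendsto_compoundPoissonLaw_generator (ν := ν) (c := 0) (by simp) hf
    fun x => by simpa using hf1 x
  refine h1.congr fun t => ?_
  rw [← hμ t, integral_map (measurable_coord h t).aemeasurable hf.aestronglyMeasurable]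

lemma firstEntrance_congr {Ω : Type*} {X : ℝ≥0 → Ω → ℝ} {h : ℝ} {ω : Ω} {w : PathSpace h}
    (hw : ∀ t, coord h t w = X t ω) (y : ℝ) :
    firstEntrance X y ω = firstEntrance (coord h) y w := by
  unfold firstEntrance hittingAfter
  by_cases hex : ∃ j, (0 : ℝ≥0) ≤ j ∧ X j ω ∈ Ici y
  · rw [if_pos hex, if_pos (by simpa only [hw] using hex)]
    simp only [hw]
  · rw [if_neg hex, if_neg (by simpa only [hw] using hex)]

lemma coe_le_runningInf_iff {Ω : Type*} {X : ℝ≥0 → Ω → ℝ} {ω : Ω} {τ : WithTop ℝ≥0} {x : ℝ} :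
    (x : EReal) ≤ runningInf X τ ω ↔ ∀ s : ℝ≥0, (s : WithTop ℝ≥0) ≤ τ → x ≤ X s ω := by
  simp only [runningInf, le_iInf_iff, EReal.coe_le_coe_iff]

lemma IsUpwardsSkipFreeLevyChain.integral_indicator_eq {Ω : Type*} [mΩ : MeasurableSpace Ω]
    {P : Measure Ω} {𝔽 : Filtration ℝ≥0 mΩ} {X : ℝ≥0 → Ω → ℝ} {h : ℝ} {ν : Measure ℝ}
    (hX : IsUpwardsSkipFreeLevyChain P 𝔽 X h ν) [IsProbabilityMeasure P] {q x y : ℝ}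
    (hq : 0 ≤ q) (hxy : -x ≤ y) :
    ∫ ω, {ω | ((-x : ℝ) : EReal) ≤ runningInf X (firstEntrance X y ω) ω}.indicator
      (fun ω => discount q (firstEntrance X y ω)) ω ∂P =
      ∫ w, passage h q x y w ∂(pathLaw P h X) := by
  unfold pathLaw
  rw [integral_map hX.measurable_samplePath.aemeasurable
    (measurable_passage hX.h_pos hq hxy).aestronglyMeasurable]
  refine integral_congr_ae ?_
  filter_upwards [hX.ae_forall_mem] with ω hω
  have hc := hX.coord_samplePath hω
  have hiff : ω ∈ {ω | ((-x : ℝ) : EReal) ≤ runningInf X (firstEntrance X y ω) ω} ↔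
      ∀ s : ℝ≥0, (s : WithTop ℝ≥0) ≤ firstEntrance (coord h) y (samplePath h X ω) →
        -x ≤ coord h s (samplePath h X ω) := by
    rw [mem_ofPred_eq, coe_le_runningInf_iff, firstEntrance_congr hc]
    simp only [hc]
  unfold passage
  by_cases hω' : ω ∈ {ω | ((-x : ℝ) : EReal) ≤ runningInf X (firstEntrance X y ω) ω}
  · rw [indicator_of_mem hω', if_pos (hiff.1 hω'), firstEntrance_congr hc]
  · rw [indicator_of_notMem hω', if_neg fun h1 => hω' (hiff.2 h1)]

lemma passage_floor {h : ℝ} (hh : 0 < h) (q : ℝ) {x : ℝ} (hx : 0 ≤ x) (y : ℝ) :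
    passage h q x y = passage h q (⌊x / h⌋₊ * h) y := by
  have key : ∀ (w : PathSpace h) (s : ℝ≥0), -x ≤ coord h s w ↔
      -(⌊x / h⌋₊ * h) ≤ coord h s w := fun w s => by
    have h1 := mem_Ico_floor_div hh hx
    constructor
    · intro h2
      obtain ⟨k, hk⟩ := w.2.2 s
      replace hk : (k : ℝ) * h = coord h s w := hk
      rw [← hk] at h2 ⊢
      have h3 : (-(⌊x / h⌋₊ + 1) : ℝ) * h < k * h := by linarith [h1.2]
      have h4 : (-(⌊x / h⌋₊ + 1) : ℝ) < k := lt_of_mul_lt_mul_right h3 hh.le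
      have h5 : (-(⌊x / h⌋₊ + 1) : ℤ) < k := by exact_mod_cast h4
      have h6 : (-(⌊x / h⌋₊ : ℤ)) ≤ k := by omega
      have h7 : (-(⌊x / h⌋₊ : ℝ)) ≤ k := by exact_mod_cast h6
      rw [← neg_mul]
      exact mul_le_mul_of_nonneg_right h7 hh.le
    · intro h2
      linarith [h1.1]
  ext w
  have hiff := forall₂_congr fun (s : ℝ≥0)
    (_ : (s : WithTop ℝ≥0) ≤ firstEntrance (coord h) y w) => key w s
  unfold passage
  by_cases hc : ∀ s : ℝ≥0, (s : WithTop ℝ≥0) ≤ firstEntrance (coord h) y w → -x ≤ coord h s w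
  · rw [if_pos hc, if_pos (hiff.1 hc)]
  · rw [if_neg hc, if_neg fun h1 => hc (hiff.2 h1)]

end PathLaw

/-! ### Existence of the exponential change of measure -/

section Esscher

variable {h : ℝ}

/-- The path stopped at time `1`. -/
def PathSpace.block (w : PathSpace h) : PathSpace h :=
  ⟨fun u => w.1 (min u 1), by
    refine ⟨fun t => ⟨?_, ?_⟩, fun t => w.2.2 _⟩
    · exact (w.2.1 (min t 1)).1.comp (f := fun u : ℝ≥0 => min u 1)
        (by fun_prop) fun _ (hu : t ≤ _) => min_le_min_right 1 hu
    · rcases le_or_gt t 1 with ht | ht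
      · obtain ⟨l, hl⟩ := (w.2.1 t).2
        refine ⟨l, hl.congr' ?_⟩
        filter_upwards [self_mem_nhdsWithin] with u (hu : u < t)
        rw [min_eq_left (hu.le.trans ht)]
      · refine ⟨w.1 1, tendsto_const_nhds.congr' ?_⟩
        filter_upwards [mem_nhdsWithin_of_mem_nhds (Ioi_mem_nhds ht)] with u (hu : 1 < u)
        rw [min_eq_right hu.le]⟩

lemma PathSpace.coord_block (t : ℝ≥0) (w : PathSpace h) :
    coord h t w.block = coord h (min t 1) w := rfl

lemma PathSpace.measurable_block : Measurable (PathSpace.block : PathSpace h → PathSpace h) :=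
  measurable_pathSpace_iff.2 fun _ => measurable_coord h _

/-- The sum of the first `n` unit-time displacements of a sequence of paths. -/
def blockSum (v : ℕ → PathSpace h) (n : ℕ) : ℝ :=
  ∑ i ∈ Finset.range n, (coord h 1 (v i) - coord h 0 (v i))

lemma blockSum_mem_latticeZ (v : ℕ → PathSpace h) (n : ℕ) : blockSum v n ∈ latticeZ h := by
  unfold blockSum
  induction n with
  | zero => exact ⟨0, by simp⟩
  | succ n ih =>
    rw [Finset.sum_range_succ]
    exact latticeZ_add_mem ih (latticeZ_sub_mem ((v n).2.2 1) ((v n).2.2 0))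

/-- The value at time `t` of the concatenation of the unit-time pieces of a sequence of paths. -/
noncomputable def concatValue (v : ℕ → PathSpace h) (t : ℝ≥0) : ℝ :=
  blockSum v ⌊t⌋₊ + (coord h (t - ⌊t⌋₊) (v ⌊t⌋₊) - coord h 0 (v ⌊t⌋₊))

lemma concatValue_eq {v : ℕ → PathSpace h} {n : ℕ} {t : ℝ≥0} (h1 : (n : ℝ≥0) ≤ t)
    (h2 : t < n + 1) :
    concatValue v t = blockSum v n + (coord h (t - n) (v n) - coord h 0 (v n)) := by
  have : ⌊t⌋₊ = n := (Nat.floor_eq_iff zero_le).2 ⟨h1, h2⟩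
  rw [concatValue, this]

lemma isCadlagPath_concatValue (v : ℕ → PathSpace h) : IsCadlagPath (concatValue v) := by
  intro t
  constructor
  · have h1 := Nat.floor_le (zero_le (a := t))
    have h2 := Nat.lt_floor_add_one t
    set n := ⌊t⌋₊
    have hc : ContinuousWithinAt (fun s : ℝ≥0 => (v n).1 (s - n)) (Ici t) t :=
      ((v n).2.1 (t - n)).1.comp (f := fun s : ℝ≥0 => s - n)
        (by fun_prop) fun _ (hu : t ≤ _) => tsub_le_tsub_right hu _
    have hc' : ContinuousWithinAt (fun s : ℝ≥0 => blockSum v n +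
        (coord h (s - n) (v n) - coord h 0 (v n))) (Ici t) t :=
      continuousWithinAt_const.add (hc.sub continuousWithinAt_const)
    refine hc'.congr_of_eventuallyEq ?_ (concatValue_eq h1 h2)
    filter_upwards [Ico_mem_nhdsGE h2] with s hs
    exact concatValue_eq (h1.trans hs.1) hs.2
  · rcases (zero_le (a := t)).eq_or_lt with rfl | ht
    · refine ⟨0, ?_⟩
      have : Iio (0 : ℝ≥0) = ∅ := by ext; simp
      rw [this, nhdsWithin_empty]
      exact tendsto_bot
    · obtain ⟨m, hm⟩ : ∃ m : ℕ, ⌈t⌉₊ = m + 1 :=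
        Nat.exists_eq_succ_of_ne_zero (Nat.ceil_pos.2 ht).ne'
      have h1 : (m : ℝ≥0) < t := Nat.lt_ceil.1 (by omega)
      have h2 : t ≤ m + 1 := by exact_mod_cast Nat.ceil_le.1 hm.le
      obtain ⟨l, hl⟩ := ((v m).2.1 (t - m)).2
      have hl' : Tendsto (fun s : ℝ≥0 => (v m).1 (s - m)) (𝓝[<] t) (𝓝 l) := by
        refine hl.comp (tendsto_nhdsWithin_iff.2 ⟨?_, ?_⟩)
        · exact ((by fun_prop : Continuous fun s : ℝ≥0 => s - m).tendsto t).mono_left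
            nhdsWithin_le_nhds
        · filter_upwards [Ico_mem_nhdsLT h1] with s hs
          exact tsub_lt_tsub_right_of_le hs.1 hs.2
      refine ⟨blockSum v m + (l - coord h 0 (v m)),
        ((hl'.sub_const (coord h 0 (v m))).const_add (blockSum v m)).congr' ?_⟩
      filter_upwards [Ico_mem_nhdsLT h1] with s hs
      exact (concatValue_eq hs.1 (hs.2.trans_le h2)).symm

/-- The concatenation of the unit-time pieces of a sequence of paths. -/
noncomputable def concat (v : ℕ → PathSpace h) : PathSpace h :=
  ⟨concatValue v, isCadlagPath_concatValue v, fun _ =>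
    latticeZ_add_mem (blockSum_mem_latticeZ v _) (latticeZ_sub_mem ((v _).2.2 _) ((v _).2.2 _))⟩

lemma coord_concat (v : ℕ → PathSpace h) (t : ℝ≥0) : coord h t (concat v) = concatValue v t := rfl

lemma measurable_concat : Measurable (concat : (ℕ → PathSpace h) → PathSpace h) := by
  refine measurable_pathSpace_iff.2 fun t => ?_
  simp only [coord_concat, concatValue, blockSum]
  have h1 : ∀ (s : ℝ≥0) (i : ℕ), Measurable fun v : ℕ → PathSpace h => coord h s (v i) :=
    fun s i => (measurable_coord h s).comp (measurable_pi_apply i)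
  exact (Finset.measurable_sum _ fun i _ => (h1 1 i).sub (h1 0 i)).add ((h1 _ _).sub (h1 0 _))

/-- Up to time `n`, the concatenation only depends on the first `n` pieces. -/
lemma coord_concat_congr {n : ℕ} {v v' : ℕ → PathSpace h} (hv : ∀ i < n, v i = v' i) {t : ℝ≥0}
    (ht : t ≤ n) : coord h t (concat v) = coord h t (concat v') := by
  have hsum : ∀ m ≤ n, blockSum v m = blockSum v' m := fun m hm =>
    Finset.sum_congr rfl fun i hi => by rw [hv i ((Finset.mem_range.1 hi).trans_le hm)]
  have hle : ⌊t⌋₊ ≤ n := Nat.floor_le_of_le ht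
  simp only [coord_concat, concatValue, hsum _ hle]
  rcases hle.eq_or_lt with h1 | h1
  · have h2 : t = n := le_antisymm ht (by rw [← h1]; exact Nat.floor_le zero_le)
    rw [h1, h2, tsub_self]; simp
  · rw [hv _ h1]

/-- A path started at `0` is the concatenation of its unit-time blocks. -/
lemma coord_concat_block {w : PathSpace h} (hw : coord h 0 w = 0) (t : ℝ≥0) :
    coord h t (concat fun i : ℕ => (w.shift i).block) = coord h t w := by
  have hsum : ∀ n : ℕ, blockSum (fun i : ℕ => (w.shift i).block) n = coord h n w := fun n => by
    induction n with
    | zero => simp [blockSum, hw]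
    | succ n ih =>
      have e : blockSum (fun i : ℕ => (w.shift i).block) (n + 1) =
          blockSum (fun i : ℕ => (w.shift i).block) n +
          (coord h 1 (w.shift n).block - coord h 0 (w.shift n).block) := by
        rw [blockSum, Finset.sum_range_succ]; rfl
      rw [e, ih]
      simp [PathSpace.coord_block, PathSpace.coord_shift]
  have h1 := Nat.floor_le (zero_le (a := t))
  have h2 := Nat.lt_floor_add_one t
  have h3 : t - ⌊t⌋₊ ≤ 1 := by
    rw [tsub_le_iff_left]; exact h2.le
  rw [coord_concat, concatValue, hsum]
  simp only [PathSpace.coord_block, PathSpace.coord_shift, min_eq_left h3, zero_le,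
    inf_of_le_left, add_zero, add_tsub_cancel_of_le h1]
  ring

/-- The density process of the exponential change of measure. -/
noncomputable def esscherDensity (h a c : ℝ) (t : ℝ≥0) (w : PathSpace h) : ℝ≥0∞ :=
  ENNReal.ofReal (Real.exp (c * coord h t w - a * t))

lemma measurable_esscherDensity (a c : ℝ) (t : ℝ≥0) :
    Measurable[coordSigma h t] (esscherDensity h a c t) :=
  ((Real.measurable_exp.comp (((measurable_coord_coordSigma le_rfl).const_mul c).sub_const
    _)).ennreal_ofReal)

lemma esscherDensity_add (a c : ℝ) (s t : ℝ≥0) (w : PathSpace h) :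
    esscherDensity h a c (s + t) w = esscherDensity h a c s w * esscherDensity h a c t (w.shift s) := by
  unfold esscherDensity
  rw [← ENNReal.ofReal_mul (Real.exp_pos _).le, ← Real.exp_add, PathSpace.coord_shift]
  congr 2; push_cast; ring

variable {μ : Measure (PathSpace h)} {a c : ℝ}

/-- The multiplicative form of the Markov property under the exponential change of measure. -/
lemma IsLatticeLevy.setLIntegral_esscherDensity_add (hμ : IsLatticeLevy μ) (s t : ℝ≥0)
    {A B : Set (PathSpace h)} (hA : MeasurableSet[coordSigma h s] A) (hB : MeasurableSet B) :
    ∫⁻ w in A ∩ PathSpace.shift s ⁻¹' B, esscherDensity h a c (s + t) w ∂μ =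
      (∫⁻ w in A, esscherDensity h a c s w ∂μ) * ∫⁻ w in B, esscherDensity h a c t w ∂μ := by
  have hA' := coordSigma_le h s _ hA
  have h1 := hμ.lintegral_mul_shift s (F := A.indicator (esscherDensity h a c s))
    (G := B.indicator (esscherDensity h a c t))
    ((measurable_esscherDensity a c s).indicator hA)
    (((measurable_esscherDensity a c t).mono (coordSigma_le h t) le_rfl).indicator hB)
  rw [lintegral_indicator hA', lintegral_indicator hB] at h1
  rw [← h1, ← lintegral_indicator (hA'.inter (PathSpace.measurable_shift s hB))]
  refine lintegral_congr fun w => ?_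
  by_cases hwA : w ∈ A
  · by_cases hwB : w.shift s ∈ B
    · have hw : w ∈ A ∩ PathSpace.shift s ⁻¹' B := ⟨hwA, hwB⟩
      rw [indicator_of_mem hw, indicator_of_mem hwA, indicator_of_mem hwB, esscherDensity_add]
    · have hw : w ∉ A ∩ PathSpace.shift s ⁻¹' B := fun hc => hwB hc.2
      rw [indicator_of_notMem hw, indicator_of_notMem hwB, mul_zero]
  · have hw : w ∉ A ∩ PathSpace.shift s ⁻¹' B := fun hc => hwA hc.1
    rw [indicator_of_notMem hw, indicator_of_notMem hwA, zero_mul]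

/-- The law of a unit-time block under the exponential change of measure. -/
noncomputable def blockLaw (μ : Measure (PathSpace h)) (a c : ℝ) : Measure (PathSpace h) :=
  (μ.withDensity (esscherDensity h a c 1)).map PathSpace.block

lemma isProbabilityMeasure_blockLaw (hone : ∫⁻ w, esscherDensity h a c 1 w ∂μ = 1) :
    IsProbabilityMeasure (blockLaw μ a c) := by
  have : IsProbabilityMeasure (μ.withDensity (esscherDensity h a c 1)) := by
    constructor
    rw [withDensity_apply _ MeasurableSet.univ, setLIntegral_univ, hone]
  exact Measure.isProbabilityMeasure_map PathSpace.measurable_block.aemeasurable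

lemma measurable_block_shift {i n : ℕ} (hin : i < n) :
    Measurable[coordSigma h n] fun w : PathSpace h => (w.shift i).block := by
  refine (@measurable_pathSpace_iff h _ (coordSigma h n) _).2 fun t => ?_
  have h1 : ((i : ℝ≥0) + min t 1) ≤ n := by
    have : ((i + 1 : ℕ) : ℝ≥0) ≤ n := by exact_mod_cast hin
    push_cast at this
    exact (add_le_add_right (min_le_right t 1) _).trans this
  exact (measurable_coord_coordSigma h1).sub (measurable_coord_coordSigma (le_self_add.trans h1))

/-- The density up to `n + 1` is the density up to `n` times that of the next block, so under the
tilt the unit blocks are independent and identically distributed. -/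
lemma IsLatticeLevy.setLIntegral_blocks (hμ : IsLatticeLevy μ)
    (hone : ∀ t, ∫⁻ w, esscherDensity h a c t w ∂μ = 1) {B : ℕ → Set (PathSpace h)}
    (hB : ∀ i, MeasurableSet (B i)) (n : ℕ) :
    ∫⁻ w in {w | ∀ i < n, (w.shift i).block ∈ B i}, esscherDensity h a c n w ∂μ =
      ∏ i ∈ Finset.range n, blockLaw μ a c (B i) := by
  induction n with
  | zero => simpa using hone 0
  | succ n ih =>
    have hA : MeasurableSet[coordSigma h n] {w : PathSpace h | ∀ i < n, (w.shift i).block ∈ B i} := by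
      have e : {w : PathSpace h | ∀ i < n, (w.shift i).block ∈ B i} =
          ⋂ i ∈ Finset.range n, (fun w : PathSpace h => (w.shift i).block) ⁻¹' B i := by
        ext w; simp
      rw [e]
      exact Finset.measurableSet_biInter _ fun i hi =>
        measurable_block_shift (Finset.mem_range.1 hi) (hB i)
    have e : {w : PathSpace h | ∀ i < n + 1, (w.shift i).block ∈ B i} =
        {w | ∀ i < n, (w.shift i).block ∈ B i} ∩
          PathSpace.shift n ⁻¹' (PathSpace.block ⁻¹' B n) := by
      ext w
      simp only [mem_ofPred_eq, mem_inter_iff, mem_preimage, Nat.lt_succ_iff_lt_or_eq, or_imp,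
        forall_and, forall_eq]
    have hBn := PathSpace.measurable_block (hB n)
    rw [e, Nat.cast_succ, hμ.setLIntegral_esscherDensity_add n 1 hA hBn, ih,
      Finset.prod_range_succ, blockLaw, Measure.map_apply PathSpace.measurable_block (hB n),
      withDensity_apply _ hBn]

lemma IsLatticeLevy.map_blocks (hμ : IsLatticeLevy μ)
    (hone : ∀ t, ∫⁻ w, esscherDensity h a c t w ∂μ = 1) (n : ℕ) :
    (μ.withDensity (esscherDensity h a c n)).map
        (fun w (i : Finset.range n) => (w.shift (i : ℕ)).block) =
      Measure.pi fun _ : Finset.range n => blockLaw μ a c := by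
  have := isProbabilityMeasure_blockLaw (hone 1)
  have hm : Measurable fun (w : PathSpace h) (i : Finset.range n) => (w.shift (i : ℕ)).block :=
    measurable_pi_lambda _ fun i => PathSpace.measurable_block.comp (PathSpace.measurable_shift _)
  refine (Measure.pi_eq fun B hB => ?_).symm
  have hp := MeasurableSet.univ_pi hB
  set B' : ℕ → Set (PathSpace h) := fun i => if hi : i ∈ Finset.range n then B ⟨i, hi⟩ else univ
    with hB'
  have hB'm : ∀ i, MeasurableSet (B' i) := fun i => by
    simp only [hB']; split_ifs
    exacts [hB _, .univ]
  have hBB : ∀ i : Finset.range n, B' i = B i := fun i => by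
    simp only [hB']; rw [dif_pos i.2]
  rw [Measure.map_apply hm hp, withDensity_apply _ (hm hp)]
  have e : (fun (w : PathSpace h) (i : Finset.range n) => (w.shift (i : ℕ)).block) ⁻¹' univ.pi B =
      {w | ∀ i < n, (w.shift i).block ∈ B' i} := by
    ext w
    simp only [mem_preimage, mem_univ_pi, mem_ofPred_eq]
    constructor
    · intro hw i hi
      have := hw ⟨i, Finset.mem_range.2 hi⟩
      rwa [← hBB] at this
    · intro hw i
      rw [← hBB]
      exact hw i (Finset.mem_range.1 i.2)
  rw [e, hμ.setLIntegral_blocks hone hB'm, ← Finset.prod_coe_sort]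
  exact Finset.prod_congr rfl fun i _ => by rw [hBB]

/-- The law of the concatenation of independent tilted blocks. -/
noncomputable def tiltedPathLaw (μ : Measure (PathSpace h)) (a c : ℝ) : Measure (PathSpace h) :=
  (Measure.infinitePi fun _ : ℕ => blockLaw μ a c).map concat

/-- An event up to time `n` sees only the first `n` blocks, and these have the same joint law in the
infinite product and under the density at time `n`. Infinite products exist over arbitrary
probability spaces, so no topology on path space is involved. -/
lemma IsLatticeLevy.tiltedPathLaw_apply_natCast (hμ : IsLatticeLevy μ)
    (hone : ∀ t, ∫⁻ w, esscherDensity h a c t w ∂μ = 1) (n : ℕ) {A : Set (PathSpace h)}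
    (hA : MeasurableSet[coordSigma h n] A) :
    tiltedPathLaw μ a c A = ∫⁻ w in A, esscherDensity h a c n w ∂μ := by
  have := isProbabilityMeasure_blockLaw (hone 1)
  have hA' := coordSigma_le h n _ hA
  have hm : Measurable fun (w : PathSpace h) (i : Finset.range n) => (w.shift (i : ℕ)).block :=
    measurable_pi_lambda _ fun i => PathSpace.measurable_block.comp (PathSpace.measurable_shift _)
  -- Padding with zero paths: what follows time `n` does not affect the event.
  let ext : (Finset.range n → PathSpace h) → ℕ → PathSpace h :=
    fun v i => if hi : i ∈ Finset.range n then v ⟨i, hi⟩ else zeroPath h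
  have hext : Measurable ext := measurable_pi_lambda _ fun i => by
    by_cases hi : i ∈ Finset.range n
    · simp only [ext, dif_pos hi]; exact measurable_pi_apply _
    · simp only [ext, dif_neg hi]; exact measurable_const
  have hE : MeasurableSet ((fun v => concat (ext v)) ⁻¹' A) := (measurable_concat.comp hext) hA'
  have hresE : concat ⁻¹' A =
      (Finset.range n).restrict ⁻¹' ((fun v => concat (ext v)) ⁻¹' A) := by
    ext v
    refine mem_iff_of_coordSigma hA fun s hs => coord_concat_congr (n := n) (fun i hi => ?_) hs
    simp [ext, hi]
  rw [tiltedPathLaw, Measure.map_apply measurable_concat hA', hresE,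
    ← Measure.map_apply (Finset.measurable_restrict _) hE, Measure.infinitePi_map_restrict,
    ← hμ.map_blocks hone n, Measure.map_apply hm hE, withDensity_apply _ (hm hE)]
  -- Paths started at `0`, hence almost all paths, are the concatenation of their own blocks.
  refine setLIntegral_congr ?_
  filter_upwards [hμ.ae_coord_zero] with w hw
  refine propext (mem_iff_of_coordSigma hA fun s hs => ?_)
  rw [← coord_concat_block hw s]
  refine coord_concat_congr (n := n) (fun i hi => ?_) hs
  simp [ext, hi]

lemma IsLatticeLevy.isEsscherTransform_tiltedPathLaw (hμ : IsLatticeLevy μ) {ψ : ℝ → ℝ}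
    (hone : ∀ t, ∫⁻ w, esscherDensity h (ψ c) c t w ∂μ = 1) :
    IsEsscherTransform ψ c μ (tiltedPathLaw μ (ψ c) c) := by
  intro t A hA
  -- A general `t` is raised to the integer `⌈t⌉`; the density accumulated over the extra time `d`
  -- has mean `1`.
  obtain ⟨d, hd⟩ := exists_add_of_le (Nat.le_ceil t)
  have h1 := hμ.setLIntegral_esscherDensity_add (a := ψ c) (c := c) t d hA MeasurableSet.univ
  rw [preimage_univ, inter_univ, setLIntegral_univ, hone, mul_one, ← hd] at h1
  rw [hμ.tiltedPathLaw_apply_natCast hone ⌈t⌉₊ (coordSigma_mono (Nat.le_ceil t) _ hA), h1]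
  rfl

end Esscher

/-! ### Properties of the exponential change of measure -/

section EsscherProperties

/-- The measure with density `x ↦ e^{cx}` with respect to `ν`. -/
noncomputable def expTilt (ν : Measure ℝ) (c : ℝ) : Measure ℝ :=
  ν.withDensity fun x => ENNReal.ofReal (Real.exp (c * x))

variable {h c : ℝ} {ν : Measure ℝ}

lemma integral_withDensity_ofReal_exp {α : Type*} [MeasurableSpace α] {μ : Measure α} {g : α → ℝ}
    (hg : Measurable g) (f : α → ℝ) :
    ∫ x, f x ∂(μ.withDensity fun x => ENNReal.ofReal (Real.exp (g x))) =
      ∫ x, Real.exp (g x) * f x ∂μ := by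
  rw [integral_withDensity_eq_integral_toReal_smul (by fun_prop)
    (Eventually.of_forall fun x => ENNReal.ofReal_lt_top)]
  exact integral_congr_ae (Eventually.of_forall fun x => by
    simp only [ENNReal.toReal_ofReal (Real.exp_pos _).le, smul_eq_mul])

lemma integral_expTilt (f : ℝ → ℝ) :
    ∫ x, f x ∂(expTilt ν c) = ∫ x, Real.exp (c * x) * f x ∂ν :=
  integral_withDensity_ofReal_exp (by fun_prop) f

lemma expTilt_real_singleton (x : ℝ) :
    (expTilt ν c).real {x} = Real.exp (c * x) * ν.real {x} := by
  rw [measureReal_def, expTilt, withDensity_apply _ (measurableSet_singleton x),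
    lintegral_singleton, ENNReal.toReal_mul, ENNReal.toReal_ofReal (Real.exp_pos _).le]
  rfl

namespace IsSkipFreeMeasure

lemma expTilt (hν : IsSkipFreeMeasure h ν) (hh : 0 < h) (hc : 0 ≤ c) :
    IsSkipFreeMeasure h (expTilt ν c) where
  finite := isFiniteMeasure_withDensity_ofReal (hν.integrable_exp hh hc).2
  zero := withDensity_absolutelyContinuous _ _ hν.zero
  lattice := (withDensity_absolutelyContinuous _ _).ae_le hν.lattice
  pos := by rw [expTilt_real_singleton]; exact mul_pos (Real.exp_pos _) hν.pos

lemma laplaceExponent_eq (hν : IsSkipFreeMeasure h ν) (hh : 0 < h) (hc : 0 ≤ c) :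
    laplaceExponent ν c = ∫ x, Real.exp (c * x) ∂ν - ν.real univ := by
  have := hν.finite
  rw [laplaceExponent, integral_sub (hν.integrable_exp hh hc) (integrable_const _)]
  simp

lemma expTilt_real_univ (hν : IsSkipFreeMeasure h ν) (hh : 0 < h) (hc : 0 ≤ c) :
    (_root_.expTilt ν c).real univ = laplaceExponent ν c + ν.real univ := by
  have h1 := integral_expTilt (ν := ν) (c := c) fun _ => (1 : ℝ)
  rw [integral_const, smul_eq_mul, mul_one] at h1
  rw [h1, hν.laplaceExponent_eq hh hc]
  simp

lemma laplaceExponent_expTilt (hν : IsSkipFreeMeasure h ν) (hh : 0 < h) (hc : 0 ≤ c) {β : ℝ}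
    (hβ : 0 ≤ β) :
    laplaceExponent (_root_.expTilt ν c) β = laplaceExponent ν (β + c) - laplaceExponent ν c := by
  have := hν.finite
  rw [laplaceExponent, integral_expTilt, hν.laplaceExponent_eq hh hc,
    hν.laplaceExponent_eq hh (add_nonneg hβ hc), sub_sub_sub_cancel_right,
    ← integral_sub (hν.integrable_exp hh (add_nonneg hβ hc)) (hν.integrable_exp hh hc)]
  refine integral_congr_ae (Eventually.of_forall fun x => ?_)
  simp only [add_mul, Real.exp_add]
  ring

end IsSkipFreeMeasure

variable {μ ρ : Measure (PathSpace h)}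

lemma lintegral_esscherDensity_eq_one [IsFiniteMeasure ν]
    (hm : ∀ t, μ.map (coord h t) = compoundPoissonLaw ν t)
    (hc : Integrable (fun x => Real.exp (c * x)) ν) (t : ℝ≥0) :
    ∫⁻ w, esscherDensity h (laplaceExponent ν c) c t w ∂μ = 1 := by
  have h1 : ∫⁻ w, esscherDensity h (laplaceExponent ν c) c t w ∂μ =
      ∫⁻ x, ENNReal.ofReal (Real.exp (c * x - laplaceExponent ν c * t))
        ∂(compoundPoissonLaw ν t) := by
    rw [← hm t, lintegral_map (by fun_prop) (measurable_coord h t)]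
    rfl
  have h2 := integral_exp_compoundPoissonLaw hc t
  have h3 := integrable_compoundPoissonLaw hc t
  have e : (fun x : ℝ => Real.exp (c * x - laplaceExponent ν c * t)) =
      fun x => Real.exp (c * x) * Real.exp (-(laplaceExponent ν c * t)) := by
    ext x; rw [← Real.exp_add]; rfl
  rw [h1, ← ofReal_integral_eq_lintegral_ofReal (by rw [e]; exact h3.mul_const _)
    (Eventually.of_forall fun x => (Real.exp_pos _).le), e, integral_mul_const, h2,
    ← Real.exp_add, mul_comm, add_neg_cancel, Real.exp_zero, ENNReal.ofReal_one]

namespace IsEsscherTransform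

variable {ψ : ℝ → ℝ}

lemma isLatticeLevy (hρ : IsEsscherTransform ψ c μ ρ) (hμ : IsLatticeLevy μ)
    (hone : ∀ t, ∫⁻ w, esscherDensity h (ψ c) c t w ∂μ = 1) : IsLatticeLevy ρ where
  prob := ⟨by
    rw [hρ 0 univ MeasurableSet.univ, setLIntegral_univ]
    exact hone 0⟩
  incr s t A hA x := by
    have hB : MeasurableSet[coordSigma h t] {w : PathSpace h | coord h t w = x} :=
      measurable_coord_coordSigma le_rfl (measurableSet_singleton x)
    have hI : MeasurableSet[coordSigma h (s + t)]
        (A ∩ {w : PathSpace h | coord h (s + t) w - coord h s w = x}) :=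
      (coordSigma_mono le_self_add _ hA).inter
        (((measurable_coord_coordSigma le_rfl).sub (measurable_coord_coordSigma le_self_add))
          (measurableSet_singleton x))
    rw [hρ _ _ hI, hρ _ _ hA, hρ _ _ hB]
    exact hμ.setLIntegral_esscherDensity_add s t hA (coordSigma_le h t _ hB)

lemma map_coord (hρ : IsEsscherTransform ψ c μ ρ) (t : ℝ≥0) :
    ρ.map (coord h t) = (μ.map (coord h t)).withDensity fun x =>
      ENNReal.ofReal (Real.exp (c * x - ψ c * t)) := by
  ext B hB
  rw [Measure.map_apply (measurable_coord h t) hB, withDensity_apply _ hB,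
    setLIntegral_map hB (by fun_prop) (measurable_coord h t),
    hρ t _ (measurable_coord_coordSigma le_rfl hB)]

lemma integral_coord (hρ : IsEsscherTransform ψ c μ ρ)
    (hm : ∀ t, μ.map (coord h t) = compoundPoissonLaw ν t) {f : ℝ → ℝ} (hf : Measurable f)
    (t : ℝ≥0) :
    ∫ w, f (coord h t w) ∂ρ =
      Real.exp (-ψ c * t) * ∫ x, Real.exp (c * x) * f x ∂(compoundPoissonLaw ν t) := by
  rw [← integral_map (measurable_coord h t).aemeasurable hf.aestronglyMeasurable, hρ.map_coord,
    hm, integral_withDensity_ofReal_exp (by fun_prop), ← integral_const_mul]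
  refine integral_congr_ae (Eventually.of_forall fun x => ?_)
  simp only
  rw [← mul_assoc, ← Real.exp_add]
  congr 2; ring

/-- Product rule at `t = 0` for `e^{-ψ(c)t} E[e^{cX_t} f(X_t)]`. The generator acts here on `e^{cx}
f(x)`, which is why it was established for functions of exponential growth. -/
lemma hasGenerator (hρ : IsEsscherTransform (laplaceExponent ν) c μ ρ)
    (hm : ∀ t, μ.map (coord h t) = compoundPoissonLaw ν t) (hν : IsSkipFreeMeasure h ν)
    (hh : 0 < h) (hc : 0 ≤ c) : HasGenerator ρ (expTilt ν c) := by
  intro f hf hf1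
  have := hν.finite
  have hi := hν.integrable_exp hh hc
  have hF : Measurable fun x => Real.exp (c * x) * f x := by fun_prop
  have hFb : ∀ x, |Real.exp (c * x) * f x| ≤ Real.exp (c * x) := fun x => by
    rw [abs_mul, Real.abs_exp]
    exact mul_le_of_le_one_right (Real.exp_pos _).le (hf1 x)
  have h1 := tendsto_compoundPoissonLaw_generator hi hF hFb
  have h2 := tendsto_exp_sub_one_div (-laplaceExponent ν c)
  have h3 : Tendsto (fun t : ℝ≥0 => Real.exp (-laplaceExponent ν c * t)) (𝓝[>] 0) (𝓝 1) := by
    have : Continuous fun t : ℝ≥0 => Real.exp (-laplaceExponent ν c * t) := by fun_prop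
    simpa using (this.tendsto 0).mono_left nhdsWithin_le_nhds
  have h4 := (h3.mul h1).add (h2.mul_const (f 0))
  have hFi : Integrable (fun x => Real.exp (c * x) * f x) ν :=
    hi.mono' hF.aestronglyMeasurable (Eventually.of_forall hFb)
  have e : ∫ x, (f x - f 0) ∂(expTilt ν c) =
      1 * ∫ x, (Real.exp (c * x) * f x - Real.exp (c * 0) * f 0) ∂ν +
        -laplaceExponent ν c * f 0 := by
    rw [integral_expTilt, hν.laplaceExponent_eq hh hc]
    simp only [mul_sub]
    rw [integral_sub hFi (hi.mul_const _), integral_sub hFi (integrable_const _),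
      integral_mul_const]
    simp
    ring
  rw [e]
  refine h4.congr fun t => ?_
  rw [hρ.integral_coord hm hf]
  simp only [mul_zero, Real.exp_zero, one_mul]
  ring

lemma lawLaplaceExponent_eq (hρ : IsEsscherTransform (laplaceExponent ν) c μ ρ)
    (hm : ∀ t, μ.map (coord h t) = compoundPoissonLaw ν t) (hν : IsSkipFreeMeasure h ν)
    (hh : 0 < h) (hc : 0 ≤ c) {β : ℝ} (hβ : 0 ≤ β) :
    lawLaplaceExponent ρ β = laplaceExponent (expTilt ν c) β := by
  have := hν.finite
  have h1 := integral_exp_compoundPoissonLaw (hν.integrable_exp hh (add_nonneg hβ hc)) 1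
  have e : (fun x : ℝ => Real.exp (c * x) * Real.exp (β * x)) =
      fun x => Real.exp ((β + c) * x) := by
    ext x; rw [← Real.exp_add]; congr 1; ring
  rw [lawLaplaceExponent, hρ.integral_coord hm (f := fun x => Real.exp (β * x)) (by fun_prop),
    e, h1, ← Real.exp_add, Real.log_exp, hν.laplaceExponent_expTilt hh hc hβ]
  simp
  ring

end IsEsscherTransform

end EsscherProperties

/-! ### The normalized scale function -/

section NormalizedScale

variable {h : ℝ} {μ ρ : Measure (PathSpace h)} {ν : Measure ℝ}

lemma discount_zero (τ : WithTop ℝ≥0) : discount 0 τ = 1 := by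
  rcases τ with _ | u
  · change discount 0 ⊤ = 1
    simp [discount]
  · change Real.exp (-0 * u) = 1
    simp

/-- At rate `0` nothing is discounted, even if the level is never reached, so `passage` is an
indicator. -/
lemma excursionDepth_le_iff {x : ℝ} {w : PathSpace h} :
    excursionDepth h w ≤ (x : EReal) ↔ passage h 0 x h w = 1 := by
  rw [excursionDepth, EReal.neg_le, ← EReal.coe_neg, coe_le_runningInf_iff, passage, discount_zero]
  split_ifs with hc
  · exact iff_of_true hc rfl
  · exact iff_of_false hc zero_ne_one

lemma measureReal_excursionDepth_le [IsFiniteMeasure ρ] (hh : 0 < h) (r : ℕ) :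
    ρ.real {w | excursionDepth h w ≤ (((r : ℝ) * h : ℝ) : EReal)} = passageMean ρ 0 r (1 : ℕ) := by
  have hm := measurable_passage hh le_rfl (x := r * h) (y := h)
    (by have : 0 ≤ (r : ℝ) * h := by positivity
        linarith)
  have hS : MeasurableSet {w : PathSpace h | excursionDepth h w ≤ (((r : ℝ) * h : ℝ) : EReal)} := by
    simp only [excursionDepth_le_iff]
    exact hm (measurableSet_singleton 1)
  rw [← integral_indicator_one hS, passageMean]
  refine integral_congr_ae (Eventually.of_forall fun w => ?_)
  simp only [Int.cast_natCast, Nat.cast_one, Int.cast_one, one_mul]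
  by_cases hw : w ∈ {w : PathSpace h | excursionDepth h w ≤ (((r : ℝ) * h : ℝ) : EReal)}
  · rw [indicator_of_mem hw]
    exact (excursionDepth_le_iff.1 hw).symm
  · rw [indicator_of_notMem hw]
    have h1 : passage h 0 (r * h) h w ≠ 1 := fun h1 => hw (excursionDepth_le_iff.2 h1)
    unfold passage at h1 ⊢
    rw [discount_zero] at h1 ⊢
    split_ifs at h1 ⊢ with hc
    exacts [absurd rfl h1, rfl]

/-- The factor with index `r` is `u(r, 1) = W_r / W_{r+1}`, so the product telescopes. -/
lemma IsLatticeLevy.rawScale_eq (hρ : IsLatticeLevy ρ) (hh : 0 < h) (hg : HasGenerator ρ ν)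
    (hν : IsSkipFreeMeasure h ν) (x : ℝ) :
    rawScale h ρ x = scaleSeq h ν 0 ⌊x / h⌋₊ / scaleSeq h ν 0 0 := by
  have := hρ.prob
  have hpos := hρ.scaleSeq_pos hh hg hν le_rfl
  have key : ∀ n : ℕ, ∏ r ∈ Finset.range n,
      ρ.real {w | excursionDepth h w ≤ (((r : ℝ) * h : ℝ) : EReal)} =
        scaleSeq h ν 0 0 / scaleSeq h ν 0 n := fun n => by
    induction n with
    | zero => simp [(hpos 0).ne']
    | succ n ih =>
      rw [Finset.prod_range_succ, ih, measureReal_excursionDepth_le hh,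
        hρ.passageMean_eq_div hh hg hν le_rfl, div_mul_div_cancel₀ (hpos n).ne']
  rw [rawScale, key, one_div_div]

lemma largestRoot_nonneg (ψ : ℝ → ℝ) (q : ℝ) : 0 ≤ largestRoot ψ q :=
  Real.sSup_nonneg fun _ hβ => hβ.1

/-- The largest root is nonnegative, so the transform involves the exponent on `[0, ∞)` only; it is
only there that the two forms of the exponent are compared. -/
lemma HasScaleLaplaceTransform.congr_exponent {ψ ψ' f : ℝ → ℝ} {q : ℝ}
    (hf : HasScaleLaplaceTransform h ψ q f) (hψ : ∀ β, 0 ≤ β → ψ' β = ψ β) :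
    HasScaleLaplaceTransform h ψ' q f := by
  have h1 : largestRoot ψ' q = largestRoot ψ q := by
    unfold largestRoot
    congr 1
    ext β
    exact and_congr_right fun hβ => by rw [hψ β hβ]
  intro β hβ
  rw [hψ β ((largestRoot_nonneg ψ' q).trans hβ.le)]
  exact hf β (h1 ▸ hβ)

/-- `W_0` is an admissible constant, and the transform at a single `β`, being nonzero, determines
the constant. -/
lemma IsLatticeLevy.scaleConst_eq (hρ : IsLatticeLevy ρ) (hh : 0 < h) (hg : HasGenerator ρ ν)
    (hν : IsSkipFreeMeasure h ν) (hψ : ∀ β, 0 ≤ β → lawLaplaceExponent ρ β = laplaceExponent ν β) :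
    scaleConst h ρ = scaleSeq h ν 0 0 := by
  have hs := hρ.isScaleSequence hh hg hν le_rfl
  have h0 := hs.pos 0
  have h1 : HasScaleLaplaceTransform h (laplaceExponent ν) 0
      fun x => scaleSeq h ν 0 0 * rawScale h ρ x := by
    have e : (fun x => scaleSeq h ν 0 0 * rawScale h ρ x) = fun x => scaleSeq h ν 0 ⌊x / h⌋₊ := by
      ext x
      rw [hρ.rawScale_eq hh hg hν, mul_div_cancel₀ _ h0.ne']
    rw [e]
    exact hs.hasScaleLaplaceTransform hh hν
  have hex : ∃ k : ℝ, 0 < k ∧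
      HasScaleLaplaceTransform h (lawLaplaceExponent ρ) 0 (fun x => k * rawScale h ρ x) :=
    ⟨_, h0, h1.congr_exponent hψ⟩
  rw [scaleConst, dif_pos hex]
  have h2 := hex.choose_spec.2.congr_exponent fun β hβ => (hψ β hβ).symm
  set β := largestRoot (laplaceExponent ν) 0 + 1 with hβ
  have hlt : largestRoot (laplaceExponent ν) 0 < β := by linarith
  have hβ0 : 0 < β := (largestRoot_nonneg _ _).trans_lt hlt
  have e1 := (h1 β hlt).2
  have e2 := (h2 β hlt).2
  have hψβ : 0 < laplaceExponent ν β :=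
    hs.lt_laplaceExponent hh hν (by rwa [← hs.largestRoot_eq hh hν])
  have hexp : 0 < Real.exp (β * h) - 1 := by
    rw [sub_pos, Real.one_lt_exp_iff]; positivity
  have hR : 0 < (Real.exp (β * h) - 1) / (β * h * (laplaceExponent ν β - 0)) := by
    rw [sub_zero]; positivity
  simp only [mul_left_comm (Real.exp _), integral_const_mul] at e1 e2
  rw [← e2] at e1
  refine (mul_right_cancel₀ (fun hz => ?_) e1).symm
  rw [hz, mul_zero] at e2
  exact hR.ne e2

lemma IsLatticeLevy.scaleFunction_eq (hρ : IsLatticeLevy ρ) (hh : 0 < h) (hg : HasGenerator ρ ν)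
    (hν : IsSkipFreeMeasure h ν) (hψ : ∀ β, 0 ≤ β → lawLaplaceExponent ρ β = laplaceExponent ν β)
    (x : ℝ) : scaleFunction h ρ x = scaleSeq h ν 0 ⌊x / h⌋₊ := by
  rw [scaleFunction, hρ.scaleConst_eq hh hg hν hψ, hρ.rawScale_eq hh hg hν,
    mul_div_cancel₀ _ (hρ.scaleSeq_pos hh hg hν le_rfl 0).ne']

/-- The exponential change of measure reduces the killing rate `ψ(c)` to `0`. -/
lemma IsSkipFreeMeasure.exp_mul_scaleSeq_expTilt (hν : IsSkipFreeMeasure h ν) (hh : 0 < h) {c : ℝ}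
    (hc : 0 ≤ c) (n : ℕ) :
    Real.exp (c * (n + 1) * h) * scaleSeq h (_root_.expTilt ν c) 0 n =
      scaleSeq h ν (laplaceExponent ν c) n := by
  have hν' := hν.expTilt hh hc
  refine eq_scaleSeq hν (N := n)
    (V := fun k => Real.exp (c * (k + 1) * h) * scaleSeq h (_root_.expTilt ν c) 0 k) ?_
    (fun k _ => ?_) n le_rfl
  -- The exponent is `k + 1` rather than `k` so that the initial values match: the tilted atom at
  -- `h` has mass `e^{ch} ν{h}`.
  · rw [scaleSeq_zero, scaleSeq_zero, expTilt_real_singleton]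
    simp only [Nat.cast_zero, zero_add, mul_one]
    have := (Real.exp_pos (c * h)).ne'
    have := hν.pos.ne'
    field_simp
  · have h1 := scaleSeq_succ (q := 0) hν' k
    -- The tilted measure has total mass `ν(ℝ) + ψ(c)`, so its recurrence at rate `0` is the one of
    -- `ν` at rate `ψ(c)`.
    rw [hν.expTilt_real_univ hh hc, expTilt_real_singleton] at h1
    have e1 : Real.exp (c * ((k + 1 : ℕ) + 1) * h) =
        Real.exp (c * (k + 1) * h) * Real.exp (c * h) := by
      rw [← Real.exp_add]; congr 1; push_cast; ring
    have e2 : ∑ i ∈ Finset.range (k + 1), ν.real {-(i * h)} *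
        (Real.exp (c * ((k - i : ℕ) + 1) * h) * scaleSeq h (_root_.expTilt ν c) 0 (k - i)) =
        Real.exp (c * (k + 1) * h) * ∑ i ∈ Finset.range (k + 1),
          (_root_.expTilt ν c).real {-(i * h)} * scaleSeq h (_root_.expTilt ν c) 0 (k - i) := by
      rw [Finset.mul_sum]
      refine Finset.sum_congr rfl fun i hi => ?_
      have hik : i ≤ k := by have := Finset.mem_range.1 hi; omega
      have e3 : Real.exp (c * ((k - i : ℕ) + 1) * h) =
          Real.exp (c * (k + 1) * h) * Real.exp (c * -(i * h)) := by
        rw [← Real.exp_add]; congr 1; rw [Nat.cast_sub hik]; ring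
      rw [expTilt_real_singleton, e3]
      ring
    rw [e1, e2]
    linear_combination Real.exp (c * (k + 1) * h) * h1

end NormalizedScale

/-- The link between the definition through `P_{Φ(q)}` and the recurrence. It rests on `ψ(Φ(q)) =
q`, by which the tilt trades the killing rate `q` for `0`. -/
lemma IsUpwardsSkipFreeLevyChain.qScaleFunction_eq {Ω : Type*} [mΩ : MeasurableSpace Ω]
    {P : Measure Ω} [IsProbabilityMeasure P] {𝔽 : Filtration ℝ≥0 mΩ} {X : ℝ≥0 → Ω → ℝ} {h : ℝ}
    {ν : Measure ℝ} (hX : IsUpwardsSkipFreeLevyChain P 𝔽 X h ν) {q : ℝ} (hq : 0 ≤ q) {x : ℝ}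
    (hx : 0 ≤ x) : qScaleFunction h ν (pathLaw P h X) q x = scaleSeq h ν q ⌊x / h⌋₊ := by
  have hh := hX.h_pos
  have hν := hX.isSkipFreeMeasure
  have := hν.finite
  have hμ := hX.isLatticeLevy
  have hm := hX.map_coord_pathLaw
  have hs := hμ.isScaleSequence hh (hasGenerator_of_map_coord hm) hν hq
  have hc := largestRoot_nonneg (laplaceExponent ν) q
  have hψ : laplaceExponent ν (largestRoot (laplaceExponent ν) q) = q := by
    rw [hs.largestRoot_eq hh hν]
    exact hs.laplaceExponent_neg_log_scaleRatio hh hν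
  rw [qScaleFunction]
  generalize largestRoot (laplaceExponent ν) q = c at hc hψ ⊢
  have hone := lintegral_esscherDensity_eq_one hm (hν.integrable_exp hh hc)
  have hex : ∃ ρ, IsEsscherTransform (laplaceExponent ν) c (pathLaw P h X) ρ :=
    ⟨_, hμ.isEsscherTransform_tiltedPathLaw hone⟩
  have hρ : IsEsscherTransform (laplaceExponent ν) c (pathLaw P h X)
      (esscherMeasure (laplaceExponent ν) c (pathLaw P h X)) := by
    rw [esscherMeasure, dif_pos hex]
    exact hex.choose_spec
  rw [(hρ.isLatticeLevy hμ hone).scaleFunction_eq hh (hρ.hasGenerator hm hν hh hc)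
    (hν.expTilt hh hc) fun β hβ => hρ.lawLaplaceExponent_eq hm hν hh hc hβ]
  -- The `1` inside the floor supplies the exponent `c (n + 1) h` of `exp_mul_scaleSeq_expTilt`.
  have hfl : ⌊1 + x / h⌋₊ = ⌊x / h⌋₊ + 1 := by
    rw [add_comm, Nat.floor_add_one (div_nonneg hx hh.le)]
  rw [hfl, Nat.cast_succ, hν.exp_mul_scaleSeq_expTilt hh hc, hψ]

theorem mainTheorem2 {Ω : Type*} [mΩ : MeasurableSpace Ω] (P : Measure Ω) [IsProbabilityMeasure P]
    (𝔽 : Filtration ℝ≥0 mΩ) (X : ℝ≥0 → Ω → ℝ) (h : ℝ) (ν : Measure ℝ)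
    (hX : IsUpwardsSkipFreeLevyChain P 𝔽 X h ν) (q : ℝ) (hq : 0 ≤ q) :
    IsScaleSolution h (laplaceExponent ν) q (qScaleFunction h ν (pathLaw P h X) q) ∧
    (∀ f : ℝ → ℝ, IsScaleSolution h (laplaceExponent ν) q f →
      EqOn f (qScaleFunction h ν (pathLaw P h X) q) (Ici 0)) ∧
    ∀ (n : ℕ) (x : ℝ), 0 ≤ x →
      ∫ ω, {ω | ((-x : ℝ) : EReal) ≤ runningInf X (firstEntrance X (n * h) ω) ω}.indicator
          (fun ω => discount q (firstEntrance X (n * h) ω)) ω ∂P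
        = qScaleFunction h ν (pathLaw P h X) q x
          / qScaleFunction h ν (pathLaw P h X) q (x + n * h) := by
  have hh := hX.h_pos
  have hν := hX.isSkipFreeMeasure
  have := hν.finite
  have hμ := hX.isLatticeLevy
  have hg := hasGenerator_of_map_coord hX.map_coord_pathLaw
  have hsol : IsScaleSolution h (laplaceExponent ν) q (qScaleFunction h ν (pathLaw P h X) q) :=
    ((hμ.isScaleSequence hh hg hν hq).isScaleSolution hh hν).congr fun x hx =>
      (hX.qScaleFunction_eq hq hx).symm
  refine ⟨hsol, fun f hf => hf.eqOn hsol, fun n x hx => ?_⟩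
  have hn : (0 : ℝ) ≤ n * h := by positivity
  have hfl : ⌊(x + n * h) / h⌋₊ = ⌊x / h⌋₊ + n := by
    rw [add_div, mul_div_cancel_right₀ _ hh.ne', Nat.floor_add_natCast (div_nonneg hx hh.le)]
  rw [hX.integral_indicator_eq hq (by linarith), passage_floor hh q hx,
    hX.qScaleFunction_eq hq hx, hX.qScaleFunction_eq hq (add_nonneg hx hn), hfl,
    ← hμ.passageMean_eq_div hh hg hν hq]
  simp only [passageMean, Int.cast_natCast]
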